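/- **Definitions.** Work in $\widehat{\mathbb R^d}=\mathbb R^d\cup\{\infty\}$; the Möbius group is the group generated by all inversions in spheres and hyperplanes. Let $\mathcal P\subset\mathbb R^{d+1}$ be an edge-scribed polytope (all vertices lie outside the unit sphere $\mathbb S^d$ and every edge is tangent to $\mathbb S^d$). The stereographic projections (from the north pole $e_{d+1}$) of the caps $\{x\in\mathbb S^d:\langle v,x\rangle\ge 1\}$, $v$ a vertex of $\mathcal P$, form the ball-arrangement projection of $\mathcal P$; its dual spheres are the projections of the sections of $\mathbb S^d$ by the affine hulls of the facets of $\mathcal P$. A *polytopal packing* $\mathcal B$ is an image of a ball-arrangement projection under a Möbius transformation, which also carries the dual spheres; its *Apollonian group* $\mathsf A(\mathcal B)$ is generated by the inversions in the dual spheres, and its *Apollonian packing* is $\Omega(\mathcal B)=\mathsf A(\mathcal B)\cdot\mathcal B$. It is orthoplicial ($d=3$), resp. tetrahedral, octahedral, cubical ($d=2$), if $\mathcal P$ has the combinatorial type of the 4-dimensional cross polytope, resp. the tetrahedron, octahedron, cube. An *Apollonian section* of $\Omega(\mathcal B)$ is a set $\Gamma\cdot X$ with a subgroup $\Gamma\le\mathsf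 A(\mathcal B)$ and $X\subseteq\mathcal B$. Sections $\Gamma\cdot X$, $\Gamma'\cdot X'$ are *algebraically equivalent* if there are a group isomorphism $\phi:\Gamma\to\Gamma'$ and a bijection $\psi:\Gamma\cdot X\to\Gamma'\cdot X'$ with $\psi(g\cdot b)=\phi(g)\cdot\psi(b)$ for all $g\in\Gamma$, $b\in X$. An Apollonian packing $\Omega(\mathcal B)$ is regarded as the section $\mathsf A(\mathcal B)\cdot\mathcal B$ of itself. **Theorem.** Every orthoplicial Apollonian packing contains Apollonian sections that are algebraically equivalent to a tetrahedral, to an octahedral and to a cubical Apollonian disk packing. Explicitly: (a) Let $\mathcal B_0=\{b_{\pm1},\dots,b_{\pm4}\}$ be the ball-arrangement projection of the orthoplex with vertices $v_1=(0,0,1,1)$, $v_2=(0,0,-1,1)$, $v_3=(1,1,0,0)$, $v_4=(-1,1,0,0)$, $v_{-i}=-v_i$, and let $s_{ijkl}$ denote the inversion in the dual sphere of the facet with vertices $v_i,v_j,v_k,v_l$ (bars denote minus signs). Every orthoplicial packing is the image of $\mathcal B_0$ under a Möbius transformation that conjugates $\mathsf A(\mathcal B_0)$ to its Apollonian group. *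 Let $X_{\mathcal T}=\{b_1,b_2,b_3,b_4\}$, $\Gamma_{\mathcal T}=\langle s_{\overline1234},s_{1\overline234},s_{12\overline34},s_{123\overline4}\rangle$ and let $H$ be the plane $\{y=1\}$. * Let $X_{\mathcal O}=\mathcal B_0\setminus\{b_4,b_{-4}\}$, let $\Gamma_{\mathcal O}$ be generated by the eight elements $t_{ijk}=s_{ijk4}s_{ijk\overline4}$, $i=\pm1$, $j=\pm2$, $k=\pm3$, and let $H$ be the plane $\{x=y\}$. In each case, after $H\cup\{\infty\}$ is identified isometrically with $\widehat{\mathbb R^2}$, the sets $b\cap H$, $b\in X$, are the disks of a tetrahedral, resp. octahedral, disk packing $\mathcal B'$; restriction to $H$ is an isomorphism $\phi:\Gamma\to\mathsf A(\mathcal B')$; and $b\mapsto b\cap H$ is a bijection $\Gamma\cdot X\to\Omega(\mathcal B')$ that is equivariant with respect to $\phi$. (b) Let $\mathcal B_1$ be the ball-arrangement projection of the orthoplex with vertices $v_1=\tfrac1{\sqrt2}(1,1,1,1)$, $v_2=\tfrac1{\sqrt2}(1,-1,1,-1)$, $v_3=\tfrac1{\sqrt2}(1,-1,-1,1)$, $v_4=\tfrac1{\sqrt2}(1,1,-1,-1)$,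 $v_{-i}=-v_i$. Every orthoplicial packing is the image of $\mathcal B_1$ under a Möbius transformation that conjugates $\mathsf A(\mathcal B_1)$ to its Apollonian group. Let $\Gamma_{\mathcal C}\le\mathsf A(\mathcal B_1)$ be generated by the six inversions $s_{12\overline{34}},s_{1\overline{23}4},s_{\overline{12}34},s_{\overline123\overline4},s_{\overline12\overline34},s_{1\overline23\overline4}$. The orthogonal projection $\pi:\mathbb R^4\to\mathbb R^3$ along the first coordinate axis maps the vertices of the orthoplex bijectively onto those of an edge-scribed cube; let $\mathcal B_{\mathcal C^3}$ be its ball-arrangement projection. Then, with an isometric identification of the plane $\{x=0\}\cup\{\infty\}$ with $\widehat{\mathbb R^2}$, restriction to this plane is an isomorphism $\phi:\Gamma_{\mathcal C}\to\mathsf A(\mathcal B_{\mathcal C^3})$, and $g\cdot b_v\mapsto\phi(g)\cdot b_{\pi(v)}$ is a well-defined bijection $\Gamma_{\mathcal C}\cdot\mathcal B_1\to\Omega(\mathcal B_{\mathcal C^3})$. -/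

import Mathlib

/-!  Polytopal ball packings, their Apollonian groups, and Apollonian sections. -/

noncomputable section

namespace ApollonianPacking

/-- Euclidean `d`-space. -/
abbrev Euc (d : ℕ) : Type := EuclideanSpace ℝ (Fin d)

/-- The extended Euclidean space `ℝ^d ∪ {∞}`. -/
abbrev RHat (d : ℕ) : Type := OnePoint (Euc d)

/-! ### Inversions and Möbius transformations -/

open Classical in
/-- The inversion of `ℝ^d ∪ {∞}` in the sphere with centre `c` and radius `r`, as a map:
it exchanges `c` and `∞`. -/
def sphereInversionFun {d : ℕ} (c : Euc d) (r : ℝ) (p : RHat d) : RHat d :=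
  p.elim (c : RHat d)
    (fun x => if x = c then OnePoint.infty else (EuclideanGeometry.inversion c r x : Euc d))

theorem sphereInversionFun_involutive {d : ℕ} (c : Euc d) {r : ℝ} (hr : r ≠ 0) :
    Function.Involutive (sphereInversionFun c r) := by
  intro p
  induction p using OnePoint.rec with
  | infty => simp [sphereInversionFun]
  | coe x =>
    by_cases hx : x = c
    · simp [sphereInversionFun, hx]
    · simp [sphereInversionFun, hx, EuclideanGeometry.inversion_eq_center hr,
        EuclideanGeometry.inversion_inversion c hr]

/-- The inversion of `ℝ^d ∪ {∞}` in the sphere with centre `c` and radius `r`. -/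
def sphereInversion {d : ℕ} (c : Euc d) (r : ℝ) (hr : r ≠ 0) : Equiv.Perm (RHat d) :=
  (sphereInversionFun_involutive c hr).toPerm

/-- The reflection of `ℝ^d ∪ {∞}` in the hyperplane `⟪n, x⟫ = k`, as a map: it fixes `∞`. -/
def planeReflectionFun {d : ℕ} (n : Euc d) (k : ℝ) (p : RHat d) : RHat d :=
  p.elim OnePoint.infty (fun x => ((x - (2 * (inner ℝ n x - k)) • n : Euc d) : RHat d))

theorem planeReflectionFun_involutive {d : ℕ} (n : Euc d) (k : ℝ) (hn : ‖n‖ = 1) :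
    Function.Involutive (planeReflectionFun n k) := by
  intro p
  induction p using OnePoint.rec with
  | infty => simp [planeReflectionFun]
  | coe x =>
    simp only [planeReflectionFun, OnePoint.elim_some, OnePoint.some_eq_iff,
      inner_sub_right, inner_smul_right, real_inner_self_eq_norm_sq, hn]
    module

/-- The reflection of `ℝ^d ∪ {∞}` in the hyperplane `⟪n, x⟫ = k`, where `n` is a unit vector. -/
def planeReflection {d : ℕ} (n : Euc d) (k : ℝ) (hn : ‖n‖ = 1) : Equiv.Perm (RHat d) :=
  (planeReflectionFun_involutive n k hn).toPerm

/-- `f` is the inversion in `s`, where `s` is a generalized sphere of `ℝ^d ∪ {∞}`: a Euclidean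
sphere of positive radius, or a hyperplane together with `∞`. -/
def IsInversionIn {d : ℕ} (s : Set (RHat d)) (f : Equiv.Perm (RHat d)) : Prop :=
  (∃ (c : Euc d) (r : ℝ) (hr : 0 < r),
      s = (fun x : Euc d => (x : RHat d)) '' Metric.sphere c r ∧ f = sphereInversion c r hr.ne') ∨
  (∃ (n : Euc d) (k : ℝ) (hn : ‖n‖ = 1),
      s = insert OnePoint.infty ((fun x : Euc d => (x : RHat d)) '' {x | inner ℝ n x = k}) ∧
      f = planeReflection n k hn)

/-- The Möbius group of `ℝ^d ∪ {∞}`, generated by all inversions. -/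
def mobiusGroup (d : ℕ) : Subgroup (Equiv.Perm (RHat d)) :=
  Subgroup.closure {f | ∃ s, IsInversionIn s f}

/-- The inverse of the stereographic projection from the north pole `e_{d+1}` of the unit sphere
of `ℝ^{d+1}` onto `ℝ^d ∪ {∞}`. -/
def invStereo {d : ℕ} (p : RHat d) : Euc (d + 1) :=
  p.elim (EuclideanSpace.single (Fin.last d) 1)
    (fun x => WithLp.toLp 2 (Fin.snoc (α := fun _ => ℝ)
      (fun i => 2 * x i / (‖x‖ ^ 2 + 1)) ((‖x‖ ^ 2 - 1) / (‖x‖ ^ 2 + 1))))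

/-! ### Polytopes, given by their (labelled) vertices -/

/-- `S` is the set of labels of the vertices of a face (the empty one and the polytope itself
included) of the convex hull of the points `v i`. -/
def IsFace {ι : Type} {d : ℕ} (v : ι → Euc d) (S : Set ι) : Prop :=
  ∃ (a : Euc d) (c : ℝ), (∀ i, inner ℝ a (v i) ≤ c) ∧ ∀ i, i ∈ S ↔ inner ℝ a (v i) = c

/-- `S` is the set of labels of the vertices of a facet: a maximal proper face. -/
def IsFacet {ι : Type} {d : ℕ} (v : ι → Euc d) (S : Set ι) : Prop :=
  IsFace v S ∧ S ≠ Set.univ ∧ ∀ T, IsFace v T → S ⊆ T → T = S ∨ T = Set.univ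

/-- All vertices lie outside the unit sphere and every edge is tangent to it. (A segment with end
points outside the ball is tangent to the sphere iff it meets the sphere in exactly one point.) -/
def IsEdgeScribed {ι : Type} {d : ℕ} (v : ι → Euc d) : Prop :=
  (∀ i, 1 < ‖v i‖) ∧
  ∀ i j, i ≠ j → IsFace v {i, j} → ∃ p, segment ℝ (v i) (v j) ∩ Metric.sphere 0 1 = {p}

/-- The vertices of a regular tetrahedron. -/
def tetrahedron (i : Fin 4) : Euc 3 :=
  ![!₂[1, 1, 1], !₂[1, -1, -1], !₂[-1, 1, -1], !₂[-1, -1, 1]] i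

/-- The vertices `± e_i` of the regular `n`-dimensional cross polytope. -/
def crossPolytope (n : ℕ) (i : Fin n × ℤˣ) : Euc n :=
  EuclideanSpace.single i.1 ((i.2 : ℤ) : ℝ)

/-- The vertices `(±1, …, ±1)` of the `n`-dimensional cube. -/
def cube (n : ℕ) (e : Fin n → ℤˣ) : Euc n :=
  WithLp.toLp 2 (fun k => ((e k : ℤ) : ℝ))

/-! ### Polytopal packings -/

/-- A polytopal `d`-ball packing whose tangency polytope has the combinatorial type of the polytope
with vertices `v₀`: the image under a Möbius transformation `mob` of the ball-arrangement projection
of an edge-scribed polytope, with vertices `vertex i`, that has the same faces as the one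
with vertices `v₀ i`. -/
structure PolytopalPacking {ι : Type} {d : ℕ} (v₀ : ι → Euc (d + 1)) where
  vertex : ι → Euc (d + 1)
  sameFaces : ∀ S : Set ι, IsFace vertex S ↔ IsFace v₀ S
  edgeScribed : IsEdgeScribed vertex
  mob : Equiv.Perm (RHat d)
  mob_mem : mob ∈ mobiusGroup d

namespace PolytopalPacking

variable {ι : Type} {d : ℕ} {v₀ : ι → Euc (d + 1)}

/-- The ball of the vertex `v = vertex i`: the points `x` of the unit sphere which are illuminated
from `v` are those with `⟪v, x⟫ ≥ 1`. -/
def ball (P : PolytopalPacking v₀) (i : ι) : Set (RHat d) :=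
  P.mob '' {p | 1 ≤ inner ℝ (P.vertex i) (invStereo p)}

/-- The packing, as a set of balls. -/
def balls (P : PolytopalPacking v₀) : Set (Set (RHat d)) :=
  Set.range P.ball

/-- The dual sphere of the face with vertex labels `S` (meant for facets). The ball of the vertex
`y` of the polar polytope that corresponds to a facet is bounded by the section of the unit sphere
by the hyperplane `⟪y, x⟫ = 1`, and this hyperplane is the affine hull of the facet. -/
def dualSphere (P : PolytopalPacking v₀) (S : Set ι) : Set (RHat d) :=
  P.mob '' {p | invStereo p ∈ affineSpan ℝ (P.vertex '' S)}

/-- The Apollonian group, generated by the inversions in the dual spheres of all facets. -/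
def apollonianGroup (P : PolytopalPacking v₀) : Subgroup (Equiv.Perm (RHat d)) :=
  Subgroup.closure {f | ∃ S, IsFacet P.vertex S ∧ IsInversionIn (P.dualSphere S) f}

end PolytopalPacking

/-- `Γ · X`, for a set `X` of subsets of `ℝ^d ∪ {∞}`. -/
def orbitOf {d : ℕ} (Γ : Subgroup (Equiv.Perm (RHat d))) (X : Set (Set (RHat d))) :
    Set (Set (RHat d)) :=
  {b' | ∃ g ∈ Γ, ∃ b ∈ X, b' = g '' b}

/-- The Apollonian packing (Apollonian cluster) of a polytopal packing. -/
def PolytopalPacking.cluster {ι : Type} {d : ℕ} {v₀ : ι → Euc (d + 1)}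
    (P : PolytopalPacking v₀) : Set (Set (RHat d)) :=
  orbitOf P.apollonianGroup P.balls

/-- The data of an Apollonian section `Γ · X` of the Apollonian packing of `P`. -/
structure ApollonianSection {ι : Type} {d : ℕ} {v₀ : ι → Euc (d + 1)}
    (P : PolytopalPacking v₀) where
  group : Subgroup (Equiv.Perm (RHat d))
  group_le : group ≤ P.apollonianGroup
  seeds : Set (Set (RHat d))
  seeds_subset : seeds ⊆ P.balls

/-- The set of balls `Γ · X`. -/
def ApollonianSection.carrier {ι : Type} {d : ℕ} {v₀ : ι → Euc (d + 1)}
    {P : PolytopalPacking v₀} (S : ApollonianSection P) : Set (Set (RHat d)) :=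
  orbitOf S.group S.seeds

/-- The whole Apollonian packing as a section of itself. -/
def PolytopalPacking.full {ι : Type} {d : ℕ} {v₀ : ι → Euc (d + 1)}
    (P : PolytopalPacking v₀) : ApollonianSection P where
  group := P.apollonianGroup
  group_le := le_rfl
  seeds := P.balls
  seeds_subset := subset_rfl

/-- Algebraic equivalence of Apollonian sections: an isomorphism of the groups and an equivariant
bijection of the sets of balls. -/
def AlgebraicallyEquivalent {ι ι' : Type} {d d' : ℕ} {v₀ : ι → Euc (d + 1)}
    {v₀' : ι' → Euc (d' + 1)} {P : PolytopalPacking v₀} {P' : PolytopalPacking v₀'}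
    (S : ApollonianSection P) (S' : ApollonianSection P') : Prop :=
  ∃ (φ : S.group ≃* S'.group) (ψ : Set (RHat d) → Set (RHat d')),
    Set.BijOn ψ S.carrier S'.carrier ∧
    ∀ g : S.group, ∀ b ∈ S.seeds,
      ψ ((g : Equiv.Perm (RHat d)) '' b) = (φ g : Equiv.Perm (RHat d')) '' ψ b

/-- The Apollonian packing of `P` contains an Apollonian section which is algebraically equivalent
to an Apollonian packing whose tangency polytope has the type of `v₀'`. -/
def HasSectionOfType {ι ι' : Type} {d d' : ℕ} {v₀ : ι → Euc (d + 1)}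
    (P : PolytopalPacking v₀) (v₀' : ι' → Euc (d' + 1)) : Prop :=
  ∃ (S : ApollonianSection P) (P' : PolytopalPacking v₀'), AlgebraicallyEquivalent S P'.full

/-- Some Möbius transformation carries `P` to `P'` and the Apollonian group of `P` to that
of `P'`. -/
def MobiusEquivalent {ι : Type} {d : ℕ} {v₀ : ι → Euc (d + 1)}
    (P P' : PolytopalPacking v₀) : Prop :=
  ∃ ν ∈ mobiusGroup d, (fun b : Set (RHat d) => ν '' b) '' P.balls = P'.balls ∧
    P.apollonianGroup.map (MulAut.conj ν).toMonoidHom = P'.apollonianGroup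

/-- An isometric embedding `j` of a Euclidean space, with `∞ ↦ ∞`. -/
def extend {d d' : ℕ} (j : Euc d →ᵃⁱ[ℝ] Euc d') (p : RHat d) : RHat d' :=
  p.elim OnePoint.infty (fun x => ((j x : Euc d') : RHat d'))

/-- `S` is a planar cross section giving the Apollonian packing of `P'`. The plane is the image of
`j`, identified by `j` with `ℝ^d' ∪ {∞}`: intersecting with the plane maps the balls of `S.seeds`
onto those of `P'`, restricting to the plane is an isomorphism of `S.group` with the Apollonian
group of `P'`, and intersecting with the plane is an equivariant bijection of `S` with the
Apollonian packing of `P'`. -/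
def IsCrossSection {ι ι' : Type} {d d' : ℕ} {v₀ : ι → Euc (d + 1)}
    {v₀' : ι' → Euc (d' + 1)} {P : PolytopalPacking v₀} (S : ApollonianSection P)
    (j : Euc d' →ᵃⁱ[ℝ] Euc d) (P' : PolytopalPacking v₀') : Prop :=
  (fun b => extend j ⁻¹' b) '' S.seeds = P'.balls ∧
  ∃ φ : S.group ≃* P'.apollonianGroup,
    (∀ (g : S.group) (p : RHat d'), (g : Equiv.Perm (RHat d)) (extend j p) =
      extend j ((φ g : Equiv.Perm (RHat d')) p)) ∧
    Set.BijOn (fun b => extend j ⁻¹' b) S.carrier P'.cluster ∧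
    ∀ g : S.group, ∀ b ∈ S.seeds,
      extend j ⁻¹' ((g : Equiv.Perm (RHat d)) '' b) =
        (φ g : Equiv.Perm (RHat d')) '' (extend j ⁻¹' b)

/-! ### Orthoplicial packings. The vertex of label `±i`, `i = 1, 2, 3, 4`, is indexed by
`(i - 1, ±1)`. -/

/-- The vertices of the standard orthoplicial sphere packing. -/
def standardOrthoplex (i : Fin 4 × ℤˣ) : Euc 4 :=
  (((i.2 : ℤ) : ℝ)) •
    ![!₂[0, 0, 1, 1], !₂[0, 0, -1, 1], !₂[1, 1, 0, 0], !₂[-1, 1, 0, 0]] i.1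

/-- The vertices `(±1, ±1, ±1, ±1) / √2` with an even number of minus signs. -/
def demiOrthoplex (i : Fin 4 × ℤˣ) : Euc 4 :=
  (((i.2 : ℤ) : ℝ) / √2) •
    ![!₂[1, 1, 1, 1], !₂[1, -1, 1, -1], !₂[1, -1, -1, 1], !₂[1, 1, -1, -1]] i.1

/-- The facet of an orthoplex with the vertices `e_1 1, e_2 2, e_3 3, e_4 4`. -/
def signFacet (e : Fin 4 → ℤˣ) : Set (Fin 4 × ℤˣ) :=
  Set.range (fun i => (i, e i))

/-- `f` is the inversion `s_e` in the dual sphere of the facet `signFacet e`. -/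
def IsFacetInversion (B : PolytopalPacking (crossPolytope 4)) (e : Fin 4 → ℤˣ)
    (f : Equiv.Perm (RHat 3)) : Prop :=
  IsInversionIn (B.dualSphere (signFacet e)) f

/-- The orthographic projection `ℝ⁴ → ℝ³` along the first coordinate axis. -/
def dropFirst (x : Euc 4) : Euc 3 := !₂[x 1, x 2, x 3]

end ApollonianPacking

end

open ApollonianPacking

namespace ApollonianPacking

/-! ### The Lorentz model of `ℝ^d ∪ {∞}` -/

/-! Everything is moved to the Lorentz space ℝ^{d+1,1}. A point of ℝ^d ∪ {∞} becomes a future null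
ray, a ball or a generalized sphere is given by a unit spacelike normal vector, and an inversion
becomes the Lorentzian reflection in that vector. The Möbius transformations are exactly the
permutations induced by linear isometries (`exists_lifts_of_mem_mobiusGroup`,
`Lifts.mem_mobiusGroup`). For d ≥ 1 the isometry is unique (`Lifts.unique`) and a ball determines
its unit normal (`half_injective`), so questions about balls and groups become linear algebra.

Uniqueness of orthoplicial packings: tangency of an edge says that the normalized vectors (v, 1) of
its ends have product -1. For an orthoplex this forces them to be e₀ ± √2 eᵢ for a Lorentz
orthonormal frame (`exists_frame`). Any two such frames differ by a Lorentz transformation, so all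
orthoplicial packings are Möbius equivalent. Sections are transported by conjugation
(`MobiusEquivalent.hasSectionOfType`), and it is enough to exhibit each of them in one model.

Sections by planes: a plane corresponds to the orthogonal complement of a unit vector h. If the
generators of Γ preserve this complement, act on it as the generators of the planar group, and act
on h by a character of the restricted map, then restriction is an isomorphism: a trivial restriction
forces the map to fix both the complement and h. In the tetrahedral and the cubical case the
generators are reflections in vectors orthogonal to h, and the character is trivial. In the
octahedral case a generator is the product of the reflections in the orthogonal vectors (n ± h)/√2;
it is -1 on the span of n and h, so it restricts to the reflection in n, and the character is the
determinant. When the balls are orthogonal to the plane, their normals lie in the complement and a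
ball is recovered from its section.

The cubical balls are not orthogonal to the plane: their normals are ±h/√2 plus the lift of a cube
vertex. Since Γ fixes h, the bijection exists as soon as the planar orbit never identifies different
cube vertices, as it would lose the sign otherwise. This is a colouring argument: √2 times the space
part of a normal has integer entries, whose classes modulo 4 are invariant under the cubical
Apollonian group (`IsCongruent`). -/

/-- The space `ℝ^{d+1,1}`: space coordinates and a time coordinate. -/
abbrev Lorentz (d : ℕ) : Type := Euc (d + 1) × ℝ

/-- The Lorentzian inner product. -/
noncomputable def mink {d : ℕ} : Lorentz d →ₗ[ℝ] Lorentz d →ₗ[ℝ] ℝ :=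
  LinearMap.mk₂ ℝ (fun x y => inner ℝ x.1 y.1 - x.2 * y.2)
    (fun x y z => by simp [inner_add_left]; ring)
    (fun c x y => by simp [inner_smul_left]; ring)
    (fun x y z => by simp [inner_add_right]; ring)
    (fun c x y => by simp [inner_smul_right]; ring)

theorem mink_apply {d : ℕ} (x y : Lorentz d) : mink x y = inner ℝ x.1 y.1 - x.2 * y.2 := rfl

theorem mink_comm {d : ℕ} (x y : Lorentz d) : mink x y = mink y x := by
  simp [mink_apply, real_inner_comm, mul_comm]

theorem eq_zero_of_mink {d : ℕ} {x : Lorentz d} (h : ∀ y, mink x y = 0) : x = 0 := by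
  have h1 := h (x.1, 0)
  have h2 := h (0, x.2)
  simp [mink_apply] at h1 h2
  exact Prod.ext h1 h2

/-- The point `(β, α)` of `ℝ^d × ℝ = ℝ^{d+1}`. -/
noncomputable def vec {d : ℕ} (β : Euc d) (α : ℝ) : Euc (d + 1) :=
  WithLp.toLp 2 (Fin.snoc (α := fun _ => ℝ) (fun i => β i) α)

@[simp] theorem vec_castSucc {d : ℕ} (β : Euc d) (α : ℝ) (i : Fin d) :
    vec β α i.castSucc = β i := by
  simp [vec]

@[simp] theorem vec_last {d : ℕ} (β : Euc d) (α : ℝ) : vec β α (Fin.last d) = α := by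
  simp [vec]

theorem exists_eq_vec {d : ℕ} (x : Euc (d + 1)) : ∃ β α, x = vec (d := d) β α := by
  refine ⟨WithLp.toLp 2 fun i => x i.castSucc, x (Fin.last d), ?_⟩
  ext i
  refine Fin.lastCases ?_ (fun i => ?_) i <;> simp

theorem inner_vec {d : ℕ} (β β' : Euc d) (α α' : ℝ) :
    inner ℝ (vec β α) (vec β' α') = inner ℝ β β' + α * α' := by
  simp [PiLp.inner_apply, Fin.sum_univ_castSucc, mul_comm]

theorem vec_inj {d : ℕ} {β β' : Euc d} {α α' : ℝ} : vec β α = vec β' α' ↔ β = β' ∧ α = α' := by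
  refine ⟨fun h => ⟨?_, ?_⟩, fun h => by rw [h.1, h.2]⟩
  · ext i
    simpa using congrArg (fun x : Euc (d + 1) => x i.castSucc) h
  · simpa using congrArg (fun x : Euc (d + 1) => x (Fin.last d)) h

theorem smul_vec {d : ℕ} (c : ℝ) (β : Euc d) (α : ℝ) : c • vec β α = vec (c • β) (c * α) := by
  ext i
  refine Fin.lastCases ?_ (fun i => ?_) i <;> simp

theorem add_vec {d : ℕ} (β β' : Euc d) (α α' : ℝ) :
    vec β α + vec β' α' = vec (β + β') (α + α') := by
  ext i
  refine Fin.lastCases ?_ (fun i => ?_) i <;> simp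

theorem invStereo_infty {d : ℕ} : invStereo (OnePoint.infty : RHat d) = vec 0 1 := by
  ext i
  refine Fin.lastCases ?_ (fun i => ?_) i
  · simp [invStereo]
  · simp [invStereo, Fin.castSucc_ne_last]

theorem invStereo_coe {d : ℕ} (x : Euc d) : invStereo (x : RHat d) =
    vec ((2 / (‖x‖ ^ 2 + 1)) • x) ((‖x‖ ^ 2 - 1) / (‖x‖ ^ 2 + 1)) := by
  ext i
  refine Fin.lastCases ?_ (fun i => ?_) i
  · simp [invStereo]
  · simp [invStereo]; ring

/-- The future null vector of a point of `ℝ^d ∪ {∞}`. -/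
noncomputable def nullVec {d : ℕ} (p : RHat d) : Lorentz d := (invStereo p, 1)

theorem nullVec_infty {d : ℕ} : nullVec (OnePoint.infty : RHat d) = (vec 0 1, 1) := by
  rw [nullVec, invStereo_infty]

/-- Clearing the denominator of the stereographic projection gives a representative of the null ray
that is polynomial in `x`; the later explicit checks use this one. -/
theorem smul_nullVec_coe {d : ℕ} (x : Euc d) : (‖x‖ ^ 2 + 1) • nullVec (x : RHat d) =
    (vec ((2 : ℝ) • x) (‖x‖ ^ 2 - 1), ‖x‖ ^ 2 + 1) := by
  have : ‖x‖ ^ 2 + 1 ≠ 0 := by positivity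
  rw [nullVec, invStereo_coe, Prod.smul_mk, smul_vec, smul_smul]
  refine Prod.ext ?_ (by simp)
  simp only [vec_inj]
  refine ⟨?_, ?_⟩
  · congr 1; field_simp
  · field_simp

theorem nullVec_coe {d : ℕ} (x : Euc d) : nullVec (x : RHat d) =
    (‖x‖ ^ 2 + 1)⁻¹ • (vec ((2 : ℝ) • x) (‖x‖ ^ 2 - 1), ‖x‖ ^ 2 + 1) := by
  have : ‖x‖ ^ 2 + 1 ≠ 0 := by positivity
  rw [← smul_nullVec_coe, smul_smul, inv_mul_cancel₀ this, one_smul]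

theorem mink_nullVec_infty {d : ℕ} (β : Euc d) (α t : ℝ) :
    mink (vec β α, t) (nullVec OnePoint.infty) = α - t := by
  simp [nullVec_infty, mink_apply, inner_vec]

theorem mink_nullVec_coe {d : ℕ} (β : Euc d) (α t : ℝ) (x : Euc d) :
    mink (vec β α, t) (nullVec (x : RHat d)) =
      (‖x‖ ^ 2 + 1)⁻¹ * ((α - t) * ‖x‖ ^ 2 + 2 * inner ℝ β x - (α + t)) := by
  rw [nullVec_coe, map_smul, mink_apply, inner_vec, smul_eq_mul, inner_smul_right]
  ring

theorem mink_nullVec_coe_coe {d : ℕ} (x y : Euc d) :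
    (‖x‖ ^ 2 + 1) * (‖y‖ ^ 2 + 1) * mink (nullVec (x : RHat d)) (nullVec (y : RHat d)) =
      - 2 * ‖x - y‖ ^ 2 := by
  have : ‖x‖ ^ 2 + 1 ≠ 0 := by positivity
  have : ‖y‖ ^ 2 + 1 ≠ 0 := by positivity
  rw [nullVec_coe x, map_smul, LinearMap.smul_apply, mink_nullVec_coe, norm_sub_sq_real,
    inner_smul_left, smul_eq_mul]
  simp
  field_simp
  ring

theorem mink_nullVec_infty_coe {d : ℕ} (x : Euc d) :
    (‖x‖ ^ 2 + 1) * mink (nullVec (OnePoint.infty : RHat d)) (nullVec (x : RHat d)) = - 2 := by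
  have : ‖x‖ ^ 2 + 1 ≠ 0 := by positivity
  rw [nullVec_infty, mink_nullVec_coe]
  simp
  field_simp
  norm_num

@[simp] theorem mink_nullVec_self {d : ℕ} (p : RHat d) : mink (nullVec p) (nullVec p) = 0 := by
  induction p using OnePoint.rec with
  | infty => nth_rewrite 1 [nullVec_infty]; rw [mink_nullVec_infty]; simp
  | coe x =>
    have h := mink_nullVec_coe_coe x x
    have : ‖x‖ ^ 2 + 1 ≠ 0 := by positivity
    simpa [this] using h

/-- Up to a positive factor the product is -‖x - y‖², or -2 if one of the points is ∞. Distinct null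
rays are never orthogonal. -/
theorem mink_nullVec_neg {d : ℕ} {p q : RHat d} (h : p ≠ q) :
    mink (nullVec p) (nullVec q) < 0 := by
  induction p using OnePoint.rec with
  | infty =>
    induction q using OnePoint.rec with
    | infty => exact absurd rfl h
    | coe y =>
      have h1 := mink_nullVec_infty_coe y
      have : 0 < ‖y‖ ^ 2 + 1 := by positivity
      nlinarith
  | coe x =>
    induction q using OnePoint.rec with
    | infty =>
      have h1 := mink_nullVec_infty_coe x
      have : 0 < ‖x‖ ^ 2 + 1 := by positivity
      rw [mink_comm]
      nlinarith
    | coe y =>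
      have h1 := mink_nullVec_coe_coe x y
      have : 0 < (‖x‖ ^ 2 + 1) * (‖y‖ ^ 2 + 1) := by positivity
      have h2 : x - y ≠ 0 := fun hh => h (by rw [sub_eq_zero.1 hh])
      have : 0 < ‖x - y‖ ^ 2 := by positivity
      by_contra! hc
      have := mul_nonneg (le_of_lt ‹0 < (‖x‖ ^ 2 + 1) * (‖y‖ ^ 2 + 1)›) hc
      linarith

theorem nullVec_smul_inj {d : ℕ} {p q : RHat d} {c : ℝ} (hc : nullVec p = c • nullVec q) :
    p = q := by
  by_contra h
  have := mink_nullVec_neg h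
  rw [hc] at this
  simp at this

theorem exists_invStereo_eq {d : ℕ} (ω : Euc (d + 1)) (hω : ‖ω‖ = 1) :
    ∃ p : RHat d, invStereo p = ω := by
  obtain ⟨β, α, rfl⟩ := exists_eq_vec ω
  have h1 : ‖β‖ ^ 2 + α ^ 2 = 1 := by
    have := inner_vec β β α α
    rw [real_inner_self_eq_norm_sq, real_inner_self_eq_norm_sq, hω] at this
    linarith
  by_cases hα : α = 1
  · refine ⟨OnePoint.infty, ?_⟩
    rw [invStereo_infty, vec_inj]
    refine ⟨?_, hα.symm⟩
    have : ‖β‖ = 0 := by rw [hα] at h1; nlinarith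
    exact (norm_eq_zero.1 this).symm
  · have h2 : 1 - α ≠ 0 := fun h => hα (by linarith)
    refine ⟨((1 - α)⁻¹ • β : Euc d), ?_⟩
    have h3 : ‖(1 - α)⁻¹ • β‖ ^ 2 + 1 = 2 / (1 - α) := by
      rw [norm_smul, mul_pow, Real.norm_eq_abs, sq_abs]
      field_simp
      linear_combination h1
    rw [invStereo_coe, vec_inj, show ‖(1 - α)⁻¹ • β‖ ^ 2 - 1 =
      (‖(1 - α)⁻¹ • β‖ ^ 2 + 1) - 2 by ring, h3, smul_smul]
    constructor
    · rw [show (2 / (2 / (1 - α)) * (1 - α)⁻¹ : ℝ) = 1 by field_simp, one_smul]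
    · field_simp
      ring

theorem exists_smul_nullVec {d : ℕ} {y : Lorentz d} (h0 : mink y y = 0) (ht : 0 < y.2) :
    ∃ p, y = y.2 • nullVec p := by
  have h1 : ‖y.1‖ = y.2 := by
    rw [mink_apply, real_inner_self_eq_norm_sq] at h0
    have := norm_nonneg y.1
    nlinarith
  obtain ⟨p, hp⟩ := exists_invStereo_eq (d := d) (y.2⁻¹ • y.1) (by
    rw [norm_smul, h1, Real.norm_eq_abs, abs_of_pos (inv_pos.2 ht), inv_mul_cancel₀ ht.ne'])
  refine ⟨p, Prod.ext ?_ ?_⟩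
  · simp [nullVec, hp, smul_smul, ht.ne']
  · simp [nullVec]

/-- The generalized sphere with the normal vector `n`. -/
def zeroSet {d : ℕ} (n : Lorentz d) : Set (RHat d) := {p | mink n (nullVec p) = 0}

/-- The ball with the normal vector `n`. -/
def half {d : ℕ} (n : Lorentz d) : Set (RHat d) := {p | 0 ≤ mink n (nullVec p)}

theorem half_smul {d : ℕ} (n : Lorentz d) {c : ℝ} (hc : 0 < c) : half (c • n) = half n := by
  ext p
  simp [half, mul_nonneg_iff_of_pos_left hc]

/-! ### Lorentz isometries and the permutations they induce -/

/-- `L` is a linear isometry of the Lorentz space that induces `f`. -/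
def Lifts {d : ℕ} (L : Lorentz d ≃ₗ[ℝ] Lorentz d) (f : Equiv.Perm (RHat d)) : Prop :=
  (∀ x y, mink (L x) (L y) = mink x y) ∧
    ∀ p, ∃ c : ℝ, 0 < c ∧ L (nullVec p) = c • nullVec (f p)

theorem Lifts.one {d : ℕ} : Lifts (1 : Lorentz d ≃ₗ[ℝ] Lorentz d) 1 :=
  ⟨fun _ _ => rfl, fun p => ⟨1, one_pos, by simp⟩⟩

theorem Lifts.mul {d : ℕ} {L L' : Lorentz d ≃ₗ[ℝ] Lorentz d} {f f' : Equiv.Perm (RHat d)}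
    (h : Lifts L f) (h' : Lifts L' f') : Lifts (L * L') (f * f') := by
  refine ⟨fun x y => by simp [h.1, h'.1], fun p => ?_⟩
  obtain ⟨c', hc', e'⟩ := h'.2 p
  obtain ⟨c, hc, e⟩ := h.2 (f' p)
  exact ⟨c' * c, mul_pos hc' hc, by simp [e', e, smul_smul]⟩

theorem Lifts.inv {d : ℕ} {L : Lorentz d ≃ₗ[ℝ] Lorentz d} {f : Equiv.Perm (RHat d)}
    (h : Lifts L f) : Lifts L⁻¹ f⁻¹ := by
  have hi : ∀ x, L (L⁻¹ x) = x := fun x => L.apply_symm_apply x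
  refine ⟨fun x y => by rw [← h.1, hi, hi], fun p => ?_⟩
  obtain ⟨c, hc, e⟩ := h.2 (f⁻¹ p)
  refine ⟨c⁻¹, inv_pos.2 hc, L.injective ?_⟩
  rw [hi, map_smul, e, smul_smul, inv_mul_cancel₀ hc.ne', one_smul]
  simp

theorem Lifts.perm_unique {d : ℕ} {L : Lorentz d ≃ₗ[ℝ] Lorentz d} {f f' : Equiv.Perm (RHat d)}
    (h : Lifts L f) (h' : Lifts L f') : f = f' := by
  refine Equiv.ext fun p => ?_
  obtain ⟨c, hc, e⟩ := h.2 p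
  obtain ⟨c', hc', e'⟩ := h'.2 p
  rw [e] at e'
  refine nullVec_smul_inj (c := c⁻¹ * c') ?_
  rw [mul_smul, ← e', smul_smul, inv_mul_cancel₀ hc.ne', one_smul]

/-- The average of (ω, 1) and (-ω, 1) is the time axis; subtracting it leaves every space direction.
-/
theorem span_nullVec {d : ℕ} : Submodule.span ℝ (Set.range (nullVec (d := d))) = ⊤ := by
  rw [Submodule.eq_top_iff']
  have key : ∀ ω : Euc (d + 1), ‖ω‖ = 1 →
      ((ω, 1) : Lorentz d) ∈ Submodule.span ℝ (Set.range (nullVec (d := d))) := by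
    intro ω hω
    obtain ⟨p, rfl⟩ := exists_invStereo_eq ω hω
    exact Submodule.subset_span ⟨p, rfl⟩
  have h1 : ((0, 1) : Lorentz d) ∈ Submodule.span ℝ (Set.range (nullVec (d := d))) := by
    have hv : ‖(EuclideanSpace.single 0 1 : Euc (d + 1))‖ = 1 := by simp
    have := Submodule.smul_mem _ (1 / 2 : ℝ)
      (Submodule.add_mem _ (key _ hv) (key (-EuclideanSpace.single 0 1) (by rw [norm_neg, hv])))
    convert this using 1
    ext i <;> simp
    norm_num
  have h2 : ∀ ω : Euc (d + 1),
      ((ω, 0) : Lorentz d) ∈ Submodule.span ℝ (Set.range (nullVec (d := d))) := by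
    intro ω
    by_cases h : ω = 0
    · subst h; exact Submodule.zero_mem _
    · have hn : ‖ω‖ ≠ 0 := norm_ne_zero_iff.2 h
      have := Submodule.smul_mem _ ‖ω‖
        (Submodule.sub_mem _ (key (‖ω‖⁻¹ • ω) (by rw [norm_smul]; simp [hn])) h1)
      convert this using 1
      ext i <;> simp [hn]
  intro x
  have := Submodule.add_mem _ (h2 x.1) (Submodule.smul_mem _ x.2 h1)
  convert this using 1
  ext i <;> simp

/-- Each null vector is an eigenvector, and invariance of the form gives `c p * c q = 1` for
distinct points. With three points all factors equal 1, and null vectors span. Three points exist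
because d ≥ 1. -/
theorem Lifts.eq_one {d : ℕ} [NeZero d] {L : Lorentz d ≃ₗ[ℝ] Lorentz d} (h : Lifts L 1) :
    L = 1 := by
  choose c hc e using h.2
  have h1 : ∀ p q, p ≠ q → c p * c q = 1 := by
    intro p q hpq
    have h2 := h.1 (nullVec p) (nullVec q)
    rw [e, e] at h2
    simp only [Equiv.Perm.coe_one, id_eq, map_smul, LinearMap.smul_apply, smul_eq_mul] at h2
    exact mul_right_cancel₀ (mink_nullVec_neg hpq).ne (by linarith)
  have h3 : ∀ p, c p = 1 := by
    intro p
    obtain ⟨q, hq⟩ : ∃ q, q ≠ p := ⟨_, (Classical.choose_spec (exists_ne p))⟩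
    obtain ⟨r, hr⟩ : ∃ r : RHat d, r ∉ ({p, q} : Set (RHat d)) := by
      have : Infinite (Euc d) := inferInstance
      exact (Set.Finite.infinite_compl (Set.toFinite {p, q})).nonempty
    simp only [Set.mem_insert_iff, Set.mem_singleton_iff, not_or] at hr
    have a := h1 p q hq.symm
    have b := h1 p r (Ne.symm hr.1)
    have d := h1 q r (Ne.symm hr.2)
    have hq' : c q = c r := mul_left_cancel₀ (hc p).ne' (a.trans b.symm)
    rw [← hq'] at d
    have := hc q
    have : c q = 1 := by nlinarith
    rw [this] at a
    linarith
  apply LinearEquiv.toLinearMap_injective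
  apply LinearMap.ext_on_range (span_nullVec (d := d))
  intro p
  simpa [h3] using e p

theorem Lifts.unique {d : ℕ} [NeZero d] {L L' : Lorentz d ≃ₗ[ℝ] Lorentz d}
    {f : Equiv.Perm (RHat d)} (h : Lifts L f) (h' : Lifts L' f) : L = L' := by
  have := (h'.inv.mul h)
  rw [inv_mul_cancel] at this
  exact (inv_mul_eq_one.1 this.eq_one).symm

theorem Lifts.image_half {d : ℕ} {L : Lorentz d ≃ₗ[ℝ] Lorentz d} {f : Equiv.Perm (RHat d)}
    (h : Lifts L f) (n : Lorentz d) : f '' half n = half (L n) := by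
  ext q
  rw [Equiv.image_eq_preimage_symm]
  obtain ⟨c, hc, e⟩ := h.2 (f.symm q)
  rw [Equiv.apply_symm_apply] at e
  simp only [Set.mem_preimage, half, Set.mem_ofPred_eq]
  rw [← h.1, e, map_smul, smul_eq_mul, mul_nonneg_iff_of_pos_left hc]

theorem Lifts.image_zeroSet {d : ℕ} {L : Lorentz d ≃ₗ[ℝ] Lorentz d} {f : Equiv.Perm (RHat d)}
    (h : Lifts L f) (n : Lorentz d) : f '' zeroSet n = zeroSet (L n) := by
  ext q
  rw [Equiv.image_eq_preimage_symm]
  obtain ⟨c, hc, e⟩ := h.2 (f.symm q)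
  rw [Equiv.apply_symm_apply] at e
  simp only [Set.mem_preimage, zeroSet, Set.mem_ofPred_eq]
  rw [← h.1, e, map_smul, smul_eq_mul, mul_eq_zero]
  simp [hc.ne']

/-- The reflection in the orthogonal complement of a unit vector. -/
noncomputable def refl {d : ℕ} (n : Lorentz d) (hn : mink n n = 1) : Lorentz d ≃ₗ[ℝ] Lorentz d :=
  Module.reflection (x := n) (f := (2 : ℝ) • mink n) (by simp [hn])

theorem refl_apply {d : ℕ} (n : Lorentz d) (hn : mink n n = 1) (x : Lorentz d) :
    refl n hn x = x - (2 * mink n x) • n := by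
  simp [refl, Module.reflection_apply]

theorem mink_refl {d : ℕ} (n : Lorentz d) (hn : mink n n = 1) (x y : Lorentz d) :
    mink (refl n hn x) (refl n hn y) = mink x y := by
  simp only [refl_apply, map_sub, map_smul, LinearMap.sub_apply, LinearMap.smul_apply, hn,
    smul_eq_mul, mink_comm x n]
  ring

/-- Needed for the octahedral section, where the character on `h` is the determinant of the
restricted map. -/
theorem det_refl {d : ℕ} (n : Lorentz d) (hn : mink n n = 1) :
    ((LinearEquiv.det (refl n hn) : ℝˣ) : ℝ) = -1 := by
  have : (refl n hn : Lorentz d →ₗ[ℝ] Lorentz d) =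
      LinearMap.transvection ((-2 : ℝ) • mink n) n := by
    ext x <;> simp [refl_apply, LinearMap.transvection, sub_eq_add_neg]
  rw [LinearEquiv.coe_det, this, LinearMap.transvection.det]
  simp [hn]
  norm_num

/-! ### Inversions as Lorentzian reflections -/

/-- Allows null vectors to be replaced by any positive multiples, in particular by the polynomial
representatives. -/
theorem lifts_of_smul {d : ℕ} {L : Lorentz d ≃ₗ[ℝ] Lorentz d} {f : Equiv.Perm (RHat d)}
    (h : ∀ x y, mink (L x) (L y) = mink x y)
    (h' : ∀ p, ∃ a b : ℝ, 0 < a ∧ 0 < b ∧ L (a • nullVec p) = b • nullVec (f p)) :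
    Lifts L f := by
  refine ⟨h, fun p => ?_⟩
  obtain ⟨a, b, ha, hb, e⟩ := h' p
  refine ⟨a⁻¹ * b, mul_pos (inv_pos.2 ha) hb, ?_⟩
  rw [mul_smul, ← e, map_smul, smul_smul, inv_mul_cancel₀ ha.ne', one_smul]

theorem mink_vec {d : ℕ} (β β' : Euc d) (α α' t t' : ℝ) :
    mink (vec β α, t) (vec β' α', t') = inner ℝ β β' + α * α' - t * t' := by
  rw [mink_apply, inner_vec]

/-- The normal vector of a Euclidean sphere. -/
noncomputable def sphereNormal {d : ℕ} (c : Euc d) (r : ℝ) : Lorentz d :=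
  r⁻¹ • (vec (-c) ((1 - ‖c‖ ^ 2 + r ^ 2) / 2), (-1 - ‖c‖ ^ 2 + r ^ 2) / 2)

/-- The normal vector of a hyperplane. -/
noncomputable def planeNormal {d : ℕ} (ν : Euc d) (k : ℝ) : Lorentz d := (vec ν k, k)

theorem mink_sphereNormal {d : ℕ} (c : Euc d) {r : ℝ} (hr : r ≠ 0) :
    mink (sphereNormal c r) (sphereNormal c r) = 1 := by
  simp only [sphereNormal, map_smul, LinearMap.smul_apply, mink_vec, inner_neg_neg,
    real_inner_self_eq_norm_sq, smul_eq_mul]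
  field_simp
  ring

theorem mink_planeNormal {d : ℕ} {ν : Euc d} (k : ℝ) (hν : ‖ν‖ = 1) :
    mink (planeNormal ν k) (planeNormal ν k) = 1 := by
  simp [planeNormal, mink_vec, hν]

theorem mink_sphereNormal_coe {d : ℕ} (c : Euc d) (r : ℝ) (x : Euc d) :
    mink (sphereNormal c r) ((‖x‖ ^ 2 + 1) • nullVec (x : RHat d)) =
      r⁻¹ * (‖x - c‖ ^ 2 - r ^ 2) := by
  simp only [smul_nullVec_coe, sphereNormal, map_smul, LinearMap.smul_apply, mink_vec,
    inner_neg_left, inner_smul_right, smul_eq_mul, norm_sub_sq_real, real_inner_comm x c]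
  ring

theorem mink_sphereNormal_infty {d : ℕ} (c : Euc d) (r : ℝ) :
    mink (sphereNormal c r) (nullVec (OnePoint.infty : RHat d)) = r⁻¹ := by
  simp only [sphereNormal, map_smul, LinearMap.smul_apply, mink_nullVec_infty, smul_eq_mul]
  ring

theorem mink_planeNormal_coe {d : ℕ} (ν : Euc d) (k : ℝ) (x : Euc d) :
    mink (planeNormal ν k) ((‖x‖ ^ 2 + 1) • nullVec (x : RHat d)) =
      2 * (inner ℝ ν x - k) := by
  simp only [smul_nullVec_coe, planeNormal, mink_vec, inner_smul_right]
  ring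

theorem mem_zeroSet_coe {d : ℕ} (n : Lorentz d) (x : Euc d) :
    (x : RHat d) ∈ zeroSet n ↔ mink n ((‖x‖ ^ 2 + 1) • nullVec (x : RHat d)) = 0 := by
  have : ‖x‖ ^ 2 + 1 ≠ 0 := by positivity
  simp [zeroSet, this]

theorem zeroSet_sphereNormal {d : ℕ} (c : Euc d) {r : ℝ} (hr : 0 < r) :
    zeroSet (sphereNormal c r) = (fun x : Euc d => (x : RHat d)) '' Metric.sphere c r := by
  ext p
  induction p using OnePoint.rec with
  | infty => simp [zeroSet, mink_sphereNormal_infty, hr.ne']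
  | coe x =>
    rw [mem_zeroSet_coe, mink_sphereNormal_coe]
    simp [hr.ne', sub_eq_zero, hr.le]

theorem zeroSet_planeNormal {d : ℕ} (ν : Euc d) (k : ℝ) :
    zeroSet (planeNormal ν k) =
      insert OnePoint.infty ((fun x : Euc d => (x : RHat d)) '' {x | inner ℝ ν x = k}) := by
  ext p
  induction p using OnePoint.rec with
  | infty => simp [zeroSet, planeNormal, mink_nullVec_infty]
  | coe x =>
    rw [mem_zeroSet_coe, mink_planeNormal_coe]
    simp [sub_eq_zero]

theorem lifts_planeReflection {d : ℕ} {ν : Euc d} (k : ℝ) (hν : ‖ν‖ = 1) :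
    Lifts (refl (planeNormal ν k) (mink_planeNormal k hν)) (planeReflection ν k hν) := by
  refine lifts_of_smul (mink_refl _ _) fun p => ?_
  induction p using OnePoint.rec with
  | infty =>
    refine ⟨1, 1, one_pos, one_pos, ?_⟩
    rw [one_smul, one_smul, refl_apply, planeNormal, mink_nullVec_infty]
    simp [planeReflection, planeReflectionFun]
  | coe x =>
    set y : Euc d := x - (2 * (inner ℝ ν x - k)) • ν with hy
    have h1 : planeReflection ν k hν (x : RHat d) = (y : RHat d) := rfl
    have h2 : ‖y‖ ^ 2 = ‖x‖ ^ 2 - 4 * (inner ℝ ν x - k) * k := by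
      rw [hy, norm_sub_sq_real, norm_smul, mul_pow, hν, inner_smul_right, Real.norm_eq_abs, sq_abs,
        real_inner_comm ν x]
      ring
    refine ⟨‖x‖ ^ 2 + 1, ‖y‖ ^ 2 + 1, by positivity, by positivity, ?_⟩
    rw [refl_apply, mink_planeNormal_coe, h1, smul_nullVec_coe, smul_nullVec_coe, planeNormal,
      sub_eq_add_neg, ← neg_smul, Prod.smul_mk, Prod.mk_add_mk, smul_vec, add_vec, h2]
    refine Prod.ext (vec_inj.2 ⟨?_, ?_⟩) ?_
    · rw [hy]; module
    · ring
    · simp; ring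

theorem lifts_sphereInversion {d : ℕ} (c : Euc d) {r : ℝ} (hr : 0 < r) :
    Lifts (refl (sphereNormal c r) (mink_sphereNormal c hr.ne')) (sphereInversion c r hr.ne') := by
  refine lifts_of_smul (mink_refl _ _) fun p => ?_
  induction p using OnePoint.rec with
  | infty =>
    have h1 : sphereInversion c r hr.ne' OnePoint.infty = (c : RHat d) := rfl
    refine ⟨1, (r ^ 2)⁻¹ * (‖c‖ ^ 2 + 1), one_pos, by positivity, ?_⟩
    rw [one_smul, refl_apply, mink_sphereNormal_infty, h1, mul_smul (r ^ 2)⁻¹, smul_nullVec_coe,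
      nullVec_infty, sphereNormal, smul_smul,
      sub_eq_add_neg, ← neg_smul, Prod.smul_mk, Prod.mk_add_mk, smul_vec, add_vec, Prod.smul_mk,
      smul_vec]
    refine Prod.ext (vec_inj.2 ⟨?_, ?_⟩) ?_
    · match_scalars; field_simp
    · field_simp; ring
    · simp; field_simp; ring
  | coe x =>
    by_cases hx : x = c
    · subst hx
      have h1 : sphereInversion x r hr.ne' (x : RHat d) = OnePoint.infty := by
        simp [sphereInversion, sphereInversionFun]
      refine ⟨‖x‖ ^ 2 + 1, r ^ 2, by positivity, by positivity, ?_⟩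
      rw [refl_apply, mink_sphereNormal_coe, h1, smul_nullVec_coe,
        nullVec_infty, sphereNormal, smul_smul,
        sub_eq_add_neg, ← neg_smul, Prod.smul_mk, Prod.mk_add_mk, smul_vec, add_vec, Prod.smul_mk,
        smul_vec, sub_self, norm_zero]
      refine Prod.ext (vec_inj.2 ⟨?_, ?_⟩) ?_
      · match_scalars; field_simp; norm_num
      · field_simp; ring
      · simp; field_simp; ring
    · have hxc : 0 < ‖x - c‖ := norm_pos_iff.2 (sub_ne_zero.2 hx)
      set y : Euc d := (r ^ 2 / ‖x - c‖ ^ 2) • (x - c) + c with hy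
      have h1 : sphereInversion c r hr.ne' (x : RHat d) = (y : RHat d) := by
        simp [sphereInversion, sphereInversionFun, hx, EuclideanGeometry.inversion, hy,
          dist_eq_norm, div_pow]
      have h3 : inner ℝ (x - c) c = (‖x‖ ^ 2 - ‖c‖ ^ 2 - ‖x - c‖ ^ 2) / 2 := by
        rw [norm_sub_sq_real, inner_sub_left, real_inner_self_eq_norm_sq]; ring
      have h2 : ‖x - c‖ ^ 2 * ‖y‖ ^ 2 = r ^ 4 + r ^ 2 * (‖x‖ ^ 2 - ‖c‖ ^ 2 - ‖x - c‖ ^ 2) +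
          ‖x - c‖ ^ 2 * ‖c‖ ^ 2 := by
        rw [hy, norm_add_sq_real, norm_smul, mul_pow, inner_smul_left, Real.norm_eq_abs, sq_abs,
          h3]
        simp
        field_simp
      refine ⟨‖x‖ ^ 2 + 1, (‖x - c‖ ^ 2 / r ^ 2) * (‖y‖ ^ 2 + 1), by positivity, by positivity, ?_⟩
      rw [refl_apply, mink_sphereNormal_coe, h1, mul_smul (‖x - c‖ ^ 2 / r ^ 2), smul_nullVec_coe,
          smul_nullVec_coe,
        sphereNormal, smul_smul,
        sub_eq_add_neg, ← neg_smul, Prod.smul_mk, Prod.mk_add_mk, smul_vec, add_vec, Prod.smul_mk,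
        smul_vec]
      refine Prod.ext (vec_inj.2 ⟨?_, ?_⟩) ?_
      · rw [hy]
        match_scalars
        · field_simp
        · field_simp
          ring
      · field_simp
        linear_combination -h2
      · simp
        field_simp
        linear_combination -h2

theorem mink_neg_neg {d : ℕ} (x y : Lorentz d) : mink (-x) (-y) = mink x y := by
  simp

theorem refl_neg {d : ℕ} (n : Lorentz d) (hn : mink n n = 1) (hn' : mink (-n) (-n) = 1) :
    refl (-n) hn' = refl n hn := by
  ext1 x
  simp [refl_apply]

theorem zeroSet_smul {d : ℕ} (n : Lorentz d) {c : ℝ} (hc : c ≠ 0) :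
    zeroSet (c • n) = zeroSet n := by
  ext p
  simp [zeroSet, hc]

theorem IsInversionIn.exists_normal {d : ℕ} {s : Set (RHat d)} {f : Equiv.Perm (RHat d)}
    (h : IsInversionIn s f) :
    ∃ (n : Lorentz d) (hn : mink n n = 1), s = zeroSet n ∧ Lifts (refl n hn) f := by
  rcases h with ⟨c, r, hr, rfl, rfl⟩ | ⟨ν, k, hν, rfl, rfl⟩
  · exact ⟨_, _, (zeroSet_sphereNormal c hr).symm, lifts_sphereInversion c hr⟩
  · exact ⟨_, _, (zeroSet_planeNormal ν k).symm, lifts_planeReflection k hν⟩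

/-- The product with the null vector of ∞ is `α - t`. If it vanishes the sphere passes through ∞ and
is a hyperplane; otherwise it has centre -β/(α - t) and radius 1/|α - t|, and its normal agrees with
the given one up to sign. -/
theorem exists_inversion {d : ℕ} (n : Lorentz d) (hn : mink n n = 1) :
    ∃ f, IsInversionIn (zeroSet n) f ∧ Lifts (refl n hn) f := by
  obtain ⟨a, t⟩ := n
  obtain ⟨β, α, rfl⟩ := exists_eq_vec a
  have hn' := hn
  rw [mink_vec, real_inner_self_eq_norm_sq] at hn'
  by_cases h : α = t
  · subst h
    have hβ : ‖β‖ = 1 := by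
      have := norm_nonneg β
      nlinarith
    exact ⟨planeReflection β α hβ,
      Or.inr ⟨β, α, hβ, zeroSet_planeNormal β α, rfl⟩, lifts_planeReflection α hβ⟩
  · have hk : α - t ≠ 0 := sub_ne_zero.2 h
    have key : ∀ s : ℝ, s = |α - t|⁻¹ → s * (α - t) = 1 ∨ s * (α - t) = -1 := by
      rintro s rfl
      rcases abs_choice (α - t) with h | h <;> rw [h]
      · left; field_simp
      · right; field_simp
    set c : Euc d := -(α - t)⁻¹ • β with hc
    set r : ℝ := |α - t|⁻¹ with hr
    have hr0 : 0 < r := by positivity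
    have hcn : ‖c‖ ^ 2 = ‖β‖ ^ 2 / (α - t) ^ 2 := by
      rw [hc, norm_smul, mul_pow, Real.norm_eq_abs, sq_abs]; field_simp
    have hr2 : r ^ 2 = 1 / (α - t) ^ 2 := by
      rw [hr, inv_pow, sq_abs, one_div]
    have e : sphereNormal c r = (r * (α - t))⁻¹ • (vec β α, t) := by
      rw [sphereNormal, mul_inv, mul_smul]
      congr 1
      rw [Prod.smul_mk, smul_vec]
      refine Prod.ext (vec_inj.2 ⟨?_, ?_⟩) ?_
      · rw [hc]; module
      · simp only [hcn, hr2]; field_simp; linear_combination - hn'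
      · simp only [hcn, hr2, smul_eq_mul]; field_simp; linear_combination - hn'
    refine ⟨sphereInversion c r hr0.ne', Or.inl ⟨c, r, hr0, ?_, rfl⟩, ?_⟩
    · rw [← zeroSet_sphereNormal c hr0, e, zeroSet_smul _ (inv_ne_zero (mul_ne_zero hr0.ne' hk))]
    · have h1 := lifts_sphereInversion c hr0
      rcases key r rfl with h2 | h2
      · have e' : sphereNormal c r = (vec β α, t) := by rw [e, h2]; simp
        convert h1 using 2
        exact e'.symm
      · have e' : sphereNormal c r = -(vec β α, t) := by rw [e, h2]; ext <;> simp
        convert h1 using 1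
        rw [← refl_neg _ hn (by rw [mink_neg_neg, hn])]
        congr 1
        exact e'.symm

/-! ### A ball determines its normal vector -/

theorem forall_of_forall_nullVec {d : ℕ} {P : Euc (d + 1) → Prop}
    (h : ∀ p : RHat d, P (invStereo p)) (ω : Euc (d + 1)) (hω : ‖ω‖ = 1) : P ω := by
  obtain ⟨p, rfl⟩ := exists_invStereo_eq ω hω
  exact h p

/-- On the unit sphere the zero set is the section by the hyperplane ⟪a, ω⟫ = τ, which is
nondegenerate as `n` is spacelike. It determines this hyperplane. -/
theorem exists_smul_of_zeroSet_subset {d : ℕ} [NeZero d] {n n' : Lorentz d} (hn : mink n n = 1)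
    (h : zeroSet n ⊆ zeroSet n') : ∃ k : ℝ, n' = k • n := by
  obtain ⟨a, τ⟩ := n
  obtain ⟨a', τ'⟩ := n'
  have h' := forall_of_forall_nullVec (P := fun ω => inner ℝ a ω - τ = 0 → inner ℝ a' ω - τ' = 0)
    (fun p hp => by
      have := @h p (by simpa [zeroSet, mink_apply, nullVec] using hp)
      simpa [zeroSet, mink_apply, nullVec] using this)
  rw [mink_apply, real_inner_self_eq_norm_sq] at hn
  simp only at hn
  have hA : 0 < ‖a‖ := by
    rw [norm_pos_iff]; rintro rfl; simp at hn; nlinarith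
  -- Since ‖a‖² = 1 + τ², the points of the section are exactly (τ/‖a‖²) a + e/‖a‖ with a unit
  -- vector `e` orthogonal to `a`. Comparing `e` with `-e` then separates the two terms.
  have key : ∀ e : Euc (d + 1), ‖e‖ = 1 → inner ℝ a e = 0 →
      τ * inner ℝ a' a + ‖a‖ * inner ℝ a' e = τ' * ‖a‖ ^ 2 := by
    intro e he hae
    have hω : ‖(τ / ‖a‖ ^ 2) • a + ‖a‖⁻¹ • e‖ = 1 := by
      have : ‖(τ / ‖a‖ ^ 2) • a + ‖a‖⁻¹ • e‖ ^ 2 = 1 := by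
        rw [norm_add_sq_real, norm_smul, norm_smul, inner_smul_left, inner_smul_right, hae, he,
          mul_pow, mul_pow, Real.norm_eq_abs, sq_abs, Real.norm_eq_abs, sq_abs]
        simp
        field_simp
        linarith
      have h0 := norm_nonneg ((τ / ‖a‖ ^ 2) • a + ‖a‖⁻¹ • e)
      nlinarith
    have := h' _ hω (by
      rw [inner_add_right, inner_smul_right, inner_smul_right, hae, real_inner_self_eq_norm_sq]
      field_simp
      ring)
    rw [inner_add_right, inner_smul_right, inner_smul_right] at this
    field_simp at this
    linarith
  have key2 : ∀ e : Euc (d + 1), ‖e‖ = 1 → inner ℝ a e = 0 →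
      τ * inner ℝ a' a = τ' * ‖a‖ ^ 2 ∧ inner ℝ a' e = 0 := by
    intro e he hae
    have h1 := key e he hae
    have h2 := key (-e) (by rw [norm_neg, he]) (by rw [inner_neg_right, hae, neg_zero])
    rw [inner_neg_right] at h2
    refine ⟨by linarith, ?_⟩
    have : ‖a‖ * inner ℝ a' e = 0 := by linarith
    exact (mul_eq_zero.1 this).resolve_left hA.ne'
  -- One unit vector orthogonal to `a` is required, and it exists because d ≥ 1.
  have key3 : τ * inner ℝ a' a = τ' * ‖a‖ ^ 2 := by
    have : Fact (Module.finrank ℝ (Euc (d + 1)) = d + 1) := ⟨by simp⟩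
    have h1 := Submodule.finrank_orthogonal_span_singleton (𝕜 := ℝ) (n := d) (norm_pos_iff.1 hA)
    have : Nontrivial (ℝ ∙ a : Submodule ℝ (Euc (d + 1)))ᗮ := by
      apply Module.nontrivial_of_finrank_pos (R := ℝ)
      rw [h1]
      exact Nat.pos_of_ne_zero (NeZero.ne d)
    obtain ⟨e, he⟩ := exists_norm_eq (ℝ ∙ a : Submodule ℝ (Euc (d + 1)))ᗮ (zero_le_one (α := ℝ))
    exact (key2 e he (Submodule.mem_orthogonal_singleton_iff_inner_right.1 e.2)).1
  set k := inner ℝ a' a / ‖a‖ ^ 2 with hk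
  have hb : a' - k • a = 0 := by
    by_contra hb
    have hb' : 0 < ‖a' - k • a‖ := norm_pos_iff.2 hb
    have h0 : inner ℝ a (a' - k • a) = 0 := by
      rw [inner_sub_right, inner_smul_right, real_inner_self_eq_norm_sq, real_inner_comm, hk]
      field_simp
      ring
    have h1 := (key2 (‖a' - k • a‖⁻¹ • (a' - k • a))
      (by rw [norm_smul, norm_inv, norm_norm, inv_mul_cancel₀ hb'.ne'])
      (by rw [inner_smul_right, h0, mul_zero])).2
    rw [inner_smul_right] at h1
    have h2 : inner ℝ a' (a' - k • a) = 0 := by simpa [hb'.ne'] using h1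
    have h3 : inner ℝ (a' - k • a) (a' - k • a) = 0 := by
      rw [inner_sub_left, inner_smul_left, h0, h2]; simp
    rw [real_inner_self_eq_norm_sq] at h3
    exact hb'.ne' (by simpa using h3)
  refine ⟨k, Prod.ext (sub_eq_zero.1 hb) ?_⟩
  simp only [Prod.smul_mk, smul_eq_mul, hk]
  field_simp
  linarith

/-- A boundary point of one ball cannot be interior to the other, since a small move along `-a`
would leave the first ball only. Hence the boundaries agree and the normals agree up to sign; a ball
and its complementary ball are told apart by the point a/‖a‖. -/
theorem half_injective {d : ℕ} [NeZero d] {n n' : Lorentz d} (hn : mink n n = 1)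
    (hn' : mink n' n' = 1) (h : half n = half n') : n = n' := by
  have hsub : zeroSet n ⊆ zeroSet n' := by
    intro p hp
    have hp' : 0 ≤ mink n' (nullVec p) := by
      have : p ∈ half n := le_of_eq (Eq.symm hp)
      rwa [h] at this
    by_contra hne
    have hpos : 0 < mink n' (nullVec p) := lt_of_le_of_ne hp' (Ne.symm hne)
    obtain ⟨a, τ⟩ := n
    obtain ⟨a', τ'⟩ := n'
    have h' := forall_of_forall_nullVec (P := fun ω => τ' ≤ inner ℝ a' ω → τ ≤ inner ℝ a ω)
      (fun p hp => by
        have : p ∈ half (a, τ) := by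
          rw [h]; simpa [half, mink_apply, nullVec] using hp
        simpa [half, mink_apply, nullVec] using this)
    rw [mink_apply, real_inner_self_eq_norm_sq] at hn
    simp only [zeroSet, Set.mem_ofPred_eq, mink_apply, nullVec] at hn hp hpos
    set ω := invStereo p with hω'
    have hω : ‖ω‖ = 1 := by
      have := mink_nullVec_self p
      rw [mink_apply, real_inner_self_eq_norm_sq] at this
      simp only [nullVec, ← hω'] at this
      have := norm_nonneg ω
      nlinarith
    have haω : inner ℝ a ω = τ := by linarith
    -- The factor `‖ω - s • a‖` accounts for rescaling the moved point back to the unit sphere.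
    have hcont : Continuous fun s : ℝ => inner ℝ a' (ω - s • a) - τ' * ‖ω - s • a‖ := by fun_prop
    have hev : ∀ᶠ s in nhds (0 : ℝ), 0 < inner ℝ a' (ω - s • a) - τ' * ‖ω - s • a‖ := by
      apply hcont.continuousAt.eventually_const_lt
      simpa [hω] using hpos
    obtain ⟨s, hs, hs0⟩ := ((hev.filter_mono nhdsWithin_le_nhds).and
      (self_mem_nhdsWithin (s := Set.Ioi (0 : ℝ)))).exists
    have hs0 : 0 < s := hs0
    set R := ‖ω - s • a‖ with hR
    have hR2 : R ^ 2 = 1 - 2 * s * τ + s ^ 2 * (1 + τ ^ 2) := by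
      rw [hR, norm_sub_sq_real, norm_smul, mul_pow, inner_smul_right, hω, real_inner_comm, haω,
        Real.norm_eq_abs, sq_abs]
      linear_combination s ^ 2 * hn
    have hR0 : 0 < R := by
      have : R ≠ 0 := by
        intro h0
        rw [h0] at hR2
        nlinarith [sq_nonneg (1 - s * τ), sq_pos_of_pos hs0]
      exact lt_of_le_of_ne (norm_nonneg _) this.symm
    have h1 := h' (R⁻¹ • (ω - s • a))
      (by rw [norm_smul, norm_inv, norm_norm, inv_mul_cancel₀ hR0.ne'])
      (by rw [inner_smul_right, inv_mul_eq_div, le_div_iff₀ hR0]; linarith)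
    rw [inner_smul_right, inv_mul_eq_div, le_div_iff₀ hR0, inner_sub_right, haω, inner_smul_right,
      real_inner_self_eq_norm_sq] at h1
    have hA : ‖a‖ ^ 2 = 1 + τ ^ 2 := by linarith
    rw [hA] at h1
    -- The moved point satisfies τR ≤ τ - s(1 + τ²). For τ ≥ 0 this contradicts R ≥ 1 - sτ; for τ <
    -- 0 both sides are negative and their squares are in the wrong order.
    rcases le_or_gt 0 τ with hτ | hτ
    · have : 1 - s * τ ≤ R := by
        by_contra! hc
        nlinarith [sq_pos_of_pos hs0]
      nlinarith
    · have h2 : (τ * R) ^ 2 < (τ - s * (1 + τ ^ 2)) ^ 2 := by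
        rw [mul_pow, hR2]
        nlinarith [mul_pos hs0 (neg_pos.2 hτ), sq_pos_of_pos hs0]
      have h3 : τ * R < 0 := mul_neg_of_neg_of_pos hτ hR0
      nlinarith [mul_nonneg hs0.le (by positivity : 0 ≤ 1 + τ ^ 2)]
  obtain ⟨k, rfl⟩ := exists_smul_of_zeroSet_subset hn hsub
  have hk : k ^ 2 = 1 := by
    simp only [map_smul, LinearMap.smul_apply, hn, smul_eq_mul] at hn'
    linarith
  rcases sq_eq_one_iff.1 hk with rfl | rfl
  · simp
  · exfalso
    obtain ⟨a, τ⟩ := n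
    rw [mink_apply, real_inner_self_eq_norm_sq] at hn
    simp only at hn
    have hA : 0 < ‖a‖ := by
      rw [norm_pos_iff]; rintro rfl; simp at hn; nlinarith
    have hAτ : τ < ‖a‖ := by nlinarith
    obtain ⟨p, hp⟩ := exists_invStereo_eq (d := d) (‖a‖⁻¹ • a)
      (by rw [norm_smul, norm_inv, norm_norm, inv_mul_cancel₀ hA.ne'])
    have h1 : mink (a, τ) (nullVec p) = ‖a‖ - τ := by
      rw [mink_apply, nullVec, hp, inner_smul_right, real_inner_self_eq_norm_sq]
      field_simp
    have h2 : p ∈ half (a, τ) := by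
      simp only [half, Set.mem_ofPred_eq, h1]; linarith
    rw [h] at h2
    simp only [half, Set.mem_ofPred_eq, map_smul, LinearMap.smul_apply, h1, smul_eq_mul] at h2
    linarith

/-- The sphere determines its unit normal up to sign, and opposite normals have the same reflection.
So there is exactly one inversion in a given sphere, whatever Euclidean form it takes. -/
theorem isInversionIn_zeroSet_iff {d : ℕ} [NeZero d] {n : Lorentz d} (hn : mink n n = 1)
    {f : Equiv.Perm (RHat d)} : IsInversionIn (zeroSet n) f ↔ Lifts (refl n hn) f := by
  constructor
  · intro h
    obtain ⟨n', hn', e, hf⟩ := h.exists_normal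
    obtain ⟨k, rfl⟩ := exists_smul_of_zeroSet_subset hn e.subset
    have hk : k ^ 2 = 1 := by
      have := hn'
      simp only [map_smul, LinearMap.smul_apply, hn, smul_eq_mul] at this
      linarith
    convert hf using 1
    ext1 x
    simp only [refl_apply, map_smul, LinearMap.smul_apply, smul_eq_mul, smul_smul]
    congr 2
    linear_combination (- 2 * mink n x) * hk
  · intro h
    obtain ⟨f', hf', h'⟩ := exists_inversion n hn
    rwa [h.perm_unique h']

/-! ### Möbius transformations and Lorentz transformations -/

theorem exists_lifts_of_mem_mobiusGroup {d : ℕ} {f : Equiv.Perm (RHat d)}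
    (hf : f ∈ mobiusGroup d) : ∃ L, Lifts L f := by
  induction hf using Subgroup.closure_induction with
  | mem f hf =>
    obtain ⟨s, hs⟩ := hf
    obtain ⟨n, hn, -, h⟩ := hs.exists_normal
    exact ⟨_, h⟩
  | one => exact ⟨1, Lifts.one⟩
  | mul f g _ _ hf hg =>
    obtain ⟨L, hL⟩ := hf
    obtain ⟨L', hL'⟩ := hg
    exact ⟨_, hL.mul hL'⟩
  | inv f _ hf =>
    obtain ⟨L, hL⟩ := hf
    exact ⟨_, hL.inv⟩

/-- The permutation of `ℝ^d ∪ {∞}` that fixes `∞` and extends a permutation of `ℝ^d`. -/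
def extendPerm {d : ℕ} : Equiv.Perm (Euc d) →* Equiv.Perm (RHat d) where
  toFun e := Equiv.optionCongr e
  map_one' := by ext1 p; cases p <;> rfl
  map_mul' e e' := by ext1 p; cases p <;> rfl

@[simp] theorem extendPerm_coe {d : ℕ} (e : Equiv.Perm (Euc d)) (x : Euc d) :
    extendPerm e (x : RHat d) = (e x : Euc d) := rfl

@[simp] theorem extendPerm_infty {d : ℕ} (e : Equiv.Perm (Euc d)) :
    extendPerm e OnePoint.infty = OnePoint.infty := rfl

theorem perm_ext {d : ℕ} {f g : Equiv.Perm (RHat d)} (h : f OnePoint.infty = g OnePoint.infty)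
    (h' : ∀ x : Euc d, f (x : RHat d) = g (x : RHat d)) : f = g := by
  refine Equiv.ext fun p => ?_
  induction p using OnePoint.rec with
  | infty => exact h
  | coe x => exact h' x

theorem planeReflection_mem {d : ℕ} (ν : Euc d) (k : ℝ) (hν : ‖ν‖ = 1) :
    planeReflection ν k hν ∈ mobiusGroup d :=
  Subgroup.subset_closure ⟨_, Or.inr ⟨ν, k, hν, rfl, rfl⟩⟩

theorem sphereInversion_mem {d : ℕ} (c : Euc d) {r : ℝ} (hr : 0 < r) :
    sphereInversion c r hr.ne' ∈ mobiusGroup d :=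
  Subgroup.subset_closure ⟨_, Or.inl ⟨c, r, hr, rfl, rfl⟩⟩

theorem planeReflection_coe {d : ℕ} (ν : Euc d) (k : ℝ) (hν : ‖ν‖ = 1) (x : Euc d) :
    planeReflection ν k hν (x : RHat d) =
      ((x - (2 * (inner ℝ ν x - k)) • ν : Euc d) : RHat d) := rfl

/-- A product of reflections in two parallel hyperplanes at distance `‖b‖ / 2`. -/
theorem translation_mem {d : ℕ} (b : Euc d) :
    extendPerm (Equiv.addRight b) ∈ mobiusGroup d := by
  by_cases hb : b = 0
  · subst hb
    convert (mobiusGroup d).one_mem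
    exact perm_ext rfl fun x => by simp
  · have hb' : ‖b‖ ≠ 0 := norm_ne_zero_iff.2 hb
    have hν : ‖‖b‖⁻¹ • b‖ = 1 := by rw [norm_smul]; simp [hb']
    convert (mobiusGroup d).mul_mem (planeReflection_mem (‖b‖⁻¹ • b) (‖b‖ / 2) hν)
      (planeReflection_mem (‖b‖⁻¹ • b) 0 hν) using 1
    refine perm_ext rfl fun x => ?_
    rw [extendPerm_coe, Equiv.Perm.mul_apply, planeReflection_coe, planeReflection_coe,
      OnePoint.coe_eq_coe, inner_sub_right, inner_smul_right, real_inner_self_eq_norm_sq, hν]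
    simp only [Equiv.coe_addRight]
    match_scalars
    · ring
    · field_simp
      ring

/-- A product of two concentric inversions with radii √k and 1. -/
theorem homothety_mem {d : ℕ} {k : ℝ} (hk : 0 < k) :
    extendPerm (MulAction.toPerm (Units.mk0 k hk.ne')) ∈ mobiusGroup d := by
  convert (mobiusGroup d).mul_mem (sphereInversion_mem 0 (Real.sqrt_pos.2 hk))
      (sphereInversion_mem 0 one_pos) using 1
  refine perm_ext ?_ fun x => ?_
  · simp [sphereInversion, sphereInversionFun]
  · by_cases hx : x = 0
    · simp [sphereInversion, sphereInversionFun, hx]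
    · have hx' : ‖x‖ ≠ 0 := norm_ne_zero_iff.2 hx
      simp only [extendPerm_coe, MulAction.toPerm_apply, Units.smul_mk0, sphereInversion,
        Equiv.Perm.coe_mul, Function.Involutive.coe_toPerm, Function.comp_apply,
        sphereInversionFun, OnePoint.elim_some, hx, if_false,
        EuclideanGeometry.inversion_eq_center (one_ne_zero (α := ℝ)), OnePoint.coe_eq_coe]
      rw [EuclideanGeometry.inversion, EuclideanGeometry.inversion]
      simp only [dist_zero_right, vsub_eq_sub, sub_zero, vadd_eq_add, add_zero, norm_smul,
          smul_smul]
      congr 1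
      rw [Real.norm_of_nonneg (by positivity), div_pow, Real.sq_sqrt hk.le]
      field_simp

theorem linearIsometry_mem {d : ℕ} (φ : Euc d ≃ₗᵢ[ℝ] Euc d) :
    extendPerm φ.toEquiv ∈ mobiusGroup d := by
  have h : φ ∈ Subgroup.closure
      (Set.range fun v : Euc d => (Submodule.reflection (ℝ ∙ v)ᗮ : Euc d ≃ₗᵢ[ℝ] Euc d)) := by
    rw [LinearIsometryEquiv.reflections_generate]; trivial
  induction h using Subgroup.closure_induction with
  | mem φ hφ =>
    obtain ⟨v, rfl⟩ := hφ
    by_cases hv : v = 0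
    · subst hv
      convert (mobiusGroup d).one_mem
      refine perm_ext rfl fun x => ?_
      rw [extendPerm_coe, Equiv.Perm.one_apply, OnePoint.coe_eq_coe]
      exact Submodule.reflection_mem_subspace_eq_self (by simp)
    · have hv' : ‖v‖ ≠ 0 := norm_ne_zero_iff.2 hv
      have hν : ‖‖v‖⁻¹ • v‖ = 1 := by rw [norm_smul]; simp [hv']
      convert planeReflection_mem (‖v‖⁻¹ • v) 0 hν using 1
      refine perm_ext rfl fun x => ?_
      rw [planeReflection_coe, extendPerm_coe, OnePoint.coe_eq_coe]
      change Submodule.reflection (ℝ ∙ v)ᗮ x = _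
      rw [Submodule.reflection_orthogonal_apply, Submodule.reflection_singleton_apply,
        inner_smul_left]
      simp only [RCLike.ofReal_real_eq_id, id, RCLike.conj_to_real]
      match_scalars
      · ring
      · field_simp
  | one =>
    convert (mobiusGroup d).one_mem
    exact perm_ext rfl fun x => rfl
  | mul f g _ _ hf hg =>
    convert (mobiusGroup d).mul_mem hf hg using 1
    exact perm_ext rfl fun x => rfl
  | inv f _ hf =>
    convert (mobiusGroup d).inv_mem hf using 1
    rw [← map_inv]
    rfl

/-- Products of null vectors encode Euclidean distances, with the products with ∞ fixing the
normalization. A lift that scales the vector of ∞ by `k` therefore induces a similarity of ratio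
`k`, which is a composite of a linear isometry, a translation and a homothety. -/
theorem Lifts.mem_of_fix {d : ℕ} {L : Lorentz d ≃ₗ[ℝ] Lorentz d} {f : Equiv.Perm (RHat d)}
    (h : Lifts L f) (hf : f OnePoint.infty = OnePoint.infty) : f ∈ mobiusGroup d := by
  have hf' : f⁻¹ OnePoint.infty = OnePoint.infty := by
    rw [Equiv.Perm.inv_eq_iff_eq, hf]
  have hcoe : ∀ g : Equiv.Perm (RHat d), g OnePoint.infty = OnePoint.infty →
      ∀ x : Euc d, ∃ y : Euc d, g (x : RHat d) = (y : RHat d) := by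
    intro g hg x
    have : g (x : RHat d) ≠ OnePoint.infty := by
      rw [← hg]
      exact fun hh => OnePoint.coe_ne_infty x (g.injective hh)
    obtain ⟨y, hy⟩ := OnePoint.ne_infty_iff_exists.1 this
    exact ⟨y, hy.symm⟩
  choose F hF using hcoe f hf
  obtain ⟨k, hk, e⟩ := h.2 OnePoint.infty
  rw [hf] at e
  have hdist : ∀ x y, ‖F x - F y‖ = k * ‖x - y‖ := by
    intro x y
    obtain ⟨cx, hcx, ex⟩ := h.2 x
    obtain ⟨cy, hcy, ey⟩ := h.2 y
    rw [hF] at ex ey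
    have h1 := h.1 (nullVec OnePoint.infty) (nullVec (x : RHat d))
    have h2 := h.1 (nullVec OnePoint.infty) (nullVec (y : RHat d))
    have h3 := h.1 (nullVec (x : RHat d)) (nullVec (y : RHat d))
    rw [e, ex] at h1
    rw [e, ey] at h2
    rw [ex, ey] at h3
    simp only [map_smul, LinearMap.smul_apply, smul_eq_mul] at h1 h2 h3
    have a1 := mink_nullVec_infty_coe x
    have a2 := mink_nullVec_infty_coe y
    have a3 := mink_nullVec_infty_coe (F x)
    have a4 := mink_nullVec_infty_coe (F y)
    have a5 := mink_nullVec_coe_coe x y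
    have a6 := mink_nullVec_coe_coe (F x) (F y)
    set m1 := mink (nullVec OnePoint.infty) (nullVec (x : RHat d))
    set m2 := mink (nullVec OnePoint.infty) (nullVec (y : RHat d))
    set m3 := mink (nullVec OnePoint.infty) (nullVec (F x : RHat d))
    set m4 := mink (nullVec OnePoint.infty) (nullVec (F y : RHat d))
    set m5 := mink (nullVec (x : RHat d)) (nullVec (y : RHat d))
    set m6 := mink (nullVec (F x : RHat d)) (nullVec (F y : RHat d))
    have b1 : ‖F x‖ ^ 2 + 1 = k * cx * (‖x‖ ^ 2 + 1) := by
      have hm : m1 ≠ 0 := by rintro hm; rw [hm] at a1; norm_num at a1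
      have hm3 : m3 ≠ 0 := by rintro hm; rw [hm] at a3; norm_num at a3
      apply mul_right_cancel₀ hm3
      linear_combination a3 - a1 - (‖x‖ ^ 2 + 1) * h1
    have b2 : ‖F y‖ ^ 2 + 1 = k * cy * (‖y‖ ^ 2 + 1) := by
      have hm3 : m4 ≠ 0 := by rintro hm; rw [hm] at a4; norm_num at a4
      apply mul_right_cancel₀ hm3
      linear_combination a4 - a2 - (‖y‖ ^ 2 + 1) * h2
    have b3 : ‖F x - F y‖ ^ 2 = (k * ‖x - y‖) ^ 2 := by
      rw [b1, b2] at a6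
      linear_combination (1 / 2) * a6 - (k ^ 2 / 2) * a5 -
        (1 / 2) * k ^ 2 * (‖x‖ ^ 2 + 1) * (‖y‖ ^ 2 + 1) * h3
    exact (sq_eq_sq₀ (norm_nonneg _) (by positivity)).1 b3
  have hGi : Isometry fun x => k⁻¹ • F x := by
    refine Isometry.of_dist_eq fun x y => ?_
    rw [dist_eq_norm, dist_eq_norm, ← smul_sub, norm_smul, hdist,
        Real.norm_of_nonneg (by positivity)]
    field_simp
  have hGs : Function.Surjective fun x => k⁻¹ • F x := by
    intro y
    obtain ⟨x, hx⟩ := hcoe f⁻¹ hf' (k • y)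
    rw [Equiv.Perm.inv_eq_iff_eq, hF, OnePoint.coe_eq_coe] at hx
    exact ⟨x, by simp [← hx, smul_smul, hk.ne']⟩
  let A := (IsometryEquiv.mk (Equiv.ofBijective _ ⟨hGi.injective,
      hGs⟩) hGi).toRealAffineIsometryEquiv
  have hA : ∀ x, A x = k⁻¹ • F x := fun x => rfl
  have hF' : ∀ x, F x = k • (A.linearIsometryEquiv x + A 0) := by
    intro x
    have h1 : A x = A.linearIsometryEquiv x + A 0 := by
      have := A.map_vadd 0 x
      simpa using this
    rw [← h1, hA, smul_smul, mul_inv_cancel₀ hk.ne', one_smul]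
  convert (mobiusGroup d).mul_mem (homothety_mem hk)
    ((mobiusGroup d).mul_mem (translation_mem (A 0)) (linearIsometry_mem A.linearIsometryEquiv))
    using 1
  refine perm_ext hf fun x => ?_
  rw [hF, hF']
  rfl

/-- An inversion centred at the image of ∞ reduces to the case where ∞ is fixed. -/
theorem Lifts.mem_mobiusGroup {d : ℕ} {L : Lorentz d ≃ₗ[ℝ] Lorentz d} {f : Equiv.Perm (RHat d)}
    (h : Lifts L f) : f ∈ mobiusGroup d := by
  by_cases hf : f OnePoint.infty = OnePoint.infty
  · exact h.mem_of_fix hf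
  · obtain ⟨c, hc⟩ := OnePoint.ne_infty_iff_exists.1 hf
    have h1 := (lifts_sphereInversion c one_pos).mul h
    have h2 := h1.mem_of_fix (by
      rw [Equiv.Perm.mul_apply, ← hc]
      simp [sphereInversion, sphereInversionFun])
    exact (Subgroup.mul_mem_cancel_left _ (sphereInversion_mem c one_pos)).1 h2

theorem refl_map {d : ℕ} {L : Lorentz d ≃ₗ[ℝ] Lorentz d}
    (h : ∀ x y, mink (L x) (L y) = mink x y) (n : Lorentz d) (hn : mink n n = 1)
    (hn' : mink (L n) (L n) = 1) : refl (L n) hn' = L * refl n hn * L⁻¹ := by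
  ext1 x
  have hi : ∀ x, L (L⁻¹ x) = x := fun x => L.apply_symm_apply x
  have : mink (L n) x = mink n (L⁻¹ x) := by
    conv_lhs => rw [← hi x]
    rw [h]
  simp [refl_apply, this]

theorem IsInversionIn.conj {d : ℕ} [NeZero d] {s : Set (RHat d)} {f ν : Equiv.Perm (RHat d)}
    (h : IsInversionIn s f) (hν : ν ∈ mobiusGroup d) :
    IsInversionIn (ν '' s) (ν * f * ν⁻¹) := by
  obtain ⟨L, hL⟩ := exists_lifts_of_mem_mobiusGroup hν
  obtain ⟨n, hn, rfl, hf⟩ := h.exists_normal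
  have hn' : mink (L n) (L n) = 1 := by rw [hL.1, hn]
  rw [hL.image_zeroSet, isInversionIn_zeroSet_iff hn', refl_map hL.1 n hn]
  exact (hL.mul hf).mul hL.inv

/-- Cauchy–Schwarz: a causal vector with nonpositive time has nonnegative product with a future
timelike vector. -/
theorem time_pos_of_mink_neg {d : ℕ} {x y : Lorentz d} (hx : mink x x < 0) (hx' : 0 < x.2)
    (hy : mink y y ≤ 0) (hxy : mink y x < 0) : 0 < y.2 := by
  by_contra! hc
  rw [mink_apply, real_inner_self_eq_norm_sq] at hx hy
  rw [mink_apply] at hxy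
  have h1 := abs_le.1 (abs_real_inner_le_norm y.1 x.1)
  have h2 := norm_nonneg x.1
  have h3 := norm_nonneg y.1
  have h4 : ‖x.1‖ ≤ x.2 := by nlinarith
  have h5 : ‖y.1‖ ≤ -y.2 := by nlinarith
  have := mul_le_mul h5 h4 h2 (by linarith)
  linarith

/-- An isometry sending the time axis to the future preserves the future null cone, hence permutes
its rays. -/
theorem exists_lifts {d : ℕ} {L : Lorentz d ≃ₗ[ℝ] Lorentz d}
    (h : ∀ x y, mink (L x) (L y) = mink x y) (ht : 0 < (L (0, 1)).2) : ∃ f, Lifts L f := by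
  have key : ∀ M : Lorentz d ≃ₗ[ℝ] Lorentz d, (∀ x y, mink (M x) (M y) = mink x y) →
      0 < (M (0, 1)).2 → ∀ p, ∃ c : ℝ, ∃ q, 0 < c ∧ M (nullVec p) = c • nullVec q := by
    intro M hM hMt p
    have h1 : 0 < (M (nullVec p)).2 := by
      refine time_pos_of_mink_neg (x := M (0, 1)) ?_ hMt ?_ ?_
      · rw [hM]; simp [mink_apply]
      · rw [hM, mink_nullVec_self]
      · rw [hM]; simp [mink_apply, nullVec]
    obtain ⟨q, hq⟩ := exists_smul_nullVec (by rw [hM, mink_nullVec_self]) h1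
    exact ⟨_, q, h1, hq⟩
  have hs : ∀ x y, mink (L.symm x) (L.symm y) = mink x y := fun x y => by
    rw [← h, L.apply_symm_apply, L.apply_symm_apply]
  -- The inverse is also future preserving: by invariance, `L (0, 1)` and `L.symm (0, 1)` have the
  -- same time coordinate.
  have hst : 0 < (L.symm (0, 1)).2 := by
    have h1 : mink (L.symm (0, 1)) (0, 1) = mink (0, 1) (L (0, 1)) := by
      rw [← h, L.apply_symm_apply]
    simp [mink_apply] at h1
    rwa [h1]
  choose c F hc e using key L h ht
  choose c' F' hc' e' using key L.symm hs hst
  refine ⟨⟨F, F', fun p => ?_, fun p => ?_⟩, h, fun p => ⟨c p, hc p, e p⟩⟩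
  · refine (nullVec_smul_inj (c := c p * c' (F p)) ?_).symm
    rw [mul_smul, ← e', ← map_smul, ← e, L.symm_apply_apply]
  · refine (nullVec_smul_inj (c := c' p * c (F' p)) ?_).symm
    rw [mul_smul, ← e, ← map_smul, ← e', L.apply_symm_apply]

/-! ### Balls and dual spheres in the Lorentz model -/

theorem isFacet_congr {ι : Type} {d d' : ℕ} {v : ι → Euc d} {v' : ι → Euc d'}
    (h : ∀ S, IsFace v S ↔ IsFace v' S) (S : Set ι) : IsFacet v S ↔ IsFacet v' S := by
  simp only [IsFacet, h]

/-- Homogenization: an affine span is the slice at height 1 of a linear span. This makes the dual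
spheres accessible to linear maps. -/
theorem mem_affineSpan_iff {d : ℕ} (s : Set (Euc (d + 1))) (x : Euc (d + 1)) :
    x ∈ affineSpan ℝ s ↔
      ((x, 1) : Lorentz d) ∈ Submodule.span ℝ ((fun v : Euc (d + 1) =>
        ((v, 1) : Lorentz d)) '' s) := by
  constructor
  · intro h
    let A : Euc (d + 1) →ᵃ[ℝ] Lorentz d := (AffineMap.id ℝ _).prod (AffineMap.const ℝ _ 1)
    have h1 : A x ∈ (affineSpan ℝ s).map A := AffineSubspace.mem_map_of_mem A h
    rw [AffineSubspace.map_span] at h1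
    exact affineSpan_subset_span h1
  · intro h
    rcases s.eq_empty_or_nonempty with rfl | ⟨x₀, hx₀⟩
    · simp at h
    · have key : ∀ y ∈ Submodule.span ℝ ((fun v : Euc (d + 1) => ((v, 1) : Lorentz d)) '' s),
          y.1 - y.2 • x₀ ∈ (affineSpan ℝ s).direction := by
        intro y hy
        induction hy using Submodule.span_induction with
        | mem y hy =>
          obtain ⟨v, hv, rfl⟩ := hy
          rw [one_smul]
          exact AffineSubspace.vsub_mem_direction (mem_affineSpan ℝ hv) (mem_affineSpan ℝ hx₀)
        | zero => simp
        | add y z _ _ hy hz =>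
          convert add_mem hy hz using 1
          simp only [Prod.fst_add, Prod.snd_add]
          module
        | smul c y _ hy =>
          convert Submodule.smul_mem _ c hy using 1
          simp only [Prod.smul_fst, Prod.smul_snd, smul_eq_mul]
          module
      have h1 := key _ h
      rw [one_smul] at h1
      have := AffineSubspace.vadd_mem_of_mem_direction h1 (mem_affineSpan ℝ hx₀)
      simpa using this

namespace PolytopalPacking

variable {ι : Type} {d : ℕ} {v₀ : ι → Euc (d + 1)}

/-- The normal vector (up to scaling) of the ball of a vertex. -/
noncomputable def normal (P : PolytopalPacking v₀) (i : ι) : Lorentz d := (P.vertex i, 1)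

theorem ball_eq (P : PolytopalPacking v₀) (i : ι) : P.ball i = P.mob '' half (P.normal i) := by
  simp [ball, half, normal, nullVec, mink_apply]

theorem dualSphere_eq (P : PolytopalPacking v₀) (S : Set ι) :
    P.dualSphere S = P.mob '' {p | nullVec p ∈ Submodule.span ℝ (P.normal '' S)} := by
  rw [dualSphere]
  congr 1
  ext p
  rw [Set.mem_ofPred_eq, Set.mem_ofPred_eq, mem_affineSpan_iff, Set.image_image]
  rfl

end PolytopalPacking

theorem image_span_set {d : ℕ} {L : Lorentz d ≃ₗ[ℝ] Lorentz d} {f : Equiv.Perm (RHat d)}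
    (h : Lifts L f) (W : Submodule ℝ (Lorentz d)) :
    f '' {p | nullVec p ∈ W} = {p | nullVec p ∈ W.map (L : Lorentz d →ₗ[ℝ] Lorentz d)} := by
  ext q
  rw [Equiv.image_eq_preimage_symm]
  obtain ⟨c, hc, e⟩ := h.2 (f.symm q)
  rw [Equiv.apply_symm_apply] at e
  simp only [Set.mem_preimage, Set.mem_ofPred_eq]
  rw [← Submodule.smul_mem_iff (p := W.map (L : Lorentz d →ₗ[ℝ] Lorentz d)) hc.ne', ← e]
  exact (Submodule.mem_map_equiv (e := L) (p := W) (x := L _)).trans (by simp) |>.symm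

theorem span_image_eq_of_smul {ι V : Type*} [AddCommGroup V] [Module ℝ V] {u v : ι → V} {S : Set ι}
    (h : ∀ i, ∃ c : ℝ, 0 < c ∧ u i = c • v i) :
    Submodule.span ℝ (u '' S) = Submodule.span ℝ (v '' S) := by
  choose c hc e using h
  apply le_antisymm <;> rw [Submodule.span_le]
  · rintro _ ⟨i, hi, rfl⟩
    rw [e]
    exact Submodule.smul_mem _ _ (Submodule.subset_span ⟨i, hi, rfl⟩)
  · rintro _ ⟨i, hi, rfl⟩
    have : v i = (c i)⁻¹ • u i := by rw [e, smul_smul, inv_mul_cancel₀ (hc i).ne', one_smul]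
    rw [this]
    exact Submodule.smul_mem _ _ (Submodule.subset_span ⟨i, hi, rfl⟩)

theorem mobiusEquivalent_of_images {ι : Type} {d : ℕ} [NeZero d] {v₀ : ι → Euc (d + 1)}
    (P P' : PolytopalPacking v₀) {ν : Equiv.Perm (RHat d)} (hν : ν ∈ mobiusGroup d)
    (hb : ∀ i, ν '' P.ball i = P'.ball i) (hs : ∀ S, ν '' P.dualSphere S = P'.dualSphere S) :
    MobiusEquivalent P P' := by
  have hf : ∀ S, IsFacet P.vertex S ↔ IsFacet P'.vertex S :=
    isFacet_congr fun S => (P.sameFaces S).trans (P'.sameFaces S).symm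
  refine ⟨ν, hν, ?_, ?_⟩
  · rw [PolytopalPacking.balls, PolytopalPacking.balls, ← Set.range_comp]
    congr 1
    ext1 i
    exact hb i
  · rw [PolytopalPacking.apollonianGroup, PolytopalPacking.apollonianGroup, MonoidHom.map_closure]
    congr 1
    ext g
    constructor
    · rintro ⟨f, ⟨S, hS, h⟩, rfl⟩
      refine ⟨S, (hf S).1 hS, ?_⟩
      rw [← hs]
      exact h.conj hν
    · rintro ⟨S, hS, h⟩
      refine ⟨ν⁻¹ * g * ν, ⟨S, (hf S).2 hS, ?_⟩, ?_⟩
      · have := h.conj (inv_mem hν)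
        rw [inv_inv, ← hs, ← Set.image_comp] at this
        convert this using 1
        have : (⇑ν⁻¹ ∘ ⇑ν) = id := by ext1 p; simp
        rw [this, Set.image_id]
      · simp [mul_assoc]

/-- Positive rescaling of the normals changes neither the balls nor the linear spans that cut out
the dual spheres, so matching the rays suffices. -/
theorem mobiusEquivalent_of_linear {ι : Type} {d : ℕ} [NeZero d] {v₀ : ι → Euc (d + 1)}
    (P P' : PolytopalPacking v₀) {L : Lorentz d ≃ₗ[ℝ] Lorentz d}
    (h : ∀ x y, mink (L x) (L y) = mink x y) (ht : 0 < (L (0, 1)).2)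
    (hL : ∀ i, ∃ c : ℝ, 0 < c ∧ L (P.normal i) = c • P'.normal i) : MobiusEquivalent P P' := by
  obtain ⟨f, hf⟩ := exists_lifts h ht
  refine mobiusEquivalent_of_images P P' (ν := P'.mob * f * P.mob⁻¹)
    (mul_mem (mul_mem P'.mob_mem hf.mem_mobiusGroup) (inv_mem P.mob_mem)) ?_ ?_
  · intro i
    obtain ⟨c, hc, e⟩ := hL i
    have : (⇑(P'.mob * f * P.mob⁻¹) ∘ ⇑P.mob) = P'.mob ∘ f := by ext1 p; simp
    rw [P.ball_eq, P'.ball_eq, ← Set.image_comp, this, Set.image_comp, hf.image_half, e,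
      half_smul _ hc]
  · intro S
    have : (⇑(P'.mob * f * P.mob⁻¹) ∘ ⇑P.mob) = P'.mob ∘ f := by ext1 p; simp
    rw [P.dualSphere_eq, P'.dualSphere_eq, ← Set.image_comp, this, Set.image_comp,
      image_span_set hf, Submodule.map_span, ← Set.image_comp,
      ← span_image_eq_of_smul (u := (L : Lorentz d →ₗ[ℝ] Lorentz d) ∘ P.normal) hL]

/-! ### Edge-scribed polytopes -/

/-- Along the segment, ‖·‖² - 1 is the quadratic form A(1-t)² + 2Bt(1-t) + Ct² with A, C > 0. It has
a single root in the segment iff B² = AC and B < 0. In terms of the normals (v, 1), the normalized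
product is then -1. -/
theorem segment_inter_sphere_iff {d : ℕ} {v w : Euc d} (hv : 1 < ‖v‖) (hw : 1 < ‖w‖) :
    (∃ p, segment ℝ v w ∩ Metric.sphere 0 1 = {p}) ↔
      (inner ℝ v w - 1) ^ 2 = (‖v‖ ^ 2 - 1) * (‖w‖ ^ 2 - 1) ∧ inner ℝ v w < 1 := by
  have hA : 0 < ‖v‖ ^ 2 - 1 := by nlinarith
  have hC : 0 < ‖w‖ ^ 2 - 1 := by nlinarith
  have hmem : ∀ t : ℝ, t ∈ Set.Icc (0 : ℝ) 1 →
      ((1 - t) • v + t • w ∈ segment ℝ v w ∩ Metric.sphere 0 1 ↔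
        (‖v‖ ^ 2 - 1) * (1 - t) ^ 2 + 2 * (inner ℝ v w - 1) * t * (1 - t)
          + (‖w‖ ^ 2 - 1) * t ^ 2 = 0) := by
    intro t ht
    have h1 : ‖(1 - t) • v + t • w‖ ^ 2 = (1 - t) ^ 2 * ‖v‖ ^ 2 + 2 * (t * (1 - t)) * inner ℝ v w
        + t ^ 2 * ‖w‖ ^ 2 := by
      rw [norm_add_sq_real, norm_smul, norm_smul, mul_pow, mul_pow, Real.norm_eq_abs,
        Real.norm_eq_abs, sq_abs, sq_abs, inner_smul_left, inner_smul_right]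
      simp
      ring
    have h2 : ‖(1 - t) • v + t • w‖ = 1 ↔ ‖(1 - t) • v + t • w‖ ^ 2 = 1 := by
      constructor
      · intro h; rw [h]; norm_num
      · intro h
        have := norm_nonneg ((1 - t) • v + t • w)
        nlinarith
    rw [Set.mem_inter_iff, mem_sphere_zero_iff_norm, h2, h1, segment_eq_image]
    constructor
    · rintro ⟨-, h⟩
      linear_combination h
    · intro h
      exact ⟨⟨t, ht, rfl⟩, by linear_combination h⟩
  set A := ‖v‖ ^ 2 - 1
  set C := ‖w‖ ^ 2 - 1
  set B := inner ℝ v w - 1 with hB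
  constructor
  · rintro ⟨p, hp⟩
    have hpm : p ∈ segment ℝ v w ∩ Metric.sphere 0 1 := by rw [hp]; rfl
    have hvw : v ≠ w := by
      rintro rfl
      rw [segment_same] at hpm
      obtain ⟨h1, h2⟩ := hpm
      rw [Set.mem_singleton_iff.1 h1, mem_sphere_zero_iff_norm] at h2
      linarith
    have hpm' := hpm
    rw [segment_eq_image] at hpm'
    obtain ⟨⟨t, ht, htp⟩, -⟩ := hpm'
    simp only at htp
    rw [← htp, hmem t ht] at hpm
    have ht0 : t ≠ 0 := by rintro rfl; simp at hpm; linarith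
    have ht1 : 1 - t ≠ 0 := by
      intro h
      have : t = 1 := by linarith
      subst this
      simp at hpm; linarith
    have ht0' : 0 < t := lt_of_le_of_ne ht.1 ht0.symm
    have ht1' : 0 < 1 - t := lt_of_le_of_ne (by linarith [ht.2]) ht1.symm
    have hD : 0 < C * t + A * (1 - t) := by positivity
    -- The second root, from the product of the roots in t/(1-t) being A/C. Uniqueness of the
    -- intersection forces it to equal `t`.
    set s := A * (1 - t) / (C * t + A * (1 - t)) with hs
    have hs1 : 1 - s = C * t / (C * t + A * (1 - t)) := by rw [hs]; field_simp; ring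
    have hsI : s ∈ Set.Icc (0 : ℝ) 1 := by
      refine ⟨by positivity, ?_⟩
      have : 0 ≤ 1 - s := by rw [hs1]; positivity
      linarith
    have hsr : (1 - s) • v + s • w ∈ segment ℝ v w ∩ Metric.sphere 0 1 := by
      rw [hmem s hsI, hs1, hs]
      field_simp
      linear_combination A * C * hpm
    rw [hp, Set.mem_singleton_iff, ← htp] at hsr
    have hst : s = t := by
      have h1 : (s - t) • (w - v) = 0 := by
        have := sub_eq_zero.2 hsr
        rw [← this]; module
      rcases smul_eq_zero.1 h1 with h | h
      · linarith
      · exact absurd (sub_eq_zero.1 h).symm hvw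
    have h2 : C * t ^ 2 = A * (1 - t) ^ 2 := by
      rw [hs, div_eq_iff hD.ne'] at hst
      linear_combination -hst
    have h3 : A * (1 - t) = - B * t := by
      apply mul_right_cancel₀ ht1
      linear_combination hpm / 2 - h2 / 2
    have h4 : C * t = - B * (1 - t) := by
      apply mul_right_cancel₀ ht0
      linear_combination hpm / 2 + h2 / 2
    refine ⟨?_, ?_⟩
    · apply mul_right_cancel₀ (mul_ne_zero ht0 ht1)
      linear_combination B * t * h4 - C * t * h3
    · by_contra! hc
      have : 0 ≤ B := by linarith
      nlinarith [mul_pos hA ht1', mul_nonneg this ht0'.le]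
  · rintro ⟨h1, h2⟩
    have hB0 : B < 0 := by linarith
    have hAB : 0 < A - B := by linarith
    -- The double root: the form times A is the square of A(1-t) + Bt.
    set t := A / (A - B) with ht
    have ht1 : 1 - t = - B / (A - B) := by rw [ht]; field_simp; ring
    have htI : t ∈ Set.Icc (0 : ℝ) 1 := by
      refine ⟨by positivity, ?_⟩
      have : 0 ≤ 1 - t := by rw [ht1]; exact div_nonneg (by linarith) hAB.le
      linarith
    refine ⟨(1 - t) • v + t • w, Set.eq_singleton_iff_unique_mem.2 ⟨?_, ?_⟩⟩
    · rw [hmem t htI, ht1, ht]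
      field_simp
      linear_combination -A * h1
    · intro q hq
      have hq' := hq
      rw [segment_eq_image] at hq'
      obtain ⟨⟨s, hs, rfl⟩, -⟩ := hq'
      simp only at hq ⊢
      rw [hmem s hs] at hq
      have h3 : (A * (1 - s) + B * s) ^ 2 = 0 := by linear_combination A * hq + s ^ 2 * h1
      have h4 : A * (1 - s) + B * s = 0 := by simpa using h3
      have : s = t := by rw [ht, eq_div_iff hAB.ne']; linarith
      rw [this]

theorem mink_normal {d : ℕ} (v w : Euc (d + 1)) :
    mink ((v, 1) : Lorentz d) (w, 1) = inner ℝ v w - 1 := by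
  simp [mink_apply]

/-! ### Faces of cross polytopes -/

theorem inner_crossPolytope {n : ℕ} (a : Euc n) (k : Fin n × ℤˣ) :
    inner ℝ a (crossPolytope n k) = ((k.2 : ℤ) : ℝ) * a k.1 := by
  simp [crossPolytope, EuclideanSpace.inner_single_right]

/-- The facet of a cross polytope with the vertices `e_i i`. -/
def crossFacet {n : ℕ} (e : Fin n → ℤˣ) : Set (Fin n × ℤˣ) := Set.range fun i => (i, e i)

theorem mem_crossFacet {n : ℕ} {e : Fin n → ℤˣ} {k : Fin n × ℤˣ} :
    k ∈ crossFacet e ↔ k.2 = e k.1 := by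
  constructor
  · rintro ⟨i, rfl⟩; rfl
  · intro h; exact ⟨k.1, Prod.ext rfl h.symm⟩

/-- Central symmetry gives `|a i| ≤ c`, so `c ≤ 0` is possible only for the zero functional. Proper
faces thus have positive height. -/
theorem crossPolytope_face {n : ℕ} [NeZero n] {a : Euc n} {c : ℝ} {S : Set (Fin n × ℤˣ)}
    (h : ∀ i, inner ℝ a (crossPolytope n i) ≤ c)
    (h' : ∀ i, i ∈ S ↔ inner ℝ a (crossPolytope n i) = c) : S = Set.univ ∨ 0 < c := by
  simp only [inner_crossPolytope] at h h'
  have h1 : ∀ i, |a i| ≤ c := fun i => abs_le.2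
    ⟨by have := h (i, -1); simp at this; linarith, by simpa using h (i, 1)⟩
  rcases lt_or_ge 0 c with hc | hc
  · exact Or.inr hc
  · left
    have h2 : ∀ i, a i = 0 := fun i => abs_eq_zero.1 (le_antisymm ((h1 i).trans hc) (abs_nonneg _))
    have h3 : c = 0 := le_antisymm hc ((abs_nonneg _).trans (h1 0))
    ext i
    simp [h', h2, h3]

theorem units_mul_le_one (u v : ℤˣ) : ((u : ℤ) : ℝ) * ((v : ℤ) : ℝ) ≤ 1 ∧
    (u = v ↔ ((u : ℤ) : ℝ) * ((v : ℤ) : ℝ) = 1) := by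
  rcases Int.units_eq_one_or u with rfl | rfl <;> rcases Int.units_eq_one_or v with rfl | rfl <;>
    norm_num

theorem isFace_crossFacet {n : ℕ} (e : Fin n → ℤˣ) : IsFace (crossPolytope n) (crossFacet e) := by
  refine ⟨WithLp.toLp 2 fun i => ((e i : ℤ) : ℝ), 1, fun i => ?_, fun i => ?_⟩
  · rw [inner_crossPolytope]; exact (units_mul_le_one _ _).1
  · rw [inner_crossPolytope, mem_crossFacet]; exact (units_mul_le_one _ _).2

theorem crossFacet_ne_univ {n : ℕ} [NeZero n] (e : Fin n → ℤˣ) : crossFacet e ≠ Set.univ := by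
  intro h
  have : ((0 : Fin n), -e 0) ∈ crossFacet e := by rw [h]; trivial
  rw [mem_crossFacet] at this
  exact units_ne_neg_self (e 0) this.symm

theorem isFacet_crossPolytope_iff {n : ℕ} [NeZero n] (S : Set (Fin n × ℤˣ)) :
    IsFacet (crossPolytope n) S ↔ ∃ e, S = crossFacet e := by
  constructor
  · rintro ⟨⟨a, c, h, h'⟩, hS, hmax⟩
    have hc := (crossPolytope_face h h').resolve_left hS
    simp only [inner_crossPolytope] at h h'
    let e : Fin n → ℤˣ := fun i => if 0 ≤ a i then 1 else -1
    refine ⟨e, ?_⟩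
    have hsub : S ⊆ crossFacet e := by
      intro k hk
      have h1 := (h' k).1 hk
      rw [mem_crossFacet]
      rcases Int.units_eq_one_or k.2 with h | h <;> rw [h] at h1 ⊢
      · have : 0 ≤ a k.1 := by simp at h1; linarith
        simp [e, this]
      · have : ¬ 0 ≤ a k.1 := by simp at h1; linarith
        simp [e, this]
    rcases hmax _ (isFace_crossFacet e) hsub with h | h
    · exact h.symm
    · exact absurd h (crossFacet_ne_univ e)
  · rintro ⟨e, rfl⟩
    refine ⟨isFace_crossFacet e, crossFacet_ne_univ e, ?_⟩
    rintro T ⟨a, c, h, h'⟩ hT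
    rcases crossPolytope_face h h' with h1 | hc
    · exact Or.inr h1
    · left
      refine Set.Subset.antisymm (fun k hk => ?_) hT
      have h1 := (h' k).1 hk
      have h2 := (h' (k.1, e k.1)).1 (hT (mem_crossFacet.2 rfl))
      rw [inner_crossPolytope] at h1 h2
      rw [mem_crossFacet]
      rcases Int.units_eq_one_or k.2 with h3 | h3 <;>
        rcases Int.units_eq_one_or (e k.1) with h4 | h4 <;> rw [h3, h4] <;>
        (rw [h3] at h1; simp only [h4] at h2; simp at h1 h2; linarith)

/-- Opposite vertices take opposite values, so they share no face of positive height; for n ≥ 2 the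
pair is not the whole polytope either. -/
theorem isFace_pair_crossPolytope_iff {n : ℕ} [NeZero n] {i j : Fin n × ℤˣ} (hij : i ≠ j)
    (hn : n ≠ 1) : IsFace (crossPolytope n) {i, j} ↔ i.1 ≠ j.1 := by
  constructor
  · rintro ⟨a, c, h, h'⟩ heq
    have h2 : j.2 = -i.2 := by
      have : i.2 ≠ j.2 := fun hh => hij (Prod.ext heq hh)
      rcases Int.units_eq_one_or i.2 with h | h <;> rcases Int.units_eq_one_or j.2 with h' | h' <;>
        rw [h, h'] at this ⊢ <;> first | rfl | exact absurd rfl this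
    rcases crossPolytope_face h h' with hS | hc
    · have h0 : ∃ k : Fin n, k ≠ i.1 := by
        have : 1 < n := by have := NeZero.ne n; omega
        have : Nontrivial (Fin n) := Fin.nontrivial_iff_two_le.2 this
        exact exists_ne _
      obtain ⟨k, hk⟩ := h0
      have : (k, (1 : ℤˣ)) ∈ ({i, j} : Set (Fin n × ℤˣ)) := by rw [hS]; trivial
      rcases this with h | h
      · exact hk (by rw [← h])
      · exact hk (by rw [heq, ← (Set.mem_singleton_iff.1 h)])
    · have h3 := (h' i).1 (by simp)
      have h4 := (h' j).1 (by simp)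
      rw [inner_crossPolytope] at h3 h4
      rw [h2, ← heq] at h4
      push_cast at h4
      linarith
  · intro hne
    let a : Euc n := WithLp.toLp 2 fun l : Fin n =>
      if l = i.1 then ((i.2 : ℤ) : ℝ) else if l = j.1 then ((j.2 : ℤ) : ℝ) else 0
    have hk : ∀ k : Fin n × ℤˣ, a k.1 =
        if k.1 = i.1 then ((i.2 : ℤ) : ℝ) else if k.1 = j.1 then ((j.2 : ℤ) : ℝ) else 0 :=
      fun k => rfl
    refine ⟨a, 1, fun k => ?_, fun k => ?_⟩
    · rw [inner_crossPolytope, hk]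
      split_ifs
      · exact (units_mul_le_one _ _).1
      · exact (units_mul_le_one _ _).1
      · simp
    · rw [inner_crossPolytope, hk, Set.mem_insert_iff, Set.mem_singleton_iff, Prod.ext_iff,
        Prod.ext_iff]
      split_ifs with h1 h2
      · rw [← (units_mul_le_one _ _).2, h1]
        simp [hne]
      · rw [← (units_mul_le_one _ _).2, h2]
        simp [Ne.symm hne]
      · simp [h1, h2]

theorem isFace_singleton_crossPolytope {n : ℕ} (i : Fin n × ℤˣ) :
    IsFace (crossPolytope n) {i} := by
  refine ⟨EuclideanSpace.single i.1 ((i.2 : ℤ) : ℝ), 1, fun k => ?_, fun k => ?_⟩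
  · rw [inner_crossPolytope, PiLp.single_apply]
    split_ifs
    · exact (units_mul_le_one _ _).1
    · simp
  · rw [inner_crossPolytope, PiLp.single_apply, Set.mem_singleton_iff, Prod.ext_iff]
    split_ifs with h
    · rw [← (units_mul_le_one _ _).2, h]; simp
    · simp [h]

/-! ### Uniqueness of edge-scribed orthoplexes up to Lorentz transformations -/

/-- The equality case of Cauchy–Schwarz: a totally isotropic subspace of a Lorentz space is at most
a line. -/
theorem smul_of_mink_eq_zero {d : ℕ} {w y : Lorentz d} (hw : mink w w = 0) (hw0 : w ≠ 0)
    (hy : mink y y = 0) (hwy : mink w y = 0) : ∃ c : ℝ, y = c • w := by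
  obtain ⟨a, s⟩ := w
  obtain ⟨b, t⟩ := y
  rw [mink_apply, real_inner_self_eq_norm_sq] at hw hy
  rw [mink_apply] at hwy
  simp only at hw hy hwy
  have hs : s ≠ 0 := by
    rintro rfl
    apply hw0
    have : ‖a‖ = 0 := by nlinarith
    rw [norm_eq_zero.1 this]; rfl
  have h1 : ‖s • b - t • a‖ ^ 2 = 0 := by
    rw [norm_sub_sq_real, norm_smul, norm_smul, mul_pow, mul_pow, inner_smul_left,
      inner_smul_right, Real.norm_eq_abs, Real.norm_eq_abs, sq_abs, sq_abs, real_inner_comm]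
    simp
    linear_combination s ^ 2 * hy + t ^ 2 * hw - 2 * s * t * hwy
  have h2 : s • b = t • a := sub_eq_zero.1 (norm_eq_zero.1 (by simpa using h1))
  refine ⟨t / s, Prod.ext ?_ ?_⟩
  · simp only [Prod.smul_fst]
    rw [div_eq_inv_mul, mul_smul, ← h2, smul_smul, inv_mul_cancel₀ hs, one_smul]
  · simp [hs]

/-- If this difference were null, then for j, k different from i the sum `u (j, 1) + u (k, 1)`,
which is null and orthogonal to it, would be a multiple of it. Three such indices make `u (j, 1)`
itself a multiple, hence null, a contradiction. -/
theorem mink_sub_ne_zero {u : Fin 4 × ℤˣ → Lorentz 3} (h1 : ∀ i, mink (u i) (u i) = 1)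
    (h2 : ∀ i j, i.1 ≠ j.1 → mink (u i) (u j) = -1) {i : Fin 4} (hi : u (i, 1) ≠ u (i, -1)) :
    mink (u (i, 1) - u (i, -1)) (u (i, 1) - u (i, -1)) ≠ 0 := by
  intro h0
  have key : ∀ j k : Fin 4, j ≠ i → k ≠ i → j ≠ k →
      ∃ c : ℝ, u (j, 1) + u (k, 1) = c • (u (i, 1) - u (i, -1)) := by
    intro j k hj hk hjk
    refine smul_of_mink_eq_zero h0 (sub_ne_zero.2 hi) ?_ ?_
    · simp only [map_add, LinearMap.add_apply, h1, h2 (j, 1) (k, 1) hjk,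
        h2 (k, 1) (j, 1) hjk.symm]
      norm_num
    · simp only [map_add, map_sub, LinearMap.sub_apply, h2 (i, _) (j, 1) hj.symm,
        h2 (i, _) (k, 1) hk.symm]
      norm_num
  obtain ⟨j, k, l, hj, hk, hl, hjk, hjl, hkl⟩ : ∃ j k l : Fin 4, j ≠ i ∧ k ≠ i ∧ l ≠ i ∧
      j ≠ k ∧ j ≠ l ∧ k ≠ l := by
    clear hi h0 key; revert i; decide
  obtain ⟨a, ha⟩ := key j k hj hk hjk
  obtain ⟨b, hb⟩ := key j l hj hl hjl
  obtain ⟨c, hc⟩ := key k l hk hl hkl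
  have e : u (j, 1) = ((a + b - c) / 2) • (u (i, 1) - u (i, -1)) := by
    have : (2 : ℝ) • u (j, 1) = (a + b - c) • (u (i, 1) - u (i, -1)) := by
      rw [sub_smul, add_smul, ← ha, ← hb, ← hc]; module
    rw [div_eq_inv_mul, mul_smul, ← this, smul_smul]
    norm_num
  have := h1 (j, 1)
  rw [e] at this
  simp only [map_smul, LinearMap.smul_apply, h0] at this
  norm_num at this

/-- Vectors with the Gram matrix of an edge-scribed orthoplex come from a Lorentz frame. -/
theorem exists_frame {u : Fin 4 × ℤˣ → Lorentz 3} (h1 : ∀ i, mink (u i) (u i) = 1)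
    (h2 : ∀ i j, i.1 ≠ j.1 → mink (u i) (u j) = -1) (h3 : ∀ i, u (i, 1) ≠ u (i, -1)) :
    ∃ (e₀ : Lorentz 3) (e : Fin 4 → Lorentz 3), mink e₀ e₀ = -1 ∧ (∀ i, mink e₀ (e i) = 0) ∧
      (∀ i j, mink (e i) (e j) = if i = j then 1 else 0) ∧
      ∀ i ε, u (i, ε) = e₀ + (((ε : ℤ) : ℝ) * √2) • e i := by
  let w : Fin 4 → Lorentz 3 := fun i => u (i, 1) - u (i, -1)
  let p : Fin 4 → Lorentz 3 := fun i => u (i, 1) + u (i, -1)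
  -- The differences `w i` are nonisotropic and mutually orthogonal, and every sum `p i` is
  -- orthogonal to all of them. What remains is that `p i` does not depend on `i`.
  have hw0 : ∀ i, mink (w i) (w i) ≠ 0 := fun i => mink_sub_ne_zero h1 h2 (h3 i)
  have hww : ∀ i j, i ≠ j → mink (w i) (w j) = 0 := by
    intro i j hij
    simp only [w, map_sub, LinearMap.sub_apply, h2 (i, _) (j, _) hij]; norm_num
  have hpw : ∀ i j, mink (p i) (w j) = 0 := by
    intro i j
    by_cases hij : i = j
    · subst hij
      simp only [w, p, map_sub, map_add, LinearMap.add_apply, h1, mink_comm (u (i, -1)) (u (i, 1))]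
      ring
    · simp only [w, p, map_sub, map_add, LinearMap.add_apply, h2 (i, _) (j, _) hij]; norm_num
  have hpp : ∀ i j, i ≠ j → mink (p i) (p j) = -4 := by
    intro i j hij
    simp only [p, map_add, LinearMap.add_apply, h2 (i, _) (j, _) hij]; norm_num
  have hp : ∀ i j, p i = p j := by
    intro i j
    by_cases hij : i = j
    · rw [hij]
    obtain ⟨k, hki, hkj⟩ : ∃ k : Fin 4, k ≠ i ∧ k ≠ j := by revert i j; decide
    have hpk : p k ≠ 0 := by
      intro h0
      have := hpp k i hki
      rw [h0] at this; simp at this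
    let b : Option (Fin 4) → Lorentz 3 := fun o => o.elim (p k) w
    -- One sum and the four differences form a basis of the five-dimensional space.
    have hli : LinearIndependent ℝ b := by
      rw [Fintype.linearIndependent_iff]
      intro g hg
      rw [Fintype.sum_option] at hg
      have hs : ∀ l, g (some l) = 0 := by
        intro l
        have h0 := congrArg (fun x => mink (w l) x) hg
        simp only [map_add, map_sum, map_smul, map_zero, b, Option.elim, smul_eq_mul] at h0
        rw [mink_comm, hpw, Finset.sum_eq_single l (fun m _ hm => by rw [hww l m hm.symm, mul_zero])
          (by simp)] at h0
        simpa [hw0 l] using h0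
      intro o
      cases o with
      | some l => exact hs l
      | none =>
        simp only [hs, zero_smul, Finset.sum_const_zero, add_zero, b, Option.elim] at hg
        exact (smul_eq_zero.1 hg).resolve_right hpk
    have hspan : Submodule.span ℝ (Set.range b) = ⊤ :=
      hli.span_eq_top_of_card_eq_finrank (by simp)
    -- `p i - p j` is orthogonal to this basis: its products with `p k` are -4 + 4. Nondegeneracy
    -- gives `p i = p j`.
    have hz : mink (p i - p j) = 0 := by
      apply LinearMap.ext_on_range hspan
      intro o
      cases o with
      | some l => simp [b, hpw]
      | none => simp [b, hpp i k hki.symm, hpp j k hkj.symm]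
    exact sub_eq_zero.1 (eq_zero_of_mink fun y => by rw [hz]; rfl)
  have hpp' : ∀ i j, mink (p i) (p j) = -4 := by
    intro i j
    obtain ⟨k, hk⟩ := exists_ne i
    rw [hp j k]
    exact hpp i k hk.symm
  -- As ⟨p, p⟩ = 2 + 2c = -4 for the product c of opposite vectors, c = -3 and ⟨w, w⟩ = 2 - 2c = 8.
  -- This explains the factor √2/4 below.
  have huu : ∀ i, mink (w i) (w i) = 8 := by
    intro i
    have := hpp' i i
    simp only [p, w, map_add, map_sub, LinearMap.add_apply, LinearMap.sub_apply, h1,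
      mink_comm (u (i, -1)) (u (i, 1))] at this ⊢
    linarith
  have hsq : (√2 : ℝ) ^ 2 = 2 := Real.sq_sqrt (by norm_num)
  refine ⟨(1 / 2 : ℝ) • p 0, fun i => (√2 / 4) • w i, ?_, ?_, ?_, ?_⟩
  · simp only [map_smul, LinearMap.smul_apply, hpp', smul_eq_mul]; norm_num
  · intro i
    simp [hpw]
  · intro i j
    simp only [map_smul, LinearMap.smul_apply, smul_eq_mul]
    split_ifs with h
    · subst h
      rw [huu]; linear_combination hsq / 2
    · rw [hww i j h]; simp
  · intro i ε
    rw [hp 0 i, smul_smul, show ((ε : ℤ) : ℝ) * √2 * (√2 / 4) = ((ε : ℤ) : ℝ) * (1 / 2) by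
      linear_combination ((ε : ℤ) : ℝ) / 4 * hsq]
    rcases Int.units_eq_one_or ε with rfl | rfl
    · simp only [p, w]; push_cast; module
    · simp only [p, w]; push_cast; module

/-- The standard frame built from `b` and the time axis is mapped to the given one. Preserving the
nondegenerate form makes the map injective, hence bijective. -/
theorem exists_linear_of_frame (b : OrthonormalBasis (Fin 4) ℝ (Euc 4)) {e₀ : Lorentz 3}
    {e : Fin 4 → Lorentz 3} (h0 : mink e₀ e₀ = -1) (h1 : ∀ i, mink e₀ (e i) = 0)
    (h2 : ∀ i j, mink (e i) (e j) = if i = j then 1 else 0) :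
    ∃ L : Lorentz 3 ≃ₗ[ℝ] Lorentz 3, (∀ x y, mink (L x) (L y) = mink x y) ∧
      (∀ i, L (b i, 0) = e i) ∧ L (0, 1) = e₀ := by
  let M : Lorentz 3 →ₗ[ℝ] Lorentz 3 :=
    LinearMap.coprod (b.toBasis.constr ℝ e) (LinearMap.toSpanSingleton ℝ _ e₀)
  have hM : ∀ x, M x = ∑ i, inner ℝ (b i) x.1 • e i + x.2 • e₀ := by
    intro x
    simp [M, Module.Basis.constr_apply_fintype, b.repr_apply_apply]
  have h1' : ∀ i, mink (e i) e₀ = 0 := fun i => by rw [mink_comm, h1]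
  have hp : ∀ x y, mink (M x) (M y) = mink x y := by
    intro x y
    rw [hM, hM, mink_apply x y, ← b.sum_inner_mul_inner x.1 y.1]
    simp only [map_add, map_sum, map_smul, LinearMap.add_apply, LinearMap.sum_apply,
      LinearMap.smul_apply, h0, h1, h1', h2, smul_eq_mul, mul_ite, mul_one, mul_zero,
      Finset.sum_const_zero, add_zero, zero_add]
    rw [sub_eq_add_neg]
    congr 1
    · exact Finset.sum_congr rfl fun i _ => by simp [real_inner_comm, mul_comm]
    · ring
  have hinj : Function.Injective M := by
    rw [← LinearMap.ker_eq_bot, LinearMap.ker_eq_bot']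
    intro x hx
    exact eq_zero_of_mink fun y => by rw [← hp, hx]; simp
  refine ⟨LinearEquiv.ofInjectiveEndo M hinj, fun x y => hp x y, fun i => ?_, ?_⟩
  · rw [LinearEquiv.coe_ofInjectiveEndo, hM]
    simp [b.inner_eq_ite]
  · rw [LinearEquiv.coe_ofInjectiveEndo, hM]
    simp

/-- The normals of `P₀` are the time axis plus ±√2 times a basis vector, which is the normal form
that `exists_frame` produces for the normalized normals of `P`. -/
theorem mobiusEquivalent_of_orthonormalBasis (P₀ P : PolytopalPacking (crossPolytope 4))
    (b : OrthonormalBasis (Fin 4) ℝ (Euc 4))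
    (hb : ∀ i ε, P₀.vertex (i, ε) = (((ε : ℤ) : ℝ) * √2) • b i) : MobiusEquivalent P₀ P := by
  have hn : ∀ i, 0 < ‖P.vertex i‖ ^ 2 - 1 := fun i => by
    have := P.edgeScribed.1 i; nlinarith
  let c : Fin 4 × ℤˣ → ℝ := fun i => (√(‖P.vertex i‖ ^ 2 - 1))⁻¹
  have hc : ∀ i, 0 < c i := fun i => inv_pos.2 (Real.sqrt_pos.2 (hn i))
  have hc2 : ∀ i, c i ^ 2 * (‖P.vertex i‖ ^ 2 - 1) = 1 := fun i => by
    simp only [c, inv_pow, Real.sq_sqrt (hn i).le, inv_mul_cancel₀ (hn i).ne']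
  let u : Fin 4 × ℤˣ → Lorentz 3 := fun i => c i • P.normal i
  have hu : ∀ i j, mink (u i) (u j) = c i * c j * (inner ℝ (P.vertex i) (P.vertex j) - 1) := by
    intro i j
    simp only [u, PolytopalPacking.normal, map_smul, LinearMap.smul_apply, mink_normal, smul_eq_mul]
    ring
  have h1 : ∀ i, mink (u i) (u i) = 1 := by
    intro i
    rw [hu, real_inner_self_eq_norm_sq, ← sq, hc2]
  have h2 : ∀ i j, i.1 ≠ j.1 → mink (u i) (u j) = -1 := by
    intro i j hij
    have hne : i ≠ j := fun h => hij (by rw [h])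
    have hf : IsFace P.vertex {i, j} :=
      (P.sameFaces _).2 ((isFace_pair_crossPolytope_iff hne (by norm_num)).2 hij)
    obtain ⟨a1, a2⟩ := (segment_inter_sphere_iff (P.edgeScribed.1 i) (P.edgeScribed.1 j)).1
      (P.edgeScribed.2 i j hne hf)
    rw [hu]
    have h3 : (c i * c j * (inner ℝ (P.vertex i) (P.vertex j) - 1)) ^ 2 = 1 := by
      rw [mul_pow, a1]
      linear_combination (c j ^ 2 * (‖P.vertex j‖ ^ 2 - 1)) * hc2 i + hc2 j
    rcases sq_eq_one_iff.1 h3 with h | h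
    · nlinarith [mul_pos (hc i) (hc j)]
    · exact h
  have h3 : ∀ i, u (i, 1) ≠ u (i, -1) := by
    intro i h
    have e1 : c (i, 1) = c (i, -1) := by
      simpa [u, PolytopalPacking.normal] using congrArg Prod.snd h
    have e2 : P.vertex (i, 1) = P.vertex (i, -1) := by
      have := congrArg Prod.fst h
      simp only [u, PolytopalPacking.normal, Prod.smul_fst, e1] at this
      exact smul_right_injective _ (hc _).ne' this
    obtain ⟨a, k, -, h'⟩ := (P.sameFaces {(i, 1)}).2 (isFace_singleton_crossPolytope _)
    have h4 := (h' (i, 1)).1 rfl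
    rw [e2, ← h' (i, -1)] at h4
    have h5 := congrArg Prod.snd (Set.mem_singleton_iff.1 h4)
    exact units_ne_neg_self 1 h5.symm
  obtain ⟨e₀, e, f1, f2, f3, f4⟩ := exists_frame h1 h2 h3
  obtain ⟨L, hL, hLe, hL0⟩ := exists_linear_of_frame b f1 f2 f3
  refine mobiusEquivalent_of_linear P₀ P hL ?_ ?_
  · have : e₀ = (1 / 2 : ℝ) • (u (0, 1) + u (0, -1)) := by
      rw [f4, f4]; push_cast; module
    rw [hL0, this]
    simp only [u, PolytopalPacking.normal, Prod.smul_snd, Prod.snd_add, smul_eq_mul]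
    have := hc (0, 1)
    have := hc (0, -1)
    positivity
  · rintro ⟨i, ε⟩
    refine ⟨c (i, ε), hc _, ?_⟩
    have e1 : P₀.normal (i, ε) =
        ((0, 1) : Lorentz 3) + (((ε : ℤ) : ℝ) * √2) • ((b i, 0) : Lorentz 3) := by
      rw [PolytopalPacking.normal, hb]
      simp
    rw [e1, map_add, map_smul, hLe, hL0, ← f4]

/-! ### Restriction of Lorentz transformations to a hyperplane -/

/-- The Lorentz model of the inclusion `j` of a hyperplane: the Lorentz space of the hyperplane is
the orthogonal complement of the unit vector `h`. -/
structure HyperplaneModel {d d' : ℕ} (j : Euc d' →ᵃⁱ[ℝ] Euc d) where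
  J : Lorentz d' →ₗ[ℝ] Lorentz d
  h : Lorentz d
  isometry : ∀ x y, mink (J x) (J y) = mink x y
  orthogonal : ∀ x, mink h (J x) = 0
  unit : mink h h = 1
  spans : ∀ z, ∃ x, ∃ c : ℝ, z = J x + c • h
  compat : ∀ p, ∃ c : ℝ, 0 < c ∧ J (nullVec p) = c • nullVec (extend j p)

namespace HyperplaneModel

variable {d d' : ℕ} {j : Euc d' →ᵃⁱ[ℝ] Euc d} (M : HyperplaneModel j)

theorem injective : Function.Injective M.J := by
  rw [← LinearMap.ker_eq_bot, LinearMap.ker_eq_bot']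
  intro x hx
  exact eq_zero_of_mink fun y => by rw [← M.isometry, hx]; simp

theorem preimage_half (u : Lorentz d') : extend j ⁻¹' half (M.J u) = half u := by
  ext p
  obtain ⟨c, hc, e⟩ := M.compat p
  simp only [Set.mem_preimage, half, Set.mem_ofPred_eq]
  rw [← M.isometry, e, map_smul, smul_eq_mul, mul_nonneg_iff_of_pos_left hc]

/-- The pairs of a Möbius transformation of the space and its restriction to the hyperplane, where
the behaviour on the normal vector is prescribed by the character `χ`. -/
def restriction (χ : (Lorentz d' ≃ₗ[ℝ] Lorentz d') →* ℝˣ) :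
    Subgroup (Equiv.Perm (RHat d) × Equiv.Perm (RHat d')) where
  carrier := {g | ∃ L L', Lifts L g.1 ∧ Lifts L' g.2 ∧ (∀ x, L (M.J x) = M.J (L' x)) ∧
    L M.h = ((χ L' : ℝˣ) : ℝ) • M.h}
  one_mem' := ⟨1, 1, Lifts.one, Lifts.one, fun x => rfl, by simp⟩
  mul_mem' := by
    rintro ⟨f, f'⟩ ⟨g, g'⟩ ⟨L, L', h1, h2, h3, h4⟩ ⟨K, K', k1, k2, k3, k4⟩
    refine ⟨L * K, L' * K', h1.mul k1, h2.mul k2, fun x => ?_, ?_⟩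
    · simp [h3, k3]
    · simp only [LinearEquiv.mul_apply, k4, map_smul, h4, map_mul, smul_smul, Units.val_mul,
        mul_comm]
  inv_mem' := by
    rintro ⟨f, f'⟩ ⟨L, L', h1, h2, h3, h4⟩
    have hi : ∀ x, L (L⁻¹ x) = x := fun x => L.apply_symm_apply x
    have hi' : ∀ x, L' (L'⁻¹ x) = x := fun x => L'.apply_symm_apply x
    refine ⟨L⁻¹, L'⁻¹, h1.inv, h2.inv, fun x => L.injective ?_, L.injective ?_⟩
    · rw [hi, h3, hi']
    · rw [hi, map_smul, h4, smul_smul, map_inv, Units.inv_mul, one_smul]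

variable {χ : (Lorentz d' ≃ₗ[ℝ] Lorentz d') →* ℝˣ}
  {g : Equiv.Perm (RHat d)} {g' : Equiv.Perm (RHat d')}

/-- A trivial restriction has the trivial lift, on which the character is 1. So the spatial lift
fixes the image of `M.J` and also `M.h`, which together span; a reflection in the plane itself is
excluded. -/
theorem eq_one_left [NeZero d'] {M : HyperplaneModel j}
    (h : (g, (1 : Equiv.Perm (RHat d'))) ∈ M.restriction χ) : g = 1 := by
  obtain ⟨L, L', h1, h2, h3, h4⟩ := h
  have hL' : L' = 1 := h2.eq_one
  subst hL'
  have hL : L = 1 := by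
    ext1 z
    obtain ⟨x, c, rfl⟩ := M.spans z
    rw [map_add, map_smul, h3, h4]
    simp
  subst hL
  exact h1.perm_unique Lifts.one

theorem eq_one_right [NeZero d] {M : HyperplaneModel j}
    (h : ((1 : Equiv.Perm (RHat d)), g') ∈ M.restriction χ) : g' = 1 := by
  obtain ⟨L, L', h1, h2, h3, h4⟩ := h
  have hL : L = 1 := h1.eq_one
  subst hL
  have hL' : L' = 1 := by
    ext1 z
    exact (M.injective (h3 z)).symm
  subst hL'
  exact h2.perm_unique Lifts.one

theorem apply_extend {M : HyperplaneModel j} (h : (g, g') ∈ M.restriction χ) (p : RHat d') :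
    g (extend j p) = extend j (g' p) := by
  obtain ⟨L, L', h1, h2, h3, -⟩ := h
  obtain ⟨a, ha, ea⟩ := M.compat p
  obtain ⟨b, hb, eb⟩ := M.compat (g' p)
  obtain ⟨c, hc, ec⟩ := h1.2 (extend j p)
  obtain ⟨k, hk, ek⟩ := h2.2 p
  have := h3 (nullVec p)
  rw [ea, map_smul, ec, ek, map_smul, eb, smul_smul, smul_smul] at this
  refine nullVec_smul_inj (c := (a * c)⁻¹ * (k * b)) ?_
  rw [mul_smul, ← this, smul_smul, inv_mul_cancel₀ (mul_pos ha hc).ne', one_smul]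

end HyperplaneModel

/-- A subgroup of a product of two groups that is the graph of an isomorphism. -/
theorem exists_mulEquiv_of_relation {G G' : Type*} [Group G] [Group G'] (Q : Subgroup (G × G'))
    {S : Set G} {S' : Set G'} (h1 : ∀ s ∈ S, ∃ s' ∈ S', (s, s') ∈ Q)
    (h2 : ∀ s' ∈ S', ∃ s ∈ S, (s, s') ∈ Q) (h3 : ∀ g, (g, (1 : G')) ∈ Q → g = 1)
    (h4 : ∀ g', ((1 : G), g') ∈ Q → g' = 1) {Γ : Subgroup G} {Γ' : Subgroup G'}
    (hΓ : Γ = Subgroup.closure S) (hΓ' : Γ' = Subgroup.closure S') :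
    ∃ φ : Γ ≃* Γ', ∀ g : Γ, ((g : G), (φ g : G')) ∈ Q := by
  subst hΓ hΓ'
  -- Induction over the closures provides partners on both sides; triviality of the two kernels
  -- makes them unique.
  have e1 : ∀ g : Subgroup.closure S, ∃ g' : Subgroup.closure S', ((g : G), (g' : G')) ∈ Q := by
    rintro ⟨g, hg⟩
    induction hg using Subgroup.closure_induction with
    | mem s hs =>
      obtain ⟨s', hs', h⟩ := h1 s hs
      exact ⟨⟨s', Subgroup.subset_closure hs'⟩, h⟩
    | one => exact ⟨1, Q.one_mem⟩
    | mul x y _ _ hx hy =>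
      obtain ⟨x', hx'⟩ := hx
      obtain ⟨y', hy'⟩ := hy
      exact ⟨x' * y', Q.mul_mem hx' hy'⟩
    | inv x _ hx =>
      obtain ⟨x', hx'⟩ := hx
      exact ⟨x'⁻¹, Q.inv_mem hx'⟩
  have e2 : ∀ g' : Subgroup.closure S', ∃ g : Subgroup.closure S, ((g : G), (g' : G')) ∈ Q := by
    rintro ⟨g, hg⟩
    induction hg using Subgroup.closure_induction with
    | mem s hs =>
      obtain ⟨s', hs', h⟩ := h2 s hs
      exact ⟨⟨s', Subgroup.subset_closure hs'⟩, h⟩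
    | one => exact ⟨1, Q.one_mem⟩
    | mul x y _ _ hx hy =>
      obtain ⟨x', hx'⟩ := hx
      obtain ⟨y', hy'⟩ := hy
      exact ⟨x' * y', Q.mul_mem hx' hy'⟩
    | inv x _ hx =>
      obtain ⟨x', hx'⟩ := hx
      exact ⟨x'⁻¹, Q.inv_mem hx'⟩
  have u1 : ∀ g a b, (g, a) ∈ Q → (g, b) ∈ Q → a = b := by
    intro g a b ha hb
    have := Q.mul_mem (Q.inv_mem ha) hb
    simp only [Prod.inv_mk, Prod.mk_mul_mk, inv_mul_cancel] at this
    exact inv_mul_eq_one.1 (h4 _ this)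
  have u2 : ∀ g a b, (a, g) ∈ Q → (b, g) ∈ Q → a = b := by
    intro g a b ha hb
    have := Q.mul_mem (Q.inv_mem ha) hb
    simp only [Prod.inv_mk, Prod.mk_mul_mk, inv_mul_cancel] at this
    exact inv_mul_eq_one.1 (h3 _ this)
  choose φ hφ using e1
  choose φ' hφ' using e2
  refine ⟨MulEquiv.mk ⟨φ, φ', fun g => ?_, fun g => ?_⟩ fun g k => ?_, hφ⟩
  · exact Subtype.ext (u2 _ _ _ (hφ' _) (hφ g))
  · exact Subtype.ext (u1 _ _ _ (hφ _) (hφ' g))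
  · exact Subtype.ext (u1 _ _ _ (hφ _) (Q.mul_mem (hφ g) (hφ k)))

/-! ### Cross sections, transport of sections, and dual spheres as zero sets -/

section Sections

variable {ι ι' : Type} {d d' : ℕ} {v₀ : ι → Euc (d + 1)} {v₀' : ι' → Euc (d' + 1)}

/-- The normals of the seeds, and so of the whole orbit, lie in the image of `M.J`: these balls are
orthogonal to the plane. The planar disk has the corresponding planar normal and determines it, so
no two balls of the orbit have the same section. -/
theorem HyperplaneModel.isCrossSection [NeZero d'] {j : Euc d' →ᵃⁱ[ℝ] Euc d}
    (M : HyperplaneModel j) (χ : (Lorentz d' ≃ₗ[ℝ] Lorentz d') →* ℝˣ)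
    {P : PolytopalPacking v₀} {P' : PolytopalPacking v₀'} (S : ApollonianSection P)
    (hseeds : ∀ b ∈ S.seeds, ∃ u, mink u u = 1 ∧ b = half (M.J u))
    (hballs : (fun b => extend j ⁻¹' b) '' S.seeds = P'.balls)
    (φ : S.group ≃* P'.apollonianGroup)
    (hφ : ∀ g : S.group, ((g : Equiv.Perm (RHat d)), (φ g : Equiv.Perm (RHat d'))) ∈
      M.restriction χ) : IsCrossSection S j P' := by
  have hpre : ∀ (g : S.group) (u : Lorentz d'), mink u u = 1 → ∃ u', mink u' u' = 1 ∧
      (g : Equiv.Perm (RHat d)) '' half (M.J u) = half (M.J u') ∧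
      (φ g : Equiv.Perm (RHat d')) '' half u = half u' := by
    intro g u hu
    obtain ⟨L, L', h1, h2, h3, -⟩ := hφ g
    refine ⟨L' u, by rw [h2.1, hu], ?_, h2.image_half u⟩
    rw [← h3]
    exact h1.image_half _
  have hequi : ∀ g : S.group, ∀ b ∈ S.seeds,
      extend j ⁻¹' ((g : Equiv.Perm (RHat d)) '' b) =
        (φ g : Equiv.Perm (RHat d')) '' (extend j ⁻¹' b) := by
    intro g b hb
    obtain ⟨u, hu, rfl⟩ := hseeds b hb
    obtain ⟨u', -, h1, h2⟩ := hpre g u hu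
    rw [h1, M.preimage_half, M.preimage_half, h2]
  refine ⟨hballs, φ, fun g p => HyperplaneModel.apply_extend (hφ g) p, ⟨?_, ?_, ?_⟩, hequi⟩
  · rintro _ ⟨g, hg, b, hb, rfl⟩
    refine ⟨φ ⟨g, hg⟩, (φ ⟨g, hg⟩).2, extend j ⁻¹' b, ?_, hequi ⟨g, hg⟩ b hb⟩
    rw [← hballs]
    exact ⟨b, hb, rfl⟩
  · rintro _ ⟨g, hg, b, hb, rfl⟩ _ ⟨k, hk, c, hc, rfl⟩ heq
    obtain ⟨u, hu, rfl⟩ := hseeds b hb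
    obtain ⟨w, hw, rfl⟩ := hseeds c hc
    obtain ⟨u', hu', h1, -⟩ := hpre ⟨g, hg⟩ u hu
    obtain ⟨w', hw', k1, -⟩ := hpre ⟨k, hk⟩ w hw
    simp only at h1 k1 heq
    rw [h1, k1, M.preimage_half, M.preimage_half] at heq
    rw [h1, k1, half_injective hu' hw' heq]
  · rintro _ ⟨g', hg', b', hb', rfl⟩
    rw [← hballs] at hb'
    obtain ⟨b, hb, rfl⟩ := hb'
    refine ⟨(φ.symm ⟨g', hg'⟩ : Equiv.Perm (RHat d)) '' b, ⟨_, (φ.symm ⟨g', hg'⟩).2, b, hb, rfl⟩,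
        ?_⟩
    have := hequi (φ.symm ⟨g', hg'⟩) b hb
    rwa [MulEquiv.apply_symm_apply] at this

theorem IsCrossSection.algebraicallyEquivalent {j : Euc d' →ᵃⁱ[ℝ] Euc d}
    {P : PolytopalPacking v₀} {P' : PolytopalPacking v₀'} {S : ApollonianSection P}
    (h : IsCrossSection S j P') : AlgebraicallyEquivalent S P'.full := by
  obtain ⟨-, φ, -, h1, h2⟩ := h
  exact ⟨φ, _, h1, h2⟩

/-- The section is conjugated by `ν`, and the equivariant bijection is precomposed with `ν⁻¹`. -/
theorem MobiusEquivalent.hasSectionOfType {P B : PolytopalPacking v₀} (h : MobiusEquivalent P B)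
    (hP : HasSectionOfType P v₀') : HasSectionOfType B v₀' := by
  obtain ⟨ν, -, hb, hg⟩ := h
  obtain ⟨S, P', φ, ψ, h1, h2⟩ := hP
  have hinj : Function.Injective (MulAut.conj ν).toMonoidHom := (MulAut.conj ν).injective
  have hcancel : ∀ b : Set (RHat d), ⇑ν⁻¹ '' (ν '' b) = b := by
    intro b
    rw [← Set.image_comp]
    have : (⇑ν⁻¹ ∘ ⇑ν) = id := by ext1 p; simp
    rw [this, Set.image_id]
  have hconj : ∀ (g : Equiv.Perm (RHat d)) (b : Set (RHat d)),
      ⇑(MulAut.conj ν g) '' (ν '' b) = ν '' (g '' b) := by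
    intro g b
    rw [← Set.image_comp, ← Set.image_comp]
    congr 1
    ext1 p
    simp
  let S' : ApollonianSection B :=
    { group := S.group.map (MulAut.conj ν).toMonoidHom
      group_le := by rw [← hg]; exact Subgroup.map_mono S.group_le
      seeds := (fun b => ν '' b) '' S.seeds
      seeds_subset := by rw [← hb]; exact Set.image_mono S.seeds_subset }
  have hcar : S'.carrier = (fun b => ν '' b) '' S.carrier := by
    ext b
    constructor
    · rintro ⟨_, ⟨g, hg, rfl⟩, _, ⟨c, hc, rfl⟩, rfl⟩
      exact ⟨g '' c, ⟨g, hg, c, hc, rfl⟩, (hconj g c).symm⟩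
    · rintro ⟨_, ⟨g, hg, c, hc, rfl⟩, rfl⟩
      exact ⟨MulAut.conj ν g, ⟨g, hg, rfl⟩, ν '' c, ⟨c, hc, rfl⟩, (hconj g c).symm⟩
  let e : S.group ≃* S'.group := S.group.equivMapOfInjective _ hinj
  have he : ∀ g : S.group,
      ((e g : S'.group) : Equiv.Perm (RHat d)) = MulAut.conj ν g := fun g => rfl
  refine ⟨S', P', e.symm.trans φ, fun b => ψ (⇑ν⁻¹ '' b), ?_, ?_⟩
  · rw [hcar]
    refine ⟨?_, ?_, ?_⟩
    · rintro _ ⟨b, hb, rfl⟩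
      simp only [hcancel]
      exact h1.mapsTo hb
    · rintro _ ⟨b, hb, rfl⟩ _ ⟨c, hc, rfl⟩ heq
      simp only [hcancel] at heq
      rw [h1.injOn hb hc heq]
    · intro b' hb'
      obtain ⟨b, hb, rfl⟩ := h1.surjOn hb'
      exact ⟨_, ⟨b, hb, rfl⟩, by simp only [hcancel]⟩
  · rintro g _ ⟨b, hb, rfl⟩
    obtain ⟨g, rfl⟩ := e.surjective g
    simp only [he, hconj, hcancel, MulEquiv.trans_apply, MulEquiv.symm_apply_apply]
    exact h2 g b hb

theorem PolytopalPacking.ball_eq_of_mob {P : PolytopalPacking v₀} (h : P.mob = 1) (i : ι) :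
    P.ball i = half (P.normal i) := by
  rw [P.ball_eq, h]
  simp

/-- The lifted facet spans exactly the hyperplane orthogonal to `n`, so lying in its affine hull is
a single linear equation. -/
theorem PolytopalPacking.dualSphere_eq_zeroSet {P : PolytopalPacking v₀} (h : P.mob = 1)
    {S : Set ι} {n : Lorentz d} (h1 : ∀ i ∈ S, mink n (P.normal i) = 0)
    (h2 : ∀ x, mink n x = 0 → x ∈ Submodule.span ℝ (P.normal '' S)) :
    P.dualSphere S = zeroSet n := by
  rw [P.dualSphere_eq, h]
  simp only [Equiv.Perm.coe_one, Set.image_id, zeroSet]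
  ext p
  refine ⟨fun hp => ?_, fun hp => h2 _ hp⟩
  have : Submodule.span ℝ (P.normal '' S) ≤ LinearMap.ker (mink n) := by
    rw [Submodule.span_le]
    rintro _ ⟨i, hi, rfl⟩
    exact h1 i hi
  exact this hp

end Sections

/-- The reflecting vector is orthogonal to `M.h`, which is therefore fixed; hence the trivial
character. -/
theorem HyperplaneModel.refl_mem {d d' : ℕ} {j : Euc d' →ᵃⁱ[ℝ] Euc d} (M : HyperplaneModel j)
    {n : Lorentz d'} (hn : mink n n = 1) (hN : mink (M.J n) (M.J n) = 1)
    {f : Equiv.Perm (RHat d)} {f' : Equiv.Perm (RHat d')} (hf : Lifts (refl (M.J n) hN) f)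
    (hf' : Lifts (refl n hn) f') : (f, f') ∈ M.restriction 1 := by
  refine ⟨_, _, hf, hf', fun x => ?_, ?_⟩
  · simp [refl_apply, M.isometry]
  · rw [refl_apply, mink_comm, M.orthogonal]
    simp

/-- `N₁` and `N₂` are orthogonal unit vectors spanning the same plane as `M.J n` and `M.h`. The
product of their reflections is -1 on that plane, so it restricts to the reflection in `n` and
negates `M.h`, in accordance with the determinant of that reflection. -/
theorem HyperplaneModel.refl_mul_refl_mem {d d' : ℕ} {j : Euc d' →ᵃⁱ[ℝ] Euc d}
    (M : HyperplaneModel j) {n : Lorentz d'} (hn : mink n n = 1) {N₁ N₂ : Lorentz d}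
    (hN₁ : mink N₁ N₁ = 1) (hN₂ : mink N₂ N₂ = 1) (e₁ : √2 • N₁ = M.J n + M.h)
    (e₂ : √2 • N₂ = M.J n - M.h)
    {f g : Equiv.Perm (RHat d)} {f' : Equiv.Perm (RHat d')} (hf : Lifts (refl N₁ hN₁) f)
    (hg : Lifts (refl N₂ hN₂) g) (hf' : Lifts (refl n hn) f') :
    (f * g, f') ∈ M.restriction LinearEquiv.det := by
  have hsq : (√2 : ℝ) ^ 2 = 2 := Real.sq_sqrt (by norm_num)
  have hr : ∀ (N : Lorentz d) (hN : mink N N = 1) (W : Lorentz d), √2 • N = W →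
      ∀ x, refl N hN x = x - mink W x • W := by
    rintro N hN _ rfl x
    rw [refl_apply, map_smul, LinearMap.smul_apply, smul_eq_mul, smul_smul]
    congr 2
    linear_combination - mink N x * hsq
  have ho : ∀ x, mink (M.J x) M.h = 0 := fun x => by rw [mink_comm, M.orthogonal]
  refine ⟨_, _, hf.mul hg, hf', fun x => ?_, ?_⟩
  · simp only [LinearEquiv.mul_apply, hr _ _ _ e₁, hr _ _ _ e₂, map_add, map_sub, map_smul,
      LinearMap.add_apply, LinearMap.sub_apply, M.isometry, M.orthogonal, M.unit, ho, hn,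
      refl_apply, smul_eq_mul]
    module
  · rw [det_refl]
    simp only [LinearEquiv.mul_apply, hr _ _ _ e₁, hr _ _ _ e₂, map_add, map_sub, map_smul,
      LinearMap.add_apply, LinearMap.sub_apply, M.isometry, M.orthogonal, M.unit, ho, hn,
      smul_eq_mul]
    module

/-! ### Faces of tetrahedra and cubes -/

/-- Supporting functionals are transported by adjoints. -/
theorem isFace_linear {ι : Type} {d d' : ℕ} {v : ι → Euc d} {v' : ι → Euc d'}
    (A : Euc d ≃ₗ[ℝ] Euc d') (h : ∀ i, v' i = A (v i)) (S : Set ι) : IsFace v' S ↔ IsFace v S := by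
  constructor
  · rintro ⟨a, c, h1, h2⟩
    refine ⟨LinearMap.adjoint (A : Euc d →ₗ[ℝ] Euc d') a, c, fun i => ?_, fun i => ?_⟩
    · rw [LinearMap.adjoint_inner_left]; simpa [h] using h1 i
    · rw [LinearMap.adjoint_inner_left]; simpa [h] using h2 i
  · rintro ⟨a, c, h1, h2⟩
    refine ⟨LinearMap.adjoint (A.symm : Euc d' →ₗ[ℝ] Euc d) a, c, fun i => ?_, fun i => ?_⟩
    · rw [LinearMap.adjoint_inner_left]; simpa [h] using h1 i
    · rw [LinearMap.adjoint_inner_left]; simpa [h] using h2 i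

theorem inner_tetrahedron (i k : Fin 4) :
    inner ℝ (tetrahedron i) (tetrahedron k) = if i = k then 3 else -1 := by
  rw [PiLp.inner_apply, Fin.sum_univ_three]
  fin_cases i <;> fin_cases k <;> simp [tetrahedron] <;> norm_num

/-- Pairing with the sum of the vertices in `S` takes the value 4 - |S| on `S` and -|S| elsewhere.
-/
theorem isFace_tetrahedron (S : Set (Fin 4)) : IsFace tetrahedron S := by
  classical
  have key : ∀ k, inner ℝ (∑ i ∈ S.toFinset, tetrahedron i) (tetrahedron k) =
      (if k ∈ S then 4 else 0) - (S.toFinset.card : ℝ) := by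
    intro k
    rw [sum_inner]
    have : ∀ i, inner ℝ (tetrahedron i) (tetrahedron k) = (if i = k then 4 else 0) - (1 : ℝ) := by
      intro i; rw [inner_tetrahedron]; split_ifs <;> norm_num
    simp only [this, Finset.sum_sub_distrib, Finset.sum_ite_eq', Set.mem_toFinset]
    simp
  refine ⟨∑ i ∈ S.toFinset, tetrahedron i, 4 - (S.toFinset.card : ℝ), fun k => ?_, fun k => ?_⟩
  · rw [key]; split_ifs <;> linarith
  · rw [key]
    split_ifs with h
    · simp [h]
    · simp only [h, false_iff]
      intro h; linarith

theorem isFacet_tetrahedron_iff (S : Set (Fin 4)) : IsFacet tetrahedron S ↔ ∃ k, S = {k}ᶜ := by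
  constructor
  · rintro ⟨-, hS, hmax⟩
    obtain ⟨k, hk⟩ := (Set.ne_univ_iff_exists_notMem S).1 hS
    refine ⟨k, ?_⟩
    rcases hmax {k}ᶜ (isFace_tetrahedron _) (by simpa using hk) with h | h
    · exact h.symm
    · simp at h
  · rintro ⟨k, rfl⟩
    refine ⟨isFace_tetrahedron _, by simp, fun T _ hT => ?_⟩
    by_cases hk : k ∈ T
    · right
      ext i
      by_cases hi : i = k
      · simp [hi, hk]
      · simpa using hT (by simpa using hi)
    · left
      exact Set.Subset.antisymm (by simpa using hk) hT

theorem inner_cube {n : ℕ} (a : Euc n) (e : Fin n → ℤˣ) :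
    inner ℝ a (cube n e) = ∑ k, ((e k : ℤ) : ℝ) * a k := by
  simp [cube, PiLp.inner_apply]

theorem inner_cube_update {n : ℕ} (a : Euc n) (e : Fin n → ℤˣ) (k : Fin n) (u : ℤˣ) :
    inner ℝ a (cube n (Function.update e k u)) =
      inner ℝ a (cube n e) + (((u : ℤ) : ℝ) - ((e k : ℤ) : ℝ)) * a k := by
  rw [inner_cube, inner_cube, ← sub_eq_iff_eq_add', ← Finset.sum_sub_distrib,
    Finset.sum_eq_single k]
  · simp; ring
  · intro l _ hl
    simp [Function.update_of_ne hl]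
  · simp

/-- The facet of a cube on which the coordinate `k` has the sign `s`. -/
def cubeFacet {n : ℕ} (k : Fin n) (s : ℤˣ) : Set (Fin n → ℤˣ) := {e | e k = s}

theorem isFace_cubeFacet {n : ℕ} (k : Fin n) (s : ℤˣ) : IsFace (cube n) (cubeFacet k s) := by
  have key : ∀ e : Fin n → ℤˣ, inner ℝ (EuclideanSpace.single k ((s : ℤ) : ℝ)) (cube n e) =
      ((e k : ℤ) : ℝ) * ((s : ℤ) : ℝ) := by
    intro e
    simp [cube, EuclideanSpace.inner_single_left, mul_comm]
  refine ⟨EuclideanSpace.single k ((s : ℤ) : ℝ), 1, fun e => ?_, fun e => ?_⟩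
  · rw [key]; exact (units_mul_le_one _ _).1
  · rw [key]; exact (units_mul_le_one _ _).2

theorem cubeFacet_ne_univ {n : ℕ} (k : Fin n) (s : ℤˣ) : cubeFacet k s ≠ Set.univ := by
  intro h
  have : (fun _ => -s) ∈ cubeFacet k s := by rw [h]; trivial
  exact units_ne_neg_self s (Eq.symm this)

theorem isFacet_cube_iff {n : ℕ} [NeZero n] (S : Set (Fin n → ℤˣ)) :
    IsFacet (cube n) S ↔ ∃ k s, S = cubeFacet k s := by
  constructor
  · rintro ⟨⟨a, c, h, h'⟩, hS, hmax⟩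
    have hne : S.Nonempty := by
      rw [Set.nonempty_iff_ne_empty]
      rintro rfl
      rcases hmax _ (isFace_cubeFacet 0 1) (Set.empty_subset _) with h0 | h0
      · have : (fun _ => 1) ∈ cubeFacet (0 : Fin n) 1 := rfl
        rw [h0] at this
        exact this
      · exact cubeFacet_ne_univ _ _ h0
    have ha : ∃ k, a k ≠ 0 := by
      by_contra! ha
      obtain ⟨e, he⟩ := hne
      rw [h', inner_cube] at he
      apply hS
      ext e'
      rw [h', inner_cube]
      simpa [ha] using he
    obtain ⟨k, hk⟩ := ha
    let s : ℤˣ := if 0 ≤ a k then 1 else -1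
    refine ⟨k, s, ?_⟩
    have hsub : S ⊆ cubeFacet k s := by
      intro e he
      have h1 := (h' e).1 he
      -- Flipping coordinate `k` of a vertex of `S` cannot increase the functional, so that
      -- coordinate has the sign of `a k`.
      have h2 := h (Function.update e k (-e k))
      rw [inner_cube_update, h1] at h2
      change e k = s
      rcases Int.units_eq_one_or (e k) with h3 | h3 <;> rw [h3] at h2 ⊢ <;> simp at h2
      · have : 0 ≤ a k := by linarith
        simp [s, this]
      · have : ¬ 0 ≤ a k := fun h => hk (by linarith)
        simp [s, this]
    rcases hmax _ (isFace_cubeFacet k s) hsub with h | h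
    · exact h.symm
    · exact absurd h (cubeFacet_ne_univ _ _)
  · rintro ⟨k, s, rfl⟩
    refine ⟨isFace_cubeFacet k s, cubeFacet_ne_univ k s, ?_⟩
    rintro T ⟨a, c, h, h'⟩ hT
    have ha : ∀ l, l ≠ k → a l = 0 := by
      intro l hl
      have h1 := (h' (fun _ => s)).1 (hT rfl)
      have h2 := (h' (Function.update (fun _ => s) l (-s))).1
        (hT (Function.update_of_ne hl.symm _ _))
      rw [inner_cube_update, h1] at h2
      rcases Int.units_eq_one_or s with h3 | h3 <;> rw [h3] at h2 <;> norm_num at h2 <;> linarith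
    have key : ∀ e, inner ℝ a (cube n e) = ((e k : ℤ) : ℝ) * a k := by
      intro e
      rw [inner_cube, Finset.sum_eq_single k (fun l _ hl => by simp [ha l hl]) (by simp)]
    have hc : ((s : ℤ) : ℝ) * a k = c := by
      have := (h' (fun _ => s)).1 (hT rfl)
      rwa [key] at this
    by_cases hk : a k = 0
    · right
      ext e
      rw [h', key, ← hc]
      simp [hk]
    · left
      refine Set.Subset.antisymm (fun e he => ?_) hT
      have := (h' e).1 he
      rw [key, ← hc] at this
      have := mul_right_cancel₀ hk this
      exact Units.ext (Int.cast_injective (α := ℝ) this)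

/-- Exchanging the coordinate `k` between `e` and `f` preserves the sum of the two values of the
functional. Both new vertices then lie on the face as well, so the first one must be `f`: the ends
of an edge differ in one coordinate. -/
theorem unique_ne_of_isFace_cube {n : ℕ} {e f : Fin n → ℤˣ} (h : IsFace (cube n) {e, f})
    (k : Fin n) (hk : e k ≠ f k) : f = Function.update e k (f k) := by
  obtain ⟨a, c, h1, h2⟩ := h
  have he := (h2 e).1 (by simp)
  have hf := (h2 f).1 (by simp)
  have he' := h1 (Function.update e k (f k))
  have hf' := h1 (Function.update f k (e k))
  rw [inner_cube_update, he] at he'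
  rw [inner_cube_update, hf] at hf'
  have : Function.update e k (f k) ∈ ({e, f} : Set (Fin n → ℤˣ)) := by
    rw [h2, inner_cube_update, he]
    linarith
  rcases this with h3 | h3
  · exact absurd (by simpa using (congrFun h3 k).symm) hk
  · exact (Set.mem_singleton_iff.1 h3).symm

/-! ### Orthoplicial packings from orthogonal frames -/

theorem exists_orthonormalBasis_of_orthogonal {n : ℕ} {v : Fin n → Euc n}
    (hv : ∀ i k, inner ℝ (v i) (v k) = if i = k then 2 else 0) :
    ∃ b : OrthonormalBasis (Fin n) ℝ (Euc n), ∀ i, v i = √2 • b i := by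
  have hsq : (√2 : ℝ) * √2 = 2 := Real.mul_self_sqrt (by norm_num)
  have hon : Orthonormal ℝ fun i => (√2)⁻¹ • v i := by
    rw [orthonormal_iff_ite]
    intro i k
    rw [inner_smul_left, inner_smul_right, hv]
    split_ifs
    · simp
      field_simp
      linarith
    · simp
  obtain ⟨b, hb⟩ := Orthonormal.exists_orthonormalBasis_extension_of_card_eq
    (𝕜 := ℝ) (E := Euc n) (ι := Fin n) (by simp) (v := fun i => (√2)⁻¹ • v i) (s := Set.univ)
    (hon.comp _ Subtype.val_injective)
  refine ⟨b, fun i => ?_⟩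
  rw [hb i trivial, smul_smul, mul_inv_cancel₀ (by positivity), one_smul]

theorem exists_linearEquiv_of_orthogonal {n : ℕ} {v : Fin n → Euc n}
    (hv : ∀ i k, inner ℝ (v i) (v k) = if i = k then 2 else 0) :
    ∃ A : Euc n ≃ₗ[ℝ] Euc n, ∀ i, (((i.2 : ℤ) : ℝ)) • v i.1 = A (crossPolytope n i) := by
  obtain ⟨b, hb⟩ := exists_orthonormalBasis_of_orthogonal hv
  refine ⟨b.repr.symm.toLinearEquiv.trans
    (LinearEquiv.smulOfUnit (Units.mk0 (√2) (by positivity))), fun i => ?_⟩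
  have : crossPolytope n i = ((i.2 : ℤ) : ℝ) • EuclideanSpace.single i.1 (1 : ℝ) := by
    rw [crossPolytope]
    ext k
    simp [PiLp.single_apply]
  rw [this, map_smul, hb]
  congr 1
  rw [LinearEquiv.trans_apply]
  simp [LinearEquiv.smulOfUnit, Units.smul_def]

/-- The packing of the cross polytope with the vertices `± v_i`, where the vectors `v_i` are
orthogonal and of length `√2`. -/
noncomputable def orthoPacking {d : ℕ} [NeZero d] (v : Fin (d + 1) → Euc (d + 1))
    (hv : ∀ i k, inner ℝ (v i) (v k) = if i = k then 2 else 0) :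
    PolytopalPacking (crossPolytope (d + 1)) where
  vertex i := ((i.2 : ℤ) : ℝ) • v i.1
  sameFaces := by
    obtain ⟨A, hA⟩ := exists_linearEquiv_of_orthogonal hv
    exact isFace_linear A hA
  edgeScribed := by
    have hn : ∀ i : Fin (d + 1) × ℤˣ, ‖((i.2 : ℤ) : ℝ) • v i.1‖ ^ 2 = 2 := by
      intro i
      have h1 : ‖v i.1‖ ^ 2 = 2 := by rw [← real_inner_self_eq_norm_sq, hv]; simp
      rw [norm_smul, mul_pow, h1, Real.norm_eq_abs, sq_abs]
      rcases Int.units_eq_one_or i.2 with h | h <;> rw [h] <;> simp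
    have hn1 : ∀ i : Fin (d + 1) × ℤˣ, 1 < ‖((i.2 : ℤ) : ℝ) • v i.1‖ := by
      intro i
      have := hn i
      have := norm_nonneg (((i.2 : ℤ) : ℝ) • v i.1)
      nlinarith
    refine ⟨hn1, fun i k hik hf => ?_⟩
    obtain ⟨A, hA⟩ := exists_linearEquiv_of_orthogonal hv
    have hne := (isFace_pair_crossPolytope_iff hik (by simpa using NeZero.ne d)).1
      ((isFace_linear A hA _).1 hf)
    rw [segment_inter_sphere_iff (hn1 i) (hn1 k), hn, hn, inner_smul_left, inner_smul_right, hv,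
      if_neg hne]
    norm_num
  mob := 1
  mob_mem := one_mem _

/-- The normal vector of the dual sphere of a facet of a cross polytope. -/
noncomputable def crossNormal {d : ℕ} (v : Fin (d + 1) → Euc (d + 1)) (e : Fin (d + 1) → ℤˣ) : Lorentz d :=
  -- The time coordinate is ‖v i‖² = 2, the value of the space part on every vertex of the facet.
  (∑ i, ((e i : ℤ) : ℝ) • v i, 2)

theorem isFacet_orthoPacking_iff {d : ℕ} [NeZero d] (v : Fin (d + 1) → Euc (d + 1))
    (hv : ∀ i k, inner ℝ (v i) (v k) = if i = k then 2 else 0)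
    (S : Set (Fin (d + 1) × ℤˣ)) :
    IsFacet (orthoPacking v hv).vertex S ↔ ∃ e, S = crossFacet e := by
  rw [← isFacet_crossPolytope_iff]
  exact isFacet_congr (orthoPacking v hv).sameFaces S

/-- The value is 4 for d = 3 and 2 for d = 2, hence the later normalizing factors 1/2 and √2/2. -/
theorem mink_crossNormal_self {d : ℕ} [NeZero d] (v : Fin (d + 1) → Euc (d + 1))
    (hv : ∀ i k, inner ℝ (v i) (v k) = if i = k then 2 else 0)
    (e : Fin (d + 1) → ℤˣ) :
    mink (crossNormal v e) (crossNormal v e) = 2 * d - 2 := by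
  have hu : ∀ u : ℤˣ, ((u : ℤ) : ℝ) * ((u : ℤ) : ℝ) = 1 := by
    intro u; rcases Int.units_eq_one_or u with rfl | rfl <;> norm_num
  have h : ∀ i, inner ℝ (((e i : ℤ) : ℝ) • v i) (∑ k, ((e k : ℤ) : ℝ) • v k) = 2 := by
    intro i
    simp only [inner_sum, inner_smul_left, inner_smul_right, hv, mul_ite, mul_zero,
      Finset.sum_ite_eq, Finset.mem_univ, if_true, RCLike.conj_to_real]
    linear_combination 2 * hu (e i)
  simp only [mink_apply, crossNormal, sum_inner, h]
  simp
  ring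

/-- The space part of `x` is expanded in the orthogonal vertices of the facet; orthogonality to
`crossNormal v e` says precisely that the time coordinate of this expansion is right. -/
theorem dualSphere_orthoPacking {d : ℕ} [NeZero d] (v : Fin (d + 1) → Euc (d + 1))
    (hv : ∀ i k, inner ℝ (v i) (v k) = if i = k then 2 else 0)
    (e : Fin (d + 1) → ℤˣ) :
    (orthoPacking v hv).dualSphere (crossFacet e) = zeroSet (crossNormal v e) := by
  have hu : ∀ u : ℤˣ, ((u : ℤ) : ℝ) * ((u : ℤ) : ℝ) = 1 := by
    intro u; rcases Int.units_eq_one_or u with rfl | rfl <;> norm_num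
  refine PolytopalPacking.dualSphere_eq_zeroSet rfl ?_ ?_
  · rintro _ ⟨i, rfl⟩
    simp only [mink_apply, crossNormal, PolytopalPacking.normal, orthoPacking, sum_inner,
      inner_smul_left, inner_smul_right, hv, mul_ite, mul_zero, Finset.sum_ite_eq',
      Finset.mem_univ, if_true, RCLike.conj_to_real]
    linear_combination 2 * hu (e i)
  · intro x hx
    obtain ⟨b, hb⟩ := exists_orthonormalBasis_of_orthogonal hv
    have hsq : (√2 : ℝ) * √2 = 2 := Real.mul_self_sqrt (by norm_num)
    have e1 : x = ∑ i, ((((e i : ℤ) : ℝ)) * inner ℝ (v i) x.1 / 2) •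
        (orthoPacking v hv).normal (i, e i) := by
      refine Prod.ext ?_ ?_
      · rw [Prod.fst_sum]
        conv_lhs => rw [← b.sum_repr' x.1]
        refine Finset.sum_congr rfl fun i _ => ?_
        simp only [PolytopalPacking.normal, orthoPacking, Prod.smul_fst, hb, smul_smul,
          inner_smul_left, RCLike.conj_to_real]
        congr 1
        linear_combination (-(inner ℝ (b i) x.1 / 2) * (((e i : ℤ) : ℝ) * ((e i : ℤ) : ℝ))) * hsq -
          inner ℝ (b i) x.1 * hu (e i)
      · rw [Prod.snd_sum]
        simp only [mink_apply, crossNormal, sum_inner, inner_smul_left, RCLike.conj_to_real] at hx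
        simp only [PolytopalPacking.normal, Prod.smul_snd, smul_eq_mul, mul_one]
        rw [← Finset.sum_div]
        linarith
    rw [e1]
    exact Submodule.sum_mem _ fun i _ => Submodule.smul_mem _ _
      (Submodule.subset_span ⟨_, ⟨i, rfl⟩, rfl⟩)

/-! ### The three cross-section planes -/

theorem norm_sq_two (x : Euc 2) : ‖x‖ ^ 2 = x 0 ^ 2 + x 1 ^ 2 := by
  simp [EuclideanSpace.norm_sq_eq, Fin.sum_univ_two]

theorem inner_three (x y : Euc 3) :
    inner ℝ x y = x 0 * y 0 + x 1 * y 1 + x 2 * y 2 := by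
  simp [PiLp.inner_apply, Fin.sum_univ_three, mul_comm]

/-- The isometric embedding of the plane through `b` spanned by the orthonormal vectors `u, v`. -/
noncomputable def planeEmbedding (u v b : Euc 3) (hu : inner ℝ u u = 1) (hv : inner ℝ v v = 1)
    (huv : inner ℝ u v = 0) : Euc 2 →ᵃⁱ[ℝ] Euc 3 :=
  (AffineIsometryEquiv.constVAdd ℝ (Euc 3) b).toAffineIsometry.comp
    (LinearIsometry.toAffineIsometry
      { toFun := fun x => x 0 • u + x 1 • v
        map_add' := fun x y => by simp only [PiLp.add_apply]; module
        map_smul' := fun c x => by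
          simp only [PiLp.smul_apply, smul_eq_mul, RingHom.id_apply]
          module
        norm_map' := fun x => by
          change ‖x 0 • u + x 1 • v‖ = ‖x‖
          rw [← sq_eq_sq₀ (norm_nonneg _) (norm_nonneg _), norm_sq_two,
            ← real_inner_self_eq_norm_sq]
          simp only [inner_add_left, inner_add_right, inner_smul_left, inner_smul_right, hu, hv,
            huv, real_inner_comm u v, RCLike.conj_to_real]
          ring })

theorem planeEmbedding_apply {u v b : Euc 3} (hu : inner ℝ u u = 1) (hv : inner ℝ v v = 1)
    (huv : inner ℝ u v = 0) (x : Euc 2) :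
    planeEmbedding u v b hu hv huv x = b + (x 0 • u + x 1 • v) := rfl

theorem vec_two (β : Euc 2) (α : ℝ) : vec β α = !₂[β 0, β 1, α] := by
  ext i
  fin_cases i
  · exact vec_castSucc β α 0
  · exact vec_castSucc β α 1
  · exact vec_last β α

theorem vec_three (β : Euc 3) (α : ℝ) : vec β α = !₂[β 0, β 1, β 2, α] := by
  ext i
  fin_cases i
  · exact vec_castSucc β α 0
  · exact vec_castSucc β α 1
  · exact vec_castSucc β α 2
  · exact vec_last β α

theorem norm_sq_three (x : Euc 3) : ‖x‖ ^ 2 = x 0 ^ 2 + x 1 ^ 2 + x 2 ^ 2 := by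
  simp [EuclideanSpace.norm_sq_eq, Fin.sum_univ_three]

theorem mink_two (x y : Lorentz 2) :
    mink x y = x.1 0 * y.1 0 + x.1 1 * y.1 1 + x.1 2 * y.1 2 - x.2 * y.2 := by
  simp [mink_apply, PiLp.inner_apply, Fin.sum_univ_three, mul_comm]

theorem mink_three (x y : Lorentz 3) :
    mink x y = x.1 0 * y.1 0 + x.1 1 * y.1 1 + x.1 2 * y.1 2 + x.1 3 * y.1 3 - x.2 * y.2 := by
  simp [mink_apply, PiLp.inner_apply, Fin.sum_univ_four, mul_comm]

/-- Reduces compatibility to a polynomial identity between the denominator-free null vectors. -/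
theorem compat_of_smul {j : Euc 2 →ᵃⁱ[ℝ] Euc 3} {J : Lorentz 2 →ₗ[ℝ] Lorentz 3}
    (h0 : J (!₂[0, 0, 1], 1) = (!₂[0, 0, 0, 1], 1))
    (h : ∀ x : Euc 2, J (!₂[2 * x 0, 2 * x 1, x 0 ^ 2 + x 1 ^ 2 - 1], x 0 ^ 2 + x 1 ^ 2 + 1) =
      (!₂[2 * j x 0, 2 * j x 1, 2 * j x 2, j x 0 ^ 2 + j x 1 ^ 2 + j x 2 ^ 2 - 1],
        j x 0 ^ 2 + j x 1 ^ 2 + j x 2 ^ 2 + 1)) (p : RHat 2) :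
    ∃ c : ℝ, 0 < c ∧ J (nullVec p) = c • nullVec (extend j p) := by
  induction p using OnePoint.rec with
  | infty =>
    refine ⟨1, one_pos, ?_⟩
    change J (nullVec OnePoint.infty) = (1 : ℝ) • nullVec OnePoint.infty
    rw [one_smul, nullVec_infty, nullVec_infty, vec_two, vec_three]
    exact h0
  | coe x =>
    have h1 : 0 < ‖x‖ ^ 2 + 1 := by positivity
    refine ⟨(‖x‖ ^ 2 + 1)⁻¹ * (‖j x‖ ^ 2 + 1), by positivity, ?_⟩
    change J (nullVec (x : RHat 2)) = _ • nullVec (j x : RHat 3)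
    rw [mul_smul, smul_nullVec_coe, nullVec_coe, map_smul, vec_two, vec_three, norm_sq_two,
      norm_sq_three]
    congr 1
    exact h x

/-- The plane `y = 1`. -/
noncomputable def tetraPlane : Euc 2 →ᵃⁱ[ℝ] Euc 3 :=
  planeEmbedding !₂[1, 0, 0] !₂[0, 0, 1] !₂[0, 1, 0]
    (by rw [inner_three]; simp)
    (by rw [inner_three]; simp)
    (by rw [inner_three]; simp)

theorem tetraPlane_apply (x : Euc 2) : tetraPlane x = !₂[x 0, 1, x 1] := by
  rw [tetraPlane, planeEmbedding_apply]
  ext i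
  fin_cases i <;> simp

theorem range_tetraPlane : Set.range tetraPlane = {x | x 1 = 1} := by
  ext y
  constructor
  · rintro ⟨x, rfl⟩
    rw [tetraPlane_apply]
    simp
  · intro hy
    refine ⟨!₂[y 0, y 2], ?_⟩
    rw [tetraPlane_apply]
    ext i
    have hy : y 1 = 1 := hy
    fin_cases i <;> simp [hy]

/-- The plane `x = y`. -/
noncomputable def octaPlane : Euc 2 →ᵃⁱ[ℝ] Euc 3 :=
  planeEmbedding !₂[√2 / 2, √2 / 2, 0] !₂[0, 0, 1] 0
    (by rw [inner_three]; simp [div_mul_div_comm]; norm_num)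
    (by rw [inner_three]; simp)
    (by rw [inner_three]; simp)

theorem octaPlane_apply (x : Euc 2) :
    octaPlane x = !₂[x 0 * (√2 / 2), x 0 * (√2 / 2), x 1] := by
  rw [octaPlane, planeEmbedding_apply]
  ext i
  fin_cases i <;> simp

theorem range_octaPlane : Set.range octaPlane = {x | x 0 = x 1} := by
  have hsq : (√2 : ℝ) * √2 = 2 := Real.mul_self_sqrt (by norm_num)
  ext y
  constructor
  · rintro ⟨x, rfl⟩
    rw [octaPlane_apply]
    simp
  · intro hy
    refine ⟨!₂[√2 * y 0, y 2], ?_⟩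
    rw [octaPlane_apply]
    have hy : y 0 = y 1 := hy
    ext i
    fin_cases i
    · simp; linear_combination y 0 / 2 * hsq
    · simp; linear_combination y 0 / 2 * hsq + hy
    · simp

/-- The plane `x = 0`. -/
noncomputable def cubePlane : Euc 2 →ᵃⁱ[ℝ] Euc 3 :=
  planeEmbedding !₂[0, 1, 0] !₂[0, 0, 1] 0
    (by rw [inner_three]; simp)
    (by rw [inner_three]; simp)
    (by rw [inner_three]; simp)

theorem cubePlane_apply (x : Euc 2) : cubePlane x = !₂[0, x 0, x 1] := by
  rw [cubePlane, planeEmbedding_apply]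
  ext i
  fin_cases i <;> simp

theorem range_cubePlane : Set.range cubePlane = {x | x 0 = 0} := by
  ext y
  constructor
  · rintro ⟨x, rfl⟩
    rw [cubePlane_apply]
    simp
  · intro hy
    refine ⟨!₂[y 1, y 2], ?_⟩
    rw [cubePlane_apply]
    have hy : y 0 = 0 := hy
    ext i
    fin_cases i <;> simp [hy]

theorem lorentz_two_ext {x y : Lorentz 2} (h0 : x.1 0 = y.1 0) (h1 : x.1 1 = y.1 1)
    (h2 : x.1 2 = y.1 2) (ht : x.2 = y.2) : x = y := by
  refine Prod.ext ?_ ht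
  ext i
  fin_cases i <;> assumption

theorem lorentz_three_ext {x y : Lorentz 3} (h0 : x.1 0 = y.1 0) (h1 : x.1 1 = y.1 1)
    (h2 : x.1 2 = y.1 2) (h3 : x.1 3 = y.1 3) (ht : x.2 = y.2) : x = y := by
  refine Prod.ext ?_ ht
  ext i
  fin_cases i <;> assumption

/-- The Lorentz model of the plane `y = 1`. -/
noncomputable def tetraModel : HyperplaneModel tetraPlane where
  -- On the null vector with α = ‖x‖² - 1 and t = ‖x‖² + 1, the point (x₀, 1, x₁) requires 2 = t -
  -- α, ‖x‖² = (α + t)/2 and ‖x‖² + 2 = (3t - α)/2; these are the entries.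
  J :=
    { toFun := fun x => (!₂[x.1 0, x.2 - x.1 2, x.1 1, (x.1 2 + x.2) / 2], (3 * x.2 - x.1 2) / 2)
      map_add' := fun x y => by apply lorentz_three_ext <;> simp <;> ring
      map_smul' := fun c x => by apply lorentz_three_ext <;> simp <;> ring }
  -- The normal of the plane y = 1. It is half of the normal of the dual sphere of the facet 1234,
  -- so the plane is that dual sphere.
  h := (!₂[0, 1, 0, 1], 1)
  isometry x y := by simp [mink_two, mink_three]; ring
  orthogonal x := by simp [mink_three]; ring
  unit := by simp [mink_three]
  spans z := by
    -- The coefficient of the normal is `mink h z`; the rest comes from inverting the embedding on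
    -- the orthogonal part.
    refine ⟨(!₂[z.1 0, z.1 2, (3 * z.1 3 - z.2 - 2 * (z.1 1 + z.1 3 - z.2)) / 2],
      (z.1 3 + z.2 - 2 * (z.1 1 + z.1 3 - z.2)) / 2), z.1 1 + z.1 3 - z.2, ?_⟩
    apply lorentz_three_ext <;> simp <;> ring
  compat := by
    apply compat_of_smul
    · apply lorentz_three_ext <;> simp; norm_num
    · intro x
      rw [tetraPlane_apply]
      apply lorentz_three_ext <;> simp <;> ring

/-- The Lorentz model of the plane `x = y`. -/
noncomputable def octaModel : HyperplaneModel octaPlane where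
  J :=
    { toFun := fun x => (!₂[x.1 0 * (√2 / 2), x.1 0 * (√2 / 2), x.1 1, x.1 2], x.2)
      map_add' := fun x y => by apply lorentz_three_ext <;> simp <;> ring
      map_smul' := fun c x => by apply lorentz_three_ext <;> simp <;> ring }
  -- This is v₄/√2: the plane is orthogonal to the two omitted vertices ±v₄.
  h := (!₂[-(√2 / 2), √2 / 2, 0, 0], 0)
  isometry x y := by
    have hsq : (√2 : ℝ) * √2 = 2 := Real.mul_self_sqrt (by norm_num)
    simp [mink_two, mink_three]; linear_combination x.1 0 * y.1 0 / 2 * hsq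
  orthogonal x := by simp [mink_three]
  unit := by
    have hsq : (√2 : ℝ) * √2 = 2 := Real.mul_self_sqrt (by norm_num)
    simp [mink_three]; linear_combination hsq / 2
  spans z := by
    have hsq : (√2 : ℝ) * √2 = 2 := Real.mul_self_sqrt (by norm_num)
    refine ⟨(!₂[(z.1 0 + z.1 1) * (√2 / 2), z.1 2, z.1 3], z.2), (z.1 1 - z.1 0) * (√2 / 2), ?_⟩
    apply lorentz_three_ext <;> simp
    · linear_combination - z.1 0 / 2 * hsq
    · linear_combination - z.1 1 / 2 * hsq
  compat := by
    have hsq : (√2 : ℝ) * √2 = 2 := Real.mul_self_sqrt (by norm_num)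
    apply compat_of_smul
    · apply lorentz_three_ext <;> simp
    · intro x
      rw [octaPlane_apply]
      apply lorentz_three_ext <;> simp
      · ring
      · ring
      · linear_combination - x 0 ^ 2 / 2 * hsq
      · linear_combination - x 0 ^ 2 / 2 * hsq

/-- The Lorentz model of the plane `x = 0`. -/
noncomputable def cubeModel : HyperplaneModel cubePlane where
  J :=
    { toFun := fun x => (!₂[0, x.1 0, x.1 1, x.1 2], x.2)
      map_add' := fun x y => by apply lorentz_three_ext <;> simp
      map_smul' := fun c x => by apply lorentz_three_ext <;> simp }
  h := (!₂[1, 0, 0, 0], 0)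
  isometry x y := by simp [mink_two, mink_three]
  orthogonal x := by simp [mink_three]
  unit := by simp [mink_three]
  spans z := by
    refine ⟨(!₂[z.1 1, z.1 2, z.1 3], z.2), z.1 0, ?_⟩
    apply lorentz_three_ext <;> simp
  compat := by
    apply compat_of_smul
    · apply lorentz_three_ext <;> simp
    · intro x
      rw [cubePlane_apply]
      apply lorentz_three_ext <;> simp

/-! ### The tetrahedral section -/

theorem inner_four (x y : Euc 4) :
    inner ℝ x y = x 0 * y 0 + x 1 * y 1 + x 2 * y 2 + x 3 * y 3 := by
  simp [PiLp.inner_apply, Fin.sum_univ_four, mul_comm]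

/-- Half of the vertices of the standard orthoplex. -/
noncomputable def standardFrame (i : Fin 4) : Euc 4 :=
  ![!₂[0, 0, 1, 1], !₂[0, 0, -1, 1], !₂[1, 1, 0, 0], !₂[-1, 1, 0, 0]] i

theorem inner_standardFrame (i k : Fin 4) :
    inner ℝ (standardFrame i) (standardFrame k) = if i = k then 2 else 0 := by
  rw [inner_four]
  fin_cases i <;> fin_cases k <;> simp [standardFrame] <;> norm_num

/-- The standard orthoplicial packing. -/
noncomputable def standardPacking : PolytopalPacking (crossPolytope 4) :=
  orthoPacking standardFrame inner_standardFrame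

theorem isFacetInversion_iff {v : Fin 4 → Euc 4}
    (hv : ∀ i k, inner ℝ (v i) (v k) = if i = k then 2 else 0) (e : Fin 4 → ℤˣ) {N : Lorentz 3}
    (hN : mink N N = 1) (h : (2 : ℝ) • N = crossNormal v e) {f : Equiv.Perm (RHat 3)} :
    IsFacetInversion (orthoPacking v hv) e f ↔ Lifts (refl N hN) f := by
  have := dualSphere_orthoPacking v hv e
  rw [← h, zeroSet_smul _ two_ne_zero] at this
  rw [← isInversionIn_zeroSet_iff hN, ← this]
  rfl

theorem isFacetInversion_le {v : Fin 4 → Euc 4}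
    (hv : ∀ i k, inner ℝ (v i) (v k) = if i = k then 2 else 0) {e : Fin 4 → ℤˣ}
    {f : Equiv.Perm (RHat 3)} (h : IsFacetInversion (orthoPacking v hv) e f) :
    f ∈ (orthoPacking v hv).apollonianGroup :=
  Subgroup.subset_closure ⟨signFacet e, (isFacet_orthoPacking_iff v hv _).2 ⟨e, rfl⟩, h⟩

/-- The vertices of the tetrahedron of the tetrahedral section. -/
noncomputable def tetraVertex (i : Fin 4) : Euc 3 :=
  ![!₂[0, 1, 1], !₂[0, -1, 1], !₂[2, 0, -1], !₂[-2, 0, -1]] i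

/-- The normal vectors of the dual circles of the tetrahedral section. -/
noncomputable def tetraNormal (i : Fin 4) : Lorentz 2 :=
  ![(!₂[0, -1, -(1 / 2)], 1 / 2), (!₂[0, 1, -(1 / 2)], 1 / 2), (!₂[-1, 0, 1], 1),
    (!₂[1, 0, 1], 1)] i

/-- The linear map of the regular tetrahedron onto that of the tetrahedral section. -/
noncomputable def tetraEquiv : Euc 3 ≃ₗ[ℝ] Euc 3 where
  toFun x := !₂[x 1 - x 2, (x 1 + x 2) / 2, x 0]
  invFun y := !₂[y 2, y 1 + y 0 / 2, y 1 - y 0 / 2]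
  map_add' x y := by ext i; fin_cases i <;> simp <;> ring
  map_smul' c x := by ext i; fin_cases i <;> simp <;> ring
  left_inv x := by ext i; fin_cases i <;> simp <;> ring
  right_inv x := by ext i; fin_cases i <;> simp

/-- The tetrahedral packing of the section in the plane `y = 1`. -/
noncomputable def tetraPacking : PolytopalPacking tetrahedron where
  vertex := tetraVertex
  -- Both tetrahedra have their centroid at the origin, so a linear map suffices.
  sameFaces := isFace_linear tetraEquiv fun i => by
    ext k
    fin_cases i <;> fin_cases k <;> simp [tetraVertex, tetraEquiv, tetrahedron] <;> norm_num
  edgeScribed := by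
    have hn : ∀ i, 1 < ‖tetraVertex i‖ := by
      intro i
      have h1 : 1 < ‖tetraVertex i‖ ^ 2 := by
        rw [norm_sq_three]
        fin_cases i <;> simp [tetraVertex]
      have := norm_nonneg (tetraVertex i)
      nlinarith
    refine ⟨hn, fun i k hik _ => (segment_inter_sphere_iff (hn i) (hn k)).2 ?_⟩
    rw [norm_sq_three, norm_sq_three, inner_three]
    fin_cases i <;> fin_cases k <;>
      first | exact absurd rfl hik | (simp [tetraVertex]; try norm_num)
  mob := 1
  mob_mem := one_mem _

theorem mink_tetraNormal_self (i : Fin 4) : mink (tetraNormal i) (tetraNormal i) = 1 := by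
  rw [mink_two]
  fin_cases i <;> simp [tetraNormal]

theorem dualSphere_tetraPacking (k : Fin 4) :
    tetraPacking.dualSphere {k}ᶜ = zeroSet (tetraNormal k) := by
  refine PolytopalPacking.dualSphere_eq_zeroSet rfl ?_ ?_
  · intro i hi
    have hi : i ≠ k := hi
    rw [mink_two]
    fin_cases i <;> fin_cases k <;>
      first | exact absurd rfl hi |
        (simp [tetraNormal, tetraPacking, tetraVertex, PolytopalPacking.normal] <;> norm_num)
  · intro x hx
    -- The dual basis expansion: the four constants are the reciprocals of the products of
    -- `tetraNormal i` with the opposite vertex vector, namely -2, -2, -4, -4.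
    have e1 : x = ∑ i, (mink (tetraNormal i) x * ![-(1 / 2), -(1 / 2), -(1 / 4), -(1 / 4)] i) •
        tetraPacking.normal i := by
      rw [Fin.sum_univ_four]
      apply lorentz_two_ext <;>
        simp [mink_two, tetraNormal, tetraPacking, tetraVertex, PolytopalPacking.normal] <;> ring
    rw [e1]
    refine Submodule.sum_mem _ fun i _ => ?_
    by_cases hik : i = k
    · rw [hik, hx]
      simp
    · exact Submodule.smul_mem _ _ (Submodule.subset_span ⟨i, hik, rfl⟩)

/-- The normal vectors of the circles of the tetrahedral section. -/
noncomputable def tetraUnit (i : Fin 4) : Lorentz 2 :=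
  -- The factors normalize the vectors (v, 1), whose squares are 1, 1, 4, 4.
  (![1, 1, 1 / 2, 1 / 2] i : ℝ) • tetraPacking.normal i

theorem mink_tetraUnit_self (i : Fin 4) : mink (tetraUnit i) (tetraUnit i) = 1 := by
  rw [mink_two]
  fin_cases i <;> simp [tetraUnit, tetraPacking, tetraVertex, PolytopalPacking.normal]

theorem tetraModel_tetraUnit (i : Fin 4) :
    tetraModel.J (tetraUnit i) = standardPacking.normal (i, 1) := by
  apply lorentz_three_ext <;> fin_cases i <;>
    simp [tetraUnit, tetraPacking, tetraVertex, PolytopalPacking.normal, tetraModel,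
      standardPacking, orthoPacking, standardFrame] <;> norm_num

theorem half_tetraUnit (i : Fin 4) : half (tetraUnit i) = tetraPacking.ball i := by
  rw [PolytopalPacking.ball_eq_of_mob rfl, tetraUnit, half_smul]
  fin_cases i <;> simp

/-- The facets adjacent to 1234 have dual spheres orthogonal to the dual sphere of 1234, which is
the section plane, so their normals come from planar ones. -/
theorem tetraModel_tetraNormal (k : Fin 4) : (2 : ℝ) • tetraModel.J (tetraNormal k) =
    crossNormal standardFrame (Function.update 1 k (-1)) := by
  rw [crossNormal, Fin.sum_univ_four]
  apply lorentz_three_ext <;> fin_cases k <;>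
    simp [tetraNormal, tetraModel, standardFrame, Function.update] <;> norm_num

/-- The tetrahedral section of the standard orthoplicial packing. -/
noncomputable def tetraSection : ApollonianSection standardPacking where
  group := Subgroup.closure
    {f | ∃ k : Fin 4, IsFacetInversion standardPacking (Function.update 1 k (-1)) f}
  group_le := by
    rw [Subgroup.closure_le]
    rintro f ⟨k, hf⟩
    exact isFacetInversion_le _ hf
  seeds := {b | ∃ i, b = standardPacking.ball (i, 1)}
  seeds_subset := by
    rintro _ ⟨i, rfl⟩
    exact ⟨_, rfl⟩

theorem isCrossSection_tetraSection : IsCrossSection tetraSection tetraPlane tetraPacking := by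
  have hN : ∀ k, mink (tetraModel.J (tetraNormal k)) (tetraModel.J (tetraNormal k)) = 1 :=
    fun k => by rw [tetraModel.isometry, mink_tetraNormal_self]
  obtain ⟨φ, hφ⟩ := exists_mulEquiv_of_relation (tetraModel.restriction 1)
    (Γ := tetraSection.group) (Γ' := tetraPacking.apollonianGroup)
    (S := {f | ∃ k : Fin 4, IsFacetInversion standardPacking (Function.update 1 k (-1)) f})
    (S' := {f | ∃ S, IsFacet tetraPacking.vertex S ∧ IsInversionIn (tetraPacking.dualSphere S) f})
    (by
      rintro f ⟨k, hf⟩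
      obtain ⟨f', h1, h2⟩ := exists_inversion _ (mink_tetraNormal_self k)
      refine ⟨f', ⟨{k}ᶜ, ?_, ?_⟩, tetraModel.refl_mem (mink_tetraNormal_self k) (hN k) ?_ h2⟩
      · rw [isFacet_congr tetraPacking.sameFaces, isFacet_tetrahedron_iff]
        exact ⟨k, rfl⟩
      · rwa [dualSphere_tetraPacking]
      · exact (isFacetInversion_iff _ _ (hN k) (tetraModel_tetraNormal k)).1 hf)
    (by
      rintro f' ⟨S, hS, hf'⟩
      rw [isFacet_congr tetraPacking.sameFaces, isFacet_tetrahedron_iff] at hS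
      obtain ⟨k, rfl⟩ := hS
      rw [dualSphere_tetraPacking, isInversionIn_zeroSet_iff (mink_tetraNormal_self k)] at hf'
      obtain ⟨f, h1, h2⟩ := exists_inversion _ (hN k)
      exact ⟨f, ⟨k, (isFacetInversion_iff _ _ (hN k) (tetraModel_tetraNormal k)).2 h2⟩,
        tetraModel.refl_mem (mink_tetraNormal_self k) (hN k) h2 hf'⟩)
    (fun g h => HyperplaneModel.eq_one_left h) (fun g h => HyperplaneModel.eq_one_right h) rfl rfl
  have hball : ∀ i, standardPacking.ball (i, 1) = half (tetraModel.J (tetraUnit i)) := fun i => by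
    rw [PolytopalPacking.ball_eq_of_mob rfl, tetraModel_tetraUnit]
  refine tetraModel.isCrossSection 1 tetraSection ?_ ?_ φ hφ
  · rintro _ ⟨i, rfl⟩
    exact ⟨_, mink_tetraUnit_self i, hball i⟩
  · ext b
    constructor
    · rintro ⟨_, ⟨i, rfl⟩, rfl⟩
      refine ⟨i, ?_⟩
      simp only [hball, tetraModel.preimage_half, half_tetraUnit]
    · rintro ⟨i, rfl⟩
      refine ⟨_, ⟨i, rfl⟩, ?_⟩
      simp only [hball, tetraModel.preimage_half, half_tetraUnit]

/-! ### The octahedral section -/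

/-- Half of the vertices of the octahedron of the octahedral section. -/
noncomputable def octaFrame (i : Fin 3) : Euc 3 :=
  ![!₂[0, 1, 1], !₂[0, -1, 1], !₂[√2, 0, 0]] i

theorem inner_octaFrame (i k : Fin 3) :
    inner ℝ (octaFrame i) (octaFrame k) = if i = k then 2 else 0 := by
  rw [inner_three]
  fin_cases i <;> fin_cases k <;> simp [octaFrame] <;> norm_num

/-- The octahedral packing of the section in the plane `x = y`. -/
noncomputable def octaPacking : PolytopalPacking (crossPolytope 3) :=
  orthoPacking (d := 2) octaFrame inner_octaFrame

/-- The normal vectors of the dual circles of the octahedral section. -/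
noncomputable def octaNormal (e : Fin 3 → ℤˣ) : Lorentz 2 :=
  (√2 / 2) • crossNormal (d := 2) octaFrame e

theorem mink_octaNormal_self (e : Fin 3 → ℤˣ) : mink (octaNormal e) (octaNormal e) = 1 := by
  have hsq : (√2 : ℝ) * √2 = 2 := Real.mul_self_sqrt (by norm_num)
  rw [octaNormal, map_smul, map_smul, LinearMap.smul_apply,
    mink_crossNormal_self (d := 2) octaFrame inner_octaFrame, smul_eq_mul, smul_eq_mul]
  push_cast
  linear_combination hsq / 2

theorem dualSphere_octaPacking (e : Fin 3 → ℤˣ) :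
    octaPacking.dualSphere (crossFacet e) = zeroSet (octaNormal e) := by
  rw [octaNormal, zeroSet_smul _ (by positivity)]
  exact dualSphere_orthoPacking (d := 2) octaFrame inner_octaFrame e

theorem mink_half_crossNormal (e : Fin 4 → ℤˣ) :
    mink ((1 / 2 : ℝ) • crossNormal standardFrame e) ((1 / 2 : ℝ) • crossNormal standardFrame e) =
      1 := by
  rw [map_smul, map_smul, LinearMap.smul_apply,
    mink_crossNormal_self standardFrame inner_standardFrame, smul_eq_mul, smul_eq_mul]
  norm_num

/-- The facets ijk4 and ijk4̄ differ only by ±v₄, a multiple of `octaModel.h`: their dual spheres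
are mirror images in the plane x = y, with normals (n ± h)/√2. -/
theorem octaModel_octaNormal (e₁ e₂ e₃ s : ℤˣ) :
    √2 • ((1 / 2 : ℝ) • crossNormal standardFrame ![e₁, e₂, e₃, s]) =
      octaModel.J (octaNormal ![e₁, e₂, e₃]) + ((s : ℤ) : ℝ) • octaModel.h := by
  have hsq : (√2 : ℝ) * √2 = 2 := Real.mul_self_sqrt (by norm_num)
  rw [octaNormal, crossNormal, crossNormal, Fin.sum_univ_four, Fin.sum_univ_three]
  apply lorentz_three_ext <;> simp [octaModel, standardFrame, octaFrame]
  · linear_combination (- ((e₃ : ℤ) : ℝ) * √2 / 4) * hsq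
  · linear_combination (- ((e₃ : ℤ) : ℝ) * √2 / 4) * hsq
  · ring
  · ring

theorem octaModel_normal (i : Fin 3) (ε : ℤˣ) :
    octaModel.J (octaPacking.normal (i, ε)) = standardPacking.normal (i.castSucc, ε) := by
  have hsq : (√2 : ℝ) * √2 = 2 := Real.mul_self_sqrt (by norm_num)
  apply lorentz_three_ext <;> fin_cases i <;>
    simp [octaModel, octaPacking, PolytopalPacking.normal, standardPacking, orthoPacking,
      standardFrame, octaFrame] <;> linear_combination ((ε : ℤ) : ℝ) / 2 * hsq

theorem mink_octaPacking_normal_self (i : Fin 3 × ℤˣ) :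
    mink (octaPacking.normal i) (octaPacking.normal i) = 1 := by
  have h : ((i.2 : ℤ) : ℝ) * ((i.2 : ℤ) : ℝ) = 1 := by
    rcases Int.units_eq_one_or i.2 with h | h <;> rw [h] <;> norm_num
  rw [mink_apply]
  simp only [PolytopalPacking.normal, octaPacking, orthoPacking, inner_smul_left, inner_smul_right,
    RCLike.conj_to_real]
  have h' := inner_octaFrame i.1 i.1
  rw [if_pos rfl] at h'
  linear_combination 2 * h + ((i.2 : ℤ) : ℝ) * ((i.2 : ℤ) : ℝ) * h'

/-- The octahedral section of the standard orthoplicial packing. -/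
noncomputable def octaSection : ApollonianSection standardPacking where
  group := Subgroup.closure
    {t | ∃ (e₁ e₂ e₃ : ℤˣ) (f g : Equiv.Perm (RHat 3)),
      IsFacetInversion standardPacking ![e₁, e₂, e₃, 1] f ∧
      IsFacetInversion standardPacking ![e₁, e₂, e₃, -1] g ∧ t = f * g}
  group_le := by
    rw [Subgroup.closure_le]
    rintro _ ⟨e₁, e₂, e₃, f, g, hf, hg, rfl⟩
    exact mul_mem (isFacetInversion_le _ hf) (isFacetInversion_le _ hg)
  seeds := {b | ∃ i ε, i ≠ 3 ∧ b = standardPacking.ball (i, ε)}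
  seeds_subset := by
    rintro _ ⟨i, ε, -, rfl⟩
    exact ⟨_, rfl⟩

theorem isCrossSection_octaSection : IsCrossSection octaSection octaPlane octaPacking := by
  have hN := mink_half_crossNormal
  have h2N : ∀ e : Fin 4 → ℤˣ,
      (2 : ℝ) • ((1 / 2 : ℝ) • crossNormal standardFrame e) = crossNormal standardFrame e :=
    fun e => by rw [smul_smul]; norm_num
  have hfacet : ∀ S, IsFacet octaPacking.vertex S ↔ ∃ e, S = crossFacet e :=
    isFacet_orthoPacking_iff (d := 2) octaFrame inner_octaFrame
  have key : ∀ e₁ e₂ e₃ f g f',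
      Lifts (refl _ (hN ![e₁, e₂, e₃, 1])) f → Lifts (refl _ (hN ![e₁, e₂, e₃, -1])) g →
      Lifts (refl _ (mink_octaNormal_self ![e₁, e₂, e₃])) f' →
      (f * g, f') ∈ octaModel.restriction LinearEquiv.det := by
    intro e₁ e₂ e₃ f g f' hf hg hf'
    refine octaModel.refl_mul_refl_mem _ _ _ ?_ ?_ hf hg hf'
    · rw [octaModel_octaNormal]; simp
    · rw [octaModel_octaNormal]; simp [sub_eq_add_neg]
  obtain ⟨φ, hφ⟩ := exists_mulEquiv_of_relation (octaModel.restriction LinearEquiv.det)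
    (Γ := octaSection.group) (Γ' := octaPacking.apollonianGroup)
    (S := {t | ∃ (e₁ e₂ e₃ : ℤˣ) (f g : Equiv.Perm (RHat 3)),
      IsFacetInversion standardPacking ![e₁, e₂, e₃, 1] f ∧
      IsFacetInversion standardPacking ![e₁, e₂, e₃, -1] g ∧ t = f * g})
    (S' := {f | ∃ S, IsFacet octaPacking.vertex S ∧ IsInversionIn (octaPacking.dualSphere S) f})
    (by
      rintro _ ⟨e₁, e₂, e₃, f, g, hf, hg, rfl⟩
      obtain ⟨f', h1, h2⟩ := exists_inversion _ (mink_octaNormal_self ![e₁, e₂, e₃])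
      refine ⟨f', ⟨crossFacet _, (hfacet _).2 ⟨![e₁, e₂, e₃], rfl⟩, ?_⟩,
        key e₁ e₂ e₃ f g f' ((isFacetInversion_iff _ _ (hN _) (h2N _)).1 hf)
          ((isFacetInversion_iff _ _ (hN _) (h2N _)).1 hg) h2⟩
      rwa [dualSphere_octaPacking])
    (by
      rintro f' ⟨S, hS, hf'⟩
      rw [hfacet] at hS
      obtain ⟨e, rfl⟩ := hS
      obtain ⟨e₁, e₂, e₃, rfl⟩ : ∃ e₁ e₂ e₃, e = ![e₁, e₂, e₃] :=
        ⟨e 0, e 1, e 2, by ext i; fin_cases i <;> rfl⟩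
      rw [dualSphere_octaPacking, isInversionIn_zeroSet_iff (mink_octaNormal_self _)] at hf'
      obtain ⟨f, -, h1⟩ := exists_inversion _ (hN ![e₁, e₂, e₃, 1])
      obtain ⟨g, -, h2⟩ := exists_inversion _ (hN ![e₁, e₂, e₃, -1])
      exact ⟨f * g, ⟨e₁, e₂, e₃, f, g, (isFacetInversion_iff _ _ (hN _) (h2N _)).2 h1,
        (isFacetInversion_iff _ _ (hN _) (h2N _)).2 h2, rfl⟩, key e₁ e₂ e₃ f g f' h1 h2 hf'⟩)
    (fun g h => HyperplaneModel.eq_one_left h) (fun g h => HyperplaneModel.eq_one_right h) rfl rfl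
  have hball : ∀ (i : Fin 3) ε, standardPacking.ball (i.castSucc, ε) =
      half (octaModel.J (octaPacking.normal (i, ε))) := fun i ε => by
    rw [PolytopalPacking.ball_eq_of_mob rfl, octaModel_normal]
  have hball' : ∀ i, half (octaPacking.normal i) = octaPacking.ball i := fun i =>
    (PolytopalPacking.ball_eq_of_mob rfl i).symm
  have hcast : ∀ i : Fin 4, i ≠ 3 → ∃ k : Fin 3, i = k.castSucc := by decide
  refine octaModel.isCrossSection LinearEquiv.det octaSection ?_ ?_ φ hφ
  · rintro _ ⟨i, ε, hi, rfl⟩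
    obtain ⟨k, rfl⟩ := hcast i hi
    exact ⟨_, mink_octaPacking_normal_self _, hball k ε⟩
  · ext b
    constructor
    · rintro ⟨_, ⟨i, ε, hi, rfl⟩, rfl⟩
      obtain ⟨k, rfl⟩ := hcast i hi
      refine ⟨(k, ε), ?_⟩
      simp only [hball, octaModel.preimage_half, hball']
    · rintro ⟨⟨k, ε⟩, rfl⟩
      refine ⟨_, ⟨k.castSucc, ε, Fin.castSucc_ne_last k, rfl⟩, ?_⟩
      simp only [hball, octaModel.preimage_half, hball']

/-! ### The cubical section -/

/-- Half of the vertices of the demihypercubic orthoplex. -/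
noncomputable def demiFrame (i : Fin 4) : Euc 4 :=
  (√2)⁻¹ • ![!₂[1, 1, 1, 1], !₂[1, -1, 1, -1], !₂[1, -1, -1, 1], !₂[1, 1, -1, -1]] i

theorem inner_demiFrame (i k : Fin 4) :
    inner ℝ (demiFrame i) (demiFrame k) = if i = k then 2 else 0 := by
  have hsq : (√2)⁻¹ * (√2)⁻¹ = (1 / 2 : ℝ) := by
    rw [← mul_inv, Real.mul_self_sqrt (by norm_num)]; norm_num
  rw [demiFrame, demiFrame, inner_smul_left, inner_smul_right, RCLike.conj_to_real, ← mul_assoc,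
    hsq, inner_four]
  fin_cases i <;> fin_cases k <;> simp <;> norm_num

/-- The orthoplicial packing with a demihypercubic orthoplex. -/
noncomputable def demiPacking : PolytopalPacking (crossPolytope 4) :=
  orthoPacking demiFrame inner_demiFrame

/-- The cubical packing of the cube with the vertices `(±1, ±1, ±1) / √2`. -/
noncomputable def cubePacking : PolytopalPacking (cube 3) where
  vertex e := (√2)⁻¹ • cube 3 e
  sameFaces := isFace_linear (LinearEquiv.smulOfUnit (Units.mk0 (√2)⁻¹ (by positivity)))
    fun _ => by simp [LinearEquiv.smulOfUnit, Units.smul_def]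
  edgeScribed := by
    have hsq : (√2)⁻¹ * (√2)⁻¹ = (1 / 2 : ℝ) := by
      rw [← mul_inv, Real.mul_self_sqrt (by norm_num)]; norm_num
    have hu : ∀ u : ℤˣ, ((u : ℤ) : ℝ) * ((u : ℤ) : ℝ) = 1 := by
      intro u; rcases Int.units_eq_one_or u with rfl | rfl <;> norm_num
    have hc : ∀ e, inner ℝ (cube 3 e) (cube 3 e) = 3 := by
      intro e
      rw [inner_cube]
      simp [cube, hu]
    have hn : ∀ e, ‖(√2)⁻¹ • cube 3 e‖ ^ 2 = 3 / 2 := by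
      intro e
      rw [← real_inner_self_eq_norm_sq, inner_smul_left, inner_smul_right, RCLike.conj_to_real, hc]
      linear_combination 3 * hsq
    have hn1 : ∀ e, 1 < ‖(√2)⁻¹ • cube 3 e‖ := by
      intro e
      have := hn e
      have := norm_nonneg ((√2)⁻¹ • cube 3 e)
      nlinarith
    refine ⟨hn1, fun e f hef hf => ?_⟩
    have hf := (isFace_linear (v := cube 3)
      (LinearEquiv.smulOfUnit (Units.mk0 (√2)⁻¹ (by positivity))) (fun _ => by simp [LinearEquiv.smulOfUnit, Units.smul_def]) _).1 hf
    obtain ⟨k, hk⟩ := Function.ne_iff.1 hef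
    have hk' : f k = -e k := by
      rcases Int.units_eq_one_or (e k) with h | h <;> rcases Int.units_eq_one_or (f k) with h' | h' <;>
        rw [h, h'] at hk ⊢ <;> first | rfl | exact absurd rfl hk
    -- The ends of an edge differ in one coordinate, which lowers the product from 3 to 1; after
    -- scaling it is 1/2, and (1/2 - 1)² = (3/2 - 1)².
    have h1 : inner ℝ (cube 3 e) (cube 3 f) = 1 := by
      rw [unique_ne_of_isFace_cube hf k hk, inner_cube_update, hc, hk']
      have := hu (e k)
      simp only [cube]
      push_cast
      linear_combination -2 * this
    rw [segment_inter_sphere_iff (hn1 e) (hn1 f), hn, hn, inner_smul_left, inner_smul_right,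
      RCLike.conj_to_real, h1, mul_one, hsq]
    norm_num
  mob := 1
  mob_mem := one_mem _

/-- The normal vectors of the dual circles of the cubical section. -/
noncomputable def cubeNormal (k : Fin 3) (s : ℤˣ) : Lorentz 2 :=
  -- The facet of the scaled cube lies in the plane x_k = s/√2, that is, √2 s x_k = 1.
  (EuclideanSpace.single k (√2 * ((s : ℤ) : ℝ)), 1)

theorem mink_cubeNormal (k : Fin 3) (s : ℤˣ) (x : Lorentz 2) :
    mink (cubeNormal k s) x = √2 * ((s : ℤ) : ℝ) * x.1 k - x.2 := by
  simp [mink_apply, cubeNormal, EuclideanSpace.inner_single_left, mul_comm]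

theorem mink_cubeNormal_self (k : Fin 3) (s : ℤˣ) :
    mink (cubeNormal k s) (cubeNormal k s) = 1 := by
  have hsq : (√2 : ℝ) * √2 = 2 := Real.mul_self_sqrt (by norm_num)
  rw [mink_cubeNormal]
  rcases Int.units_eq_one_or s with rfl | rfl <;> simp [cubeNormal] <;> linarith

theorem dualSphere_cubePacking (k : Fin 3) (s : ℤˣ) :
    cubePacking.dualSphere (cubeFacet k s) = zeroSet (cubeNormal k s) := by
  have hr : √2 * (√2)⁻¹ = (1 : ℝ) := mul_inv_cancel₀ (by positivity)
  have hu : ((s : ℤ) : ℝ) * ((s : ℤ) : ℝ) = 1 := by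
    rcases Int.units_eq_one_or s with rfl | rfl <;> norm_num
  refine PolytopalPacking.dualSphere_eq_zeroSet rfl ?_ ?_
  · intro e he
    have he : e k = s := he
    rw [mink_cubeNormal]
    simp only [PolytopalPacking.normal, cubePacking, cube, PiLp.smul_apply, he, smul_eq_mul]
    linear_combination ((s : ℤ) : ℝ) * ((s : ℤ) : ℝ) * hr + hu
  · intro x hx
    rw [mink_cubeNormal] at hx
    set W := Submodule.span ℝ (cubePacking.normal '' cubeFacet k s) with hW
    have h0 : cubePacking.normal (fun _ => s) ∈ W := Submodule.subset_span ⟨_, rfl, rfl⟩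
    -- Differences of vertices of the facet along an edge give all directions except `k`; in the
    -- expansion of `x` the `k`-th coefficient vanishes by orthogonality.
    have h1 : ∀ l, l ≠ k → ((EuclideanSpace.single l 1, 0) : Lorentz 2) ∈ W := by
      intro l hl
      have h2 : cubePacking.normal (Function.update (fun _ => s) l (-s)) ∈ W :=
        Submodule.subset_span ⟨_, Function.update_of_ne hl.symm _ _, rfl⟩
      have h3 : ((EuclideanSpace.single l 1, 0) : Lorentz 2) = (√2 * ((s : ℤ) : ℝ) / 2) •
          (cubePacking.normal (fun _ => s) -
            cubePacking.normal (Function.update (fun _ => s) l (-s))) := by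
        refine Prod.ext ?_ ?_
        · ext m
          simp only [PolytopalPacking.normal, cubePacking, cube, Prod.smul_fst, Prod.fst_sub,
            PiLp.smul_apply, PiLp.sub_apply, smul_eq_mul, PiLp.single_apply]
          by_cases hm : m = l
          · subst hm
            rw [Function.update_self, if_pos rfl]
            push_cast
            linear_combination -(((s : ℤ) : ℝ) * ((s : ℤ) : ℝ)) * hr - hu
          · rw [Function.update_of_ne hm, if_neg hm]
            ring
        · simp [PolytopalPacking.normal]
      rw [h3]
      exact Submodule.smul_mem _ _ (Submodule.sub_mem _ h0 h2)
    have h4 : x = x.2 • cubePacking.normal (fun _ => s) +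
        ∑ l, (x.1 l - x.2 * ((√2)⁻¹ * ((s : ℤ) : ℝ))) •
          ((EuclideanSpace.single l 1, 0) : Lorentz 2) := by
      rw [Fin.sum_univ_three]
      apply lorentz_two_ext <;> simp [PolytopalPacking.normal, cubePacking, cube]
    rw [h4]
    refine Submodule.add_mem _ (Submodule.smul_mem _ _ h0) (Submodule.sum_mem _ fun l _ => ?_)
    by_cases hl : l = k
    · have : x.1 l - x.2 * ((√2)⁻¹ * ((s : ℤ) : ℝ)) = 0 := by
        rw [hl]
        have h5 : x.2 = √2 * ((s : ℤ) : ℝ) * x.1 k := by linarith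
        rw [h5]
        have h6 : √2 * ((s : ℤ) : ℝ) * x.1 k * ((√2)⁻¹ * ((s : ℤ) : ℝ)) =
          (√2 * (√2)⁻¹) * (((s : ℤ) : ℝ) * ((s : ℤ) : ℝ)) * x.1 k := by ring
        rw [h6, hr, hu]
        ring
      rw [this, zero_smul]
      exact Submodule.zero_mem _
    · exact Submodule.smul_mem _ _ (h1 l hl)

theorem isFacet_cubePacking_iff (S : Set (Fin 3 → ℤˣ)) :
    IsFacet cubePacking.vertex S ↔ ∃ k s, S = cubeFacet k s := by
  rw [← isFacet_cube_iff]
  exact isFacet_congr cubePacking.sameFaces S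

/-- The vectors `(a / √2, t)` with integers `a_k` and `t`, where `a ≡ w` modulo `4`. -/
def IsCongruent (w : Fin 3 → ℤˣ) (x : Lorentz 2) : Prop :=
  ∃ (a : Fin 3 → ℤ) (t : ℤ), (∀ k, (4 : ℤ) ∣ a k - w k) ∧ (∀ k, x.1 k = (√2)⁻¹ * a k) ∧ x.2 = t

/-- The product with `cubeNormal k s` is the integer m = s a_k - t. The reflection changes a_k by
-4sm and t by -2m, leaving all residues modulo 4 unchanged. -/
theorem IsCongruent.refl_cubeNormal {w : Fin 3 → ℤˣ} {x : Lorentz 2} (h : IsCongruent w x)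
    (k : Fin 3) (s : ℤˣ) : IsCongruent w (refl (cubeNormal k s) (mink_cubeNormal_self k s) x) := by
  have hr : √2 * (√2)⁻¹ = (1 : ℝ) := mul_inv_cancel₀ (by positivity)
  have hr2 : (√2 : ℝ) = 2 * (√2)⁻¹ := by
    have hsq : (√2 : ℝ) * √2 = 2 := Real.mul_self_sqrt (by norm_num)
    field_simp
    linarith
  obtain ⟨a, t, h1, h2, h3⟩ := h
  have hm : mink (cubeNormal k s) x = s * a k - t := by
    rw [mink_cubeNormal, h2, h3]
    linear_combination ((s : ℤ) : ℝ) * a k * hr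
  refine ⟨Function.update a k (a k - 4 * (s * (s * a k - t))), t - 2 * (s * a k - t), ?_, ?_, ?_⟩
  · intro l
    by_cases hl : l = k
    · subst hl
      rw [Function.update_self]
      have : a l - 4 * (s * (s * a l - t)) - w l = (a l - w l) - 4 * (s * (s * a l - t)) := by ring
      rw [this]
      exact dvd_sub (h1 l) (dvd_mul_right _ _)
    · rw [Function.update_of_ne hl]
      exact h1 l
  · intro l
    rw [refl_apply, hm]
    simp only [cubeNormal, Prod.fst_sub, Prod.smul_fst, PiLp.sub_apply, PiLp.smul_apply,
      PiLp.single_apply, smul_eq_mul, h2]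
    by_cases hl : l = k
    · subst hl
      rw [Function.update_self, if_pos rfl]
      push_cast
      linear_combination (-(2 * (((s : ℤ) : ℝ) * a l - t)) * ((s : ℤ) : ℝ)) * hr2
    · rw [Function.update_of_ne hl, if_neg hl]
      ring
  · rw [refl_apply, hm]
    simp only [cubeNormal, Prod.snd_sub, Prod.smul_snd, smul_eq_mul, h3]
    push_cast
    ring

theorem isCongruent_normal (w : Fin 3 → ℤˣ) : IsCongruent w (cubePacking.normal w) :=
  ⟨fun k => w k, 1, fun k => by simp, fun k => by simp [PolytopalPacking.normal, cubePacking, cube],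
    by simp [PolytopalPacking.normal]⟩

/-- The signs 1 and -1 are distinct modulo 4. -/
theorem IsCongruent.eq {w w' : Fin 3 → ℤˣ} (h : IsCongruent w (cubePacking.normal w')) :
    w = w' := by
  obtain ⟨a, t, h1, h2, -⟩ := h
  ext1 k
  have h3 : a k = w' k := by
    have := h2 k
    simp only [PolytopalPacking.normal, cubePacking, cube, PiLp.smul_apply, smul_eq_mul] at this
    have h4 := mul_left_cancel₀ (by positivity) this
    exact_mod_cast h4.symm
  have h5 := h1 k
  rw [h3] at h5
  rcases Int.units_eq_one_or (w k) with h | h <;> rcases Int.units_eq_one_or (w' k) with h' | h' <;>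
    rw [h, h'] at h5 ⊢ <;> norm_num at h5

/-- The residues colour the orbit of the packing by the eight vertices of the cube, and the
Apollonian group preserves the colours. -/
theorem exists_lifts_isCongruent {g : Equiv.Perm (RHat 2)} (hg : g ∈ cubePacking.apollonianGroup) :
    ∃ L, Lifts L g ∧ ∀ w x, IsCongruent w x ↔ IsCongruent w (L x) := by
  induction hg using Subgroup.closure_induction with
  | mem f hf =>
    obtain ⟨S, hS, hf⟩ := hf
    obtain ⟨k, s, rfl⟩ := (isFacet_cubePacking_iff S).1 hS
    rw [dualSphere_cubePacking, isInversionIn_zeroSet_iff (mink_cubeNormal_self k s)] at hf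
    refine ⟨_, hf, fun w x => ⟨fun h => h.refl_cubeNormal k s, fun h => ?_⟩⟩
    have := h.refl_cubeNormal k s
    rwa [refl, Module.involutive_reflection _ x] at this
  | one => exact ⟨1, Lifts.one, fun _ _ => Iff.rfl⟩
  | mul f g _ _ hf hg =>
    obtain ⟨L, h1, h2⟩ := hf
    obtain ⟨L', h1', h2'⟩ := hg
    exact ⟨_, h1.mul h1', fun w x => (h2' w x).trans (h2 w _)⟩
  | inv f _ hf =>
    obtain ⟨L, h1, h2⟩ := hf
    refine ⟨_, h1.inv, fun w x => ?_⟩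
    rw [h2 w (L⁻¹ x)]
    have : L (L⁻¹ x) = x := L.apply_symm_apply x
    rw [this]

/-- The signs of the last three coordinates of half of the vertices. -/
def demiSign : Fin 4 → Fin 3 → ℤˣ := ![![1, 1, 1], ![-1, 1, -1], ![-1, -1, 1], ![1, -1, -1]]

theorem bijective_demiSign :
    Function.Bijective fun (i : Fin 4 × ℤˣ) (k : Fin 3) => i.2 * demiSign i.1 k := by
  decide

/-- The bijection of the vertices of the orthoplex with those of the cube. -/
noncomputable def demiVertexEquiv : Fin 4 × ℤˣ ≃ (Fin 3 → ℤˣ) :=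
  Equiv.ofBijective _ bijective_demiSign

theorem demiVertexEquiv_apply (i : Fin 4 × ℤˣ) (k : Fin 3) :
    demiVertexEquiv i k = i.2 * demiSign i.1 k := rfl

theorem dropFirst_demiPacking (i : Fin 4 × ℤˣ) :
    cubePacking.vertex (demiVertexEquiv i) = dropFirst (demiPacking.vertex i) := by
  obtain ⟨i, ε⟩ := i
  simp only [cubePacking, cube, demiVertexEquiv_apply, dropFirst, demiPacking, orthoPacking,
    demiFrame]
  ext k
  fin_cases i <;> fin_cases k <;> simp [demiSign] <;> ring

/-- The first coordinate of each vertex is ±1/√2, and deleting it leaves a vertex of the scaled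
cube. -/
theorem demiPacking_normal (i : Fin 4 × ℤˣ) : demiPacking.normal i =
    (((i.2 : ℤ) : ℝ) * (√2)⁻¹) • cubeModel.h +
      cubeModel.J (cubePacking.normal (demiVertexEquiv i)) := by
  rw [PolytopalPacking.normal, PolytopalPacking.normal, dropFirst_demiPacking]
  obtain ⟨i, ε⟩ := i
  apply lorentz_three_ext <;> simp [cubeModel, dropFirst]
  fin_cases i <;> simp [demiPacking, orthoPacking, demiFrame]

/-- The facet of the orthoplex over the facet of the cube on which the coordinate `k` has the
sign `s`. -/
def demiFacet (k : Fin 3) (s : ℤˣ) (i : Fin 4) : ℤˣ :=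
  -- Row `k` lists the signs `demiSign i k`, so each chosen vertex has the sign `s` in coordinate
  -- `k`.
  s * ![![1, -1, -1, 1], ![1, 1, -1, -1], ![1, -1, 1, -1]] k i

/-- These sign vectors have two entries of each sign, so the first coordinates cancel and the dual
spheres are orthogonal to the plane x = 0. -/
theorem cubeModel_cubeNormal (k : Fin 3) (s : ℤˣ) :
    (2 : ℝ) • cubeModel.J (cubeNormal k s) = crossNormal demiFrame (demiFacet k s) := by
  have hr2 : (√2 : ℝ) = 2 * (√2)⁻¹ := by
    have hsq : (√2 : ℝ) * √2 = 2 := Real.mul_self_sqrt (by norm_num)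
    field_simp
    linarith
  rw [crossNormal, Fin.sum_univ_four]
  apply lorentz_three_ext <;> fin_cases k <;>
    simp [cubeNormal, cubeModel, demiFrame, demiFacet] <;>
    linear_combination 2 * ((s : ℤ) : ℝ) * hr2

theorem mem_demiFacets_iff (e : Fin 4 → ℤˣ) :
    e ∈ ({![1, 1, -1, -1], ![1, -1, -1, 1], ![-1, -1, 1, 1], ![-1, 1, 1, -1],
      ![-1, 1, -1, 1], ![1, -1, 1, -1]} : Set (Fin 4 → ℤˣ)) ↔ ∃ k s, e = demiFacet k s := by
  simp only [Set.mem_insert_iff, Set.mem_singleton_iff]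
  revert e
  decide

/-- The cubical section. -/
noncomputable def cubeSection : ApollonianSection demiPacking where
  group := Subgroup.closure
    {f | ∃ e ∈ ({![1, 1, -1, -1], ![1, -1, -1, 1], ![-1, -1, 1, 1], ![-1, 1, 1, -1],
      ![-1, 1, -1, 1], ![1, -1, 1, -1]} : Set (Fin 4 → ℤˣ)), IsFacetInversion demiPacking e f}
  group_le := by
    rw [Subgroup.closure_le]
    rintro f ⟨e, -, hf⟩
    exact isFacetInversion_le _ hf
  seeds := demiPacking.balls
  seeds_subset := subset_rfl

theorem exists_cubeSection_equiv :
    ∃ φ : cubeSection.group ≃* cubePacking.apollonianGroup, ∀ g : cubeSection.group,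
      ((g : Equiv.Perm (RHat 3)), (φ g : Equiv.Perm (RHat 2))) ∈ cubeModel.restriction 1 := by
  have hN : ∀ k s, mink (cubeModel.J (cubeNormal k s)) (cubeModel.J (cubeNormal k s)) = 1 :=
    fun k s => by rw [cubeModel.isometry, mink_cubeNormal_self]
  refine exists_mulEquiv_of_relation (cubeModel.restriction 1)
    (Γ := cubeSection.group) (Γ' := cubePacking.apollonianGroup)
    (S := {f | ∃ e ∈ ({![1, 1, -1, -1], ![1, -1, -1, 1], ![-1, -1, 1, 1], ![-1, 1, 1, -1],
      ![-1, 1, -1, 1], ![1, -1, 1, -1]} : Set (Fin 4 → ℤˣ)), IsFacetInversion demiPacking e f})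
    (S' := {f | ∃ S, IsFacet cubePacking.vertex S ∧ IsInversionIn (cubePacking.dualSphere S) f})
    ?_ ?_
    (fun g h => HyperplaneModel.eq_one_left h) (fun g h => HyperplaneModel.eq_one_right h) rfl rfl
  · rintro f ⟨e, he, hf⟩
    obtain ⟨k, s, rfl⟩ := (mem_demiFacets_iff e).1 he
    obtain ⟨f', h1, h2⟩ := exists_inversion _ (mink_cubeNormal_self k s)
    refine ⟨f', ⟨cubeFacet k s, (isFacet_cubePacking_iff _).2 ⟨k, s, rfl⟩, ?_⟩,
      cubeModel.refl_mem (mink_cubeNormal_self k s) (hN k s) ?_ h2⟩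
    · rwa [dualSphere_cubePacking]
    · exact (isFacetInversion_iff _ _ (hN k s) (cubeModel_cubeNormal k s)).1 hf
  · rintro f' ⟨S, hS, hf'⟩
    obtain ⟨k, s, rfl⟩ := (isFacet_cubePacking_iff S).1 hS
    rw [dualSphere_cubePacking, isInversionIn_zeroSet_iff (mink_cubeNormal_self k s)] at hf'
    obtain ⟨f, h1, h2⟩ := exists_inversion _ (hN k s)
    exact ⟨f, ⟨demiFacet k s, (mem_demiFacets_iff _).2 ⟨k, s, rfl⟩,
      (isFacetInversion_iff _ _ (hN k s) (cubeModel_cubeNormal k s)).2 h2⟩,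
      cubeModel.refl_mem (mink_cubeNormal_self k s) (hN k s) h2 hf'⟩

/-- The lift of `g` fixes `cubeModel.h`, so the image of a normal keeps its component ±1/√2 along
it. Equality in space projects to equality in the plane; conversely the sign has to be recovered
from the planar data. -/
theorem image_ball_eq_iff
    {φ : cubeSection.group ≃* cubePacking.apollonianGroup} (hφ : ∀ g : cubeSection.group,
      ((g : Equiv.Perm (RHat 3)), (φ g : Equiv.Perm (RHat 2))) ∈ cubeModel.restriction 1)
    (g : cubeSection.group) (i k : Fin 4 × ℤˣ) :
    (g : Equiv.Perm (RHat 3)) '' demiPacking.ball i = demiPacking.ball k ↔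
      (φ g : Equiv.Perm (RHat 2)) '' cubePacking.ball (demiVertexEquiv i) =
        cubePacking.ball (demiVertexEquiv k) := by
  have hsq : (√2)⁻¹ * (√2)⁻¹ = (1 / 2 : ℝ) := by
    rw [← mul_inv, Real.mul_self_sqrt (by norm_num)]; norm_num
  have hu : ∀ u : ℤˣ, ((u : ℤ) : ℝ) * ((u : ℤ) : ℝ) = 1 := by
    intro u; rcases Int.units_eq_one_or u with rfl | rfl <;> norm_num
  have hv : ∀ w, mink (cubePacking.normal w) (cubePacking.normal w) = 1 / 2 := by
    intro w
    rw [PolytopalPacking.normal, mink_normal, cubePacking, inner_smul_left, inner_smul_right,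
      RCLike.conj_to_real, inner_cube, Fin.sum_univ_three]
    simp only [cube, hu]
    linear_combination 3 * hsq
  have hV : ∀ i, mink (demiPacking.normal i) (demiPacking.normal i) = 1 := by
    intro i
    rw [demiPacking_normal]
    simp only [map_add, map_smul, LinearMap.add_apply, LinearMap.smul_apply, cubeModel.isometry,
      cubeModel.orthogonal, cubeModel.unit, mink_comm _ cubeModel.h, hv, smul_eq_mul]
    linear_combination ((i.2 : ℤ) : ℝ) * ((i.2 : ℤ) : ℝ) * hsq + (1 / 2) * hu i.2
  obtain ⟨L, L', h1, h2, h3, h4⟩ := hφ g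
  rw [MonoidHom.one_apply, Units.val_one, one_smul] at h4
  rw [PolytopalPacking.ball_eq_of_mob rfl, PolytopalPacking.ball_eq_of_mob rfl,
    PolytopalPacking.ball_eq_of_mob rfl, PolytopalPacking.ball_eq_of_mob rfl]
  have e1 : ((g : Equiv.Perm (RHat 3)) '' half (demiPacking.normal i)) =
      half (L (demiPacking.normal i)) := h1.image_half _
  have e2 : ((φ g : Equiv.Perm (RHat 2)) '' half (cubePacking.normal (demiVertexEquiv i))) =
      half (L' (cubePacking.normal (demiVertexEquiv i))) := h2.image_half _
  have e3 : L (demiPacking.normal i) = (((i.2 : ℤ) : ℝ) * (√2)⁻¹) • cubeModel.h +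
      cubeModel.J (L' (cubePacking.normal (demiVertexEquiv i))) := by
    rw [demiPacking_normal, map_add, map_smul, h4, h3]
  rw [e1, e2]
  constructor
  · intro h
    have h5 := half_injective (by rw [h1.1, hV]) (hV k) h
    rw [e3, demiPacking_normal] at h5
    have h6 : L' (cubePacking.normal (demiVertexEquiv i)) =
        cubePacking.normal (demiVertexEquiv k) := by
      rw [← sub_eq_zero]
      refine eq_zero_of_mink fun y => ?_
      have := congrArg (fun z => mink (cubeModel.J y) z) h5
      simp only [map_add, map_smul, mink_comm (cubeModel.J y) cubeModel.h, cubeModel.orthogonal,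
        cubeModel.isometry, smul_eq_mul, mul_zero, zero_add] at this
      rw [mink_comm, map_sub, this, sub_self]
    rw [h6]
  · intro h
    -- The cube normals have square 1/2, and √2 makes them unit vectors.
    have h5 : (√2 : ℝ) • L' (cubePacking.normal (demiVertexEquiv i)) =
        (√2 : ℝ) • cubePacking.normal (demiVertexEquiv k) := by
      have hs : (√2 : ℝ) * √2 = 2 := Real.mul_self_sqrt (by norm_num)
      apply half_injective
      · simp only [map_smul, LinearMap.smul_apply, h2.1, hv, smul_eq_mul]
        linear_combination hs / 2
      · simp only [map_smul, LinearMap.smul_apply, hv, smul_eq_mul]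
        linear_combination hs / 2
      · rwa [half_smul _ (by positivity), half_smul _ (by positivity)]
    have h6 : L' (cubePacking.normal (demiVertexEquiv i)) =
        cubePacking.normal (demiVertexEquiv k) :=
      smul_right_injective _ (by positivity : (√2 : ℝ) ≠ 0) h5
    -- The colouring modulo 4 shows that the two vertices are the same, and so are the signs.
    obtain ⟨K, hK, hK'⟩ := exists_lifts_isCongruent (φ g).2
    have h7 := (hK' _ _).1 (isCongruent_normal (demiVertexEquiv i))
    rw [hK.unique h2, h6] at h7
    have h8 : i = k := demiVertexEquiv.injective h7.eq
    rw [e3, h6, ← h8, ← demiPacking_normal]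

theorem exists_cubeSection_bijection :
    ∃ (φ : cubeSection.group ≃* cubePacking.apollonianGroup) (ψ : Set (RHat 3) → Set (RHat 2)),
      (∀ (g : cubeSection.group) (p : RHat 2), (g : Equiv.Perm (RHat 3)) (extend cubePlane p) =
        extend cubePlane ((φ g : Equiv.Perm (RHat 2)) p)) ∧
      Set.BijOn ψ cubeSection.carrier cubePacking.cluster ∧
      ∀ (g : cubeSection.group) (i : Fin 4 × ℤˣ),
        ψ ((g : Equiv.Perm (RHat 3)) '' demiPacking.ball i) =
          (φ g : Equiv.Perm (RHat 2)) '' cubePacking.ball (demiVertexEquiv i) := by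
  classical
  obtain ⟨φ, hφ⟩ := exists_cubeSection_equiv
  have hinv : ∀ {d : ℕ} (g k : Equiv.Perm (RHat d)) (b c : Set (RHat d)),
      g '' b = k '' c ↔ ⇑(k⁻¹ * g) '' b = c := by
    intro d g k b c
    have h1 : ⇑(k⁻¹ * g) '' b = ⇑k⁻¹ '' (g '' b) := by rw [← Set.image_comp]; rfl
    have h2 : c = ⇑k⁻¹ '' (k '' c) := by
      rw [← Set.image_comp]
      have : (⇑k⁻¹ ∘ ⇑k) = id := by ext1 p; simp
      rw [this, Set.image_id]
    rw [h1]
    conv_rhs => rw [h2]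
    exact (Set.image_injective.2 k⁻¹.injective).eq_iff.symm
  have key : ∀ (g k : cubeSection.group) (i l : Fin 4 × ℤˣ),
      (g : Equiv.Perm (RHat 3)) '' demiPacking.ball i =
        (k : Equiv.Perm (RHat 3)) '' demiPacking.ball l ↔
      (φ g : Equiv.Perm (RHat 2)) '' cubePacking.ball (demiVertexEquiv i) =
        (φ k : Equiv.Perm (RHat 2)) '' cubePacking.ball (demiVertexEquiv l) := by
    intro g k i l
    rw [hinv, hinv]
    have := image_ball_eq_iff hφ (k⁻¹ * g) i l
    simpa using this
  -- A representative g · bᵢ is chosen for each ball of the orbit; `key` makes the value independent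
  -- of the choice.
  let ψ : Set (RHat 3) → Set (RHat 2) := fun b =>
    if h : ∃ x : cubeSection.group × (Fin 4 × ℤˣ),
        b = (x.1 : Equiv.Perm (RHat 3)) '' demiPacking.ball x.2 then
      (φ h.choose.1 : Equiv.Perm (RHat 2)) '' cubePacking.ball (demiVertexEquiv h.choose.2) else ∅
  have hψ : ∀ (g : cubeSection.group) (i : Fin 4 × ℤˣ),
      ψ ((g : Equiv.Perm (RHat 3)) '' demiPacking.ball i) =
        (φ g : Equiv.Perm (RHat 2)) '' cubePacking.ball (demiVertexEquiv i) := by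
    intro g i
    have h : ∃ x : cubeSection.group × (Fin 4 × ℤˣ), (g : Equiv.Perm (RHat 3)) ''
        demiPacking.ball i = (x.1 : Equiv.Perm (RHat 3)) '' demiPacking.ball x.2 := ⟨(g, i), rfl⟩
    simp only [ψ, dif_pos h]
    exact ((key _ _ _ _).1 h.choose_spec).symm
  refine ⟨φ, ψ, fun g p => HyperplaneModel.apply_extend (hφ g) p, ⟨?_, ?_, ?_⟩, hψ⟩
  · rintro _ ⟨g, hg, _, ⟨i, rfl⟩, rfl⟩
    exact ⟨φ ⟨g, hg⟩, (φ ⟨g, hg⟩).2, _, ⟨_, rfl⟩, hψ ⟨g, hg⟩ i⟩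
  · rintro _ ⟨g, hg, _, ⟨i, rfl⟩, rfl⟩ _ ⟨k, hk, _, ⟨l, rfl⟩, rfl⟩ heq
    exact (key ⟨g, hg⟩ ⟨k, hk⟩ i l).2 (((hψ ⟨g, hg⟩ i).symm.trans heq).trans (hψ ⟨k, hk⟩ l))
  · rintro _ ⟨g', hg', _, ⟨w, rfl⟩, rfl⟩
    obtain ⟨g, hg⟩ := φ.surjective ⟨g', hg'⟩
    obtain ⟨i, rfl⟩ := demiVertexEquiv.surjective w
    refine ⟨(g : Equiv.Perm (RHat 3)) '' demiPacking.ball i, ⟨g, g.2, _, ⟨i, rfl⟩, rfl⟩, ?_⟩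
    rw [hψ, hg]

/-! ### Assembly of the theorem -/

theorem mobiusEquivalent_orthoPacking (v : Fin 4 → Euc 4)
    (hv : ∀ i k, inner ℝ (v i) (v k) = if i = k then 2 else 0)
    (B : PolytopalPacking (crossPolytope 4)) : MobiusEquivalent (orthoPacking v hv) B := by
  obtain ⟨b, hb⟩ := exists_orthonormalBasis_of_orthogonal hv
  refine mobiusEquivalent_of_orthonormalBasis _ B b fun i ε => ?_
  change ((ε : ℤ) : ℝ) • v i = _
  rw [hb, smul_smul]

theorem hasSectionOfType_cube_demiPacking : HasSectionOfType demiPacking (cube 3) := by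
  obtain ⟨φ, ψ, -, hbij, hψ⟩ := exists_cubeSection_bijection
  refine ⟨cubeSection, cubePacking, φ, ψ, hbij, ?_⟩
  rintro g b ⟨i, rfl⟩
  -- Taking g = 1 evaluates the bijection on the seeds.
  have h := hψ 1 i
  simp only [map_one, Subgroup.coe_one, Equiv.Perm.coe_one, Set.image_id] at h
  rw [hψ, h]
  rfl

theorem vertex_standardPacking : standardPacking.vertex = standardOrthoplex := rfl

theorem vertex_demiPacking : demiPacking.vertex = demiOrthoplex := by
  funext i
  change ((i.2 : ℤ) : ℝ) • demiFrame i.1 = _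
  rw [demiFrame, demiOrthoplex, smul_smul, div_eq_mul_inv]

end ApollonianPacking

theorem mainTheorem2 :
    -- every orthoplicial Apollonian packing has a section of each of the three types
    (∀ B : PolytopalPacking (crossPolytope 4),
      HasSectionOfType B tetrahedron ∧ HasSectionOfType B (crossPolytope 3) ∧
        HasSectionOfType B (cube 3)) ∧
    -- the tetrahedral and octahedral sections as cross sections of the standard packing
    (∃ B₀ : PolytopalPacking (crossPolytope 4),
      B₀.vertex = standardOrthoplex ∧ B₀.mob = 1 ∧
      (∀ B : PolytopalPacking (crossPolytope 4), MobiusEquivalent B₀ B) ∧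
      (∃ S : ApollonianSection B₀,
        S.seeds = {b | ∃ i, b = B₀.ball (i, 1)} ∧
        S.group = Subgroup.closure
          {f | ∃ k : Fin 4, IsFacetInversion B₀ (Function.update 1 k (-1)) f} ∧
        ∃ j : Euc 2 →ᵃⁱ[ℝ] Euc 3, Set.range j = {x | x 1 = 1} ∧
        ∃ T : PolytopalPacking tetrahedron, IsCrossSection S j T) ∧
      (∃ S : ApollonianSection B₀,
        S.seeds = {b | ∃ i ε, i ≠ 3 ∧ b = B₀.ball (i, ε)} ∧
        S.group = Subgroup.closure
          {t | ∃ (e₁ e₂ e₃ : ℤˣ) (f g : Equiv.Perm (RHat 3)),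
            IsFacetInversion B₀ ![e₁, e₂, e₃, 1] f ∧
            IsFacetInversion B₀ ![e₁, e₂, e₃, -1] g ∧ t = f * g} ∧
        ∃ j : Euc 2 →ᵃⁱ[ℝ] Euc 3, Set.range j = {x | x 0 = x 1} ∧
        ∃ O : PolytopalPacking (crossPolytope 3), IsCrossSection S j O)) ∧
    -- the cubical section, by projecting the vertices of an orthoplex onto those of a cube
    (∃ B₁ : PolytopalPacking (crossPolytope 4),
      B₁.vertex = demiOrthoplex ∧ B₁.mob = 1 ∧
      (∀ B : PolytopalPacking (crossPolytope 4), MobiusEquivalent B₁ B) ∧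
      ∃ S : ApollonianSection B₁,
        S.seeds = B₁.balls ∧
        S.group = Subgroup.closure
          {f | ∃ e ∈ ({![1, 1, -1, -1], ![1, -1, -1, 1], ![-1, -1, 1, 1], ![-1, 1, 1, -1],
              ![-1, 1, -1, 1], ![1, -1, 1, -1]} : Set (Fin 4 → ℤˣ)), IsFacetInversion B₁ e f} ∧
        ∃ j : Euc 2 →ᵃⁱ[ℝ] Euc 3, Set.range j = {x | x 0 = 0} ∧
        ∃ (C : PolytopalPacking (cube 3)) (σ : Fin 4 × ℤˣ ≃ (Fin 3 → ℤˣ)),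
          C.mob = 1 ∧ (∀ i, C.vertex (σ i) = dropFirst (B₁.vertex i)) ∧
          ∃ (φ : S.group ≃* C.apollonianGroup) (ψ : Set (RHat 3) → Set (RHat 2)),
            (∀ (g : S.group) (p : RHat 2), (g : Equiv.Perm (RHat 3)) (extend j p) =
              extend j ((φ g : Equiv.Perm (RHat 2)) p)) ∧
            Set.BijOn ψ S.carrier C.cluster ∧
            ∀ (g : S.group) (i : Fin 4 × ℤˣ),
              ψ ((g : Equiv.Perm (RHat 3)) '' B₁.ball i) =
                (φ g : Equiv.Perm (RHat 2)) '' C.ball (σ i)) := by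
  refine ⟨fun B => ⟨?_, ?_, ?_⟩, ?_, ?_⟩
  · exact (mobiusEquivalent_orthoPacking _ inner_standardFrame B).hasSectionOfType
      ⟨tetraSection, tetraPacking, isCrossSection_tetraSection.algebraicallyEquivalent⟩
  · exact (mobiusEquivalent_orthoPacking _ inner_standardFrame B).hasSectionOfType
      ⟨octaSection, octaPacking, isCrossSection_octaSection.algebraicallyEquivalent⟩
  · exact (mobiusEquivalent_orthoPacking _ inner_demiFrame B).hasSectionOfType
      hasSectionOfType_cube_demiPacking
  · exact ⟨standardPacking, vertex_standardPacking, rfl,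
      mobiusEquivalent_orthoPacking _ inner_standardFrame,
      ⟨tetraSection, rfl, rfl, tetraPlane, range_tetraPlane, tetraPacking,
        isCrossSection_tetraSection⟩,
      ⟨octaSection, rfl, rfl, octaPlane, range_octaPlane, octaPacking,
        isCrossSection_octaSection⟩⟩
  · exact ⟨demiPacking, vertex_demiPacking, rfl,
      mobiusEquivalent_orthoPacking _ inner_demiFrame,
      cubeSection, rfl, rfl, cubePlane, range_cubePlane, cubePacking, demiVertexEquiv, rfl,
      dropFirst_demiPacking, exists_cubeSection_bijection⟩
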